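/- For nonnegative integers $d_1,d_2,d_3$ with $n=d_1+2d_2+3d_3$ even, let $\mathrm{CM}(d_1,d_2,d_3)$ be the configuration model with $d_i$ vertices of degree $i$ ($i=1,2,3$): the $n$ half-edges attached to the vertices are paired uniformly at random. Explore it as follows. At time $0$ all half-edges are unmatched; the unmatched degree of a vertex is the number of unmatched half-edges attached to it. At each step, as long as there is a vertex of unmatched degree $1$, pick one of these, $\ell$, uniformly at random, reveal its neighbour $v$, and erase all the edges incident to $v$ (with their half-edges). When there is no vertex of unmatched degree $1$ left, the state no longer changes. Let $X^n_k,Y^n_k,Z^n_k$ be the numbers of unmatched half-edges attached to vertices of unmatched degree $1,2,3$ after $k$ steps, and let $\theta^n=\inf\{k\ge 0: X^n_k=0\}$. Let $\mathbf d^n=(d^n_1,d^n_2,d^n_3)$ be degree sequences with $d_1^n+2d_2^n+3d_3^n=n$, where $n\to\infty$ along even integers, and suppose that $$\frac{d^n_1}{n}\to p_1,\qquad \frac{2d^n_2}{n}\to p_2,\qquad \frac{3d^n_3}{n}\to p_3,\qquad\text{with } p_1>0 \text{ or } p_3>0 .$$ For $(\mathscr X,\mathscr Y,\mathscr Z)\in\mathbb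 R^3$ with $\mathscr S=\mathscr X+\mathscr Y+\mathscr Z\neq 0$, write $(\mathbf x,\mathbf y,\mathbf z)=\mathscr S^{-1}(\mathscr X,\mathscr Y,\mathscr Z)$ and $$\phi\begin{pmatrix}\mathscr X\\ \mathscr Y\\ \mathscr Z\end{pmatrix}=\begin{pmatrix} -2\mathbf x-\mathbf y\mathbf z-3\mathbf x^2\mathbf z-2\mathbf y\mathbf x+\mathbf z\mathbf y^2-2\mathbf z\mathbf x\mathbf y-\mathbf z^3-4\mathbf z^2\mathbf x\\ 4\mathbf z^3-2\mathbf x\mathbf y-4\mathbf z\mathbf y^2-4\mathbf x\mathbf y\mathbf z-4\mathbf y^2+4\mathbf z^2\mathbf x\\ -3\mathbf y\mathbf z-3\mathbf z\mathbf y^2-12\mathbf z^2\mathbf y-3\mathbf z\mathbf x^2-6\mathbf x\mathbf y\mathbf z-12\mathbf z^2\mathbf x-9\mathbf z^3 \end{pmatrix}.$$ Then there are a unique $t_{\mathrm{ext}}\in[0,\infty)$ and a unique continuous function $(\mathscr X,\mathscr Y,\mathscr Z):[0,t_{\mathrm{ext}}]\to\mathbb R^3$ with $(\mathscr X,\mathscr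 Y,\mathscr Z)(0)=(p_1,p_2,p_3)$, such that $\mathscr X$ first hits $0$ at time $t_{\mathrm{ext}}$ and $(\mathscr X',\mathscr Y',\mathscr Z')(t)=\phi(\mathscr X(t),\mathscr Y(t),\mathscr Z(t))$ for all $0\le t<t_{\mathrm{ext}}$. Moreover, $$\sup_{t\ge 0}\left\|\frac1n\bigl(X^n_{\lfloor tn\rfloor},Y^n_{\lfloor tn\rfloor},Z^n_{\lfloor tn\rfloor}\bigr)-(\mathscr X,\mathscr Y,\mathscr Z)(t\wedge t_{\mathrm{ext}})\right\|\longrightarrow 0\quad\text{and}\quad \frac{\theta^n}{n}\longrightarrow t_{\mathrm{ext}}$$ in probability as $n\to\infty$. -/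

import Mathlib

open Filter Topology MeasureTheory
open scoped ENNReal

namespace KarpSipser

/-- Numbers of vertices of degree `1`, `2` and `3`. -/
structure DegreeSequence where
  d₁ : ℕ
  d₂ : ℕ
  d₃ : ℕ

/-- The total number `n = d₁ + 2 d₂ + 3 d₃` of half-edges. -/
def DegreeSequence.size (d : DegreeSequence) : ℕ := d.d₁ + 2 * d.d₂ + 3 * d.d₃

abbrev Vertex (d : DegreeSequence) : Type := Fin d.d₁ ⊕ Fin d.d₂ ⊕ Fin d.d₃

def Vertex.degree {d : DegreeSequence} : Vertex d → ℕ
  | .inl _ => 1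
  | .inr (.inl _) => 2
  | .inr (.inr _) => 3

/-- A half-edge is a vertex `h.1` together with one of its slots. -/
abbrev HalfEdge (d : DegreeSequence) : Type := Σ v : Vertex d, Fin (Vertex.degree v)

/-- Perfect matchings of the half-edges, as fixed-point-free involutions; a uniformly random one
is the configuration model. -/
abbrev Pairing (d : DegreeSequence) : Type :=
  {σ : Equiv.Perm (HalfEdge d) // (∀ h, σ (σ h) = h) ∧ ∀ h, σ h ≠ h}

/-- State of the exploration: the configuration, and the set of half-edges that are still
unmatched. -/
abbrev State (d : DegreeSequence) : Type := Pairing d × Finset (HalfEdge d)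

variable {d : DegreeSequence}

/-- Number of unmatched half-edges attached to the vertex `v`. -/
def State.unmatchedDegree (s : State d) (v : Vertex d) : ℕ :=
  (s.2.filter fun h => h.1 = v).card

/-- Unmatched half-edges attached to vertices of unmatched degree `i`. -/
def State.legs (s : State d) (i : ℕ) : Finset (HalfEdge d) :=
  s.2.filter fun h => State.unmatchedDegree s h.1 = i

/-- One step of the leaf-removal algorithm. The leaf `ℓ` is given through its unique unmatched
half-edge `g`. Its neighbour `v = (s.1.1 g).1` is revealed, and all the edges incident to `v` are
erased (the one that joins it to `ℓ` is among them). Vertices of unmatched degree `0` disappear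
from the counts by themselves. -/
def State.remove (s : State d) (g : HalfEdge d) : State d :=
  (s.1, s.2.filter fun h => h.1 ≠ (s.1.1 g).1 ∧ (s.1.1 h).1 ≠ (s.1.1 g).1)

/-- Law of the initial state: the pairing is uniform and every half-edge is unmatched. -/
noncomputable def initialProb (s : State d) : ℝ≥0∞ :=
  if s.2 = Finset.univ then (Fintype.card (Pairing d) : ℝ≥0∞)⁻¹ else 0

open Classical in
/-- Transition probabilities of the exploration: as long as there are leaves, one of them is
chosen uniformly at random and removed together with its neighbour; then the state is frozen.
Leaves correspond bijectively to the elements of `s.legs 1`. -/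
noncomputable def stepProb (s s' : State d) : ℝ≥0∞ :=
  if State.legs s 1 = ∅ then (if s' = s then 1 else 0)
  else (((State.legs s 1).filter fun g => State.remove s g = s').card : ℝ≥0∞) /
    ((State.legs s 1).card : ℝ≥0∞)

/-- `ξ` is (a version of) the leaf-removal exploration of the configuration model with degree
sequence `d`, defined on the probability space `(Ω, P)`. -/
structure IsExploration {Ω : Type*} [MeasurableSpace Ω] (P : Measure Ω)
    (d : DegreeSequence) (ξ : ℕ → Ω → State d) : Prop where
  measurable : ∀ (k : ℕ) (s : State d), MeasurableSet {ω | ξ k ω = s}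
  law : ∀ (k : ℕ) (s : ℕ → State d),
    P {ω | ∀ i ≤ k, ξ i ω = s i} =
      initialProb (s 0) * ∏ i ∈ Finset.range k, stepProb (s i) (s (i + 1))

/-- The rescaled triple `n⁻¹ (X, Y, Z)` in the state `s`, where `X`, `Y`, `Z` are the numbers of
unmatched half-edges attached to vertices of unmatched degree `1`, `2`, `3`. -/
noncomputable def State.rescaled (s : State d) : ℝ × ℝ × ℝ :=
  (((State.legs s 1).card : ℝ) / d.size, ((State.legs s 2).card : ℝ) / d.size,
    ((State.legs s 3).card : ℝ) / d.size)

/-- The first time at which `X = 0`. For an exploration, this time is almost surely finite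
(each step before it removes half-edges), so the default value of `sInf ∅` is
only taken on a null set. -/
noncomputable def extinctionTime {Ω : Type*} (ξ : ℕ → Ω → State d) (ω : Ω) : ℕ :=
  sInf {k : ℕ | (State.legs (ξ k ω) 1).card = 0}

/-- The drift as a function of the proportions `x`, `y`, `z`. -/
def drift (x y z : ℝ) : ℝ × ℝ × ℝ :=
  (-2 * x - y * z - 3 * x ^ 2 * z - 2 * y * x + z * y ^ 2 - 2 * z * x * y - z ^ 3 - 4 * z ^ 2 * x,
   4 * z ^ 3 - 2 * x * y - 4 * z * y ^ 2 - 4 * x * y * z - 4 * y ^ 2 + 4 * z ^ 2 * x,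
   -3 * y * z - 3 * z * y ^ 2 - 12 * z ^ 2 * y - 3 * z * x ^ 2 - 6 * x * y * z - 12 * z ^ 2 * x
     - 9 * z ^ 3)

/-- The vector field `φ`: the drift at the proportion vector `(X, Y, Z) / (X + Y + Z)`. -/
noncomputable def phi (u : ℝ × ℝ × ℝ) : ℝ × ℝ × ℝ :=
  let S := u.1 + u.2.1 + u.2.2
  drift (u.1 / S) (u.2.1 / S) (u.2.2 / S)

/-- `γ` restricted to `[0, T]` is a solution of `γ' = φ(γ)` started at `p` and run until its first
coordinate first hits `0`, at time `T`. -/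
structure IsFluidSolution (p : ℝ × ℝ × ℝ) (T : ℝ) (γ : ℝ → ℝ × ℝ × ℝ) : Prop where
  nonneg : 0 ≤ T
  continuousOn : ContinuousOn γ (Set.Icc 0 T)
  initial : γ 0 = p
  hasDeriv : ∀ t ∈ Set.Ico 0 T, HasDerivWithinAt γ (phi (γ t)) (Set.Icc 0 T) t
  ne_zero : ∀ t ∈ Set.Ico 0 T, (γ t).1 ≠ 0
  hits : (γ T).1 = 0

end KarpSipser

open KarpSipser

/-! This is the differential equation method: a law of large numbers for a chain with bounded
increments, plus a separate argument near extinction, where the fluid limit alone does not control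
the leaves.

Exchangeability. A step from `A` to `A'` consults the pairing only outside `A'`. So, given the
history of unmatched sets, the pairing of the half-edges still unmatched is invariant under
exchanging two of them (`pathWeight_swapPairing`). The leaf's neighbour `v` is therefore reached
through an almost uniform unmatched half-edge, and the other half-edges of `v` have almost uniform
partners. Loops and parallel edges at `v` have probability O(1/|A|). The mean change of the three
counts is thus `phi` of the rescaled triple up to O(1/|A|)
(`abs_sum_weight_potential_change_sub_le`, `phi_rescaledOf`). Each step erases at most six
half-edges, so while |A| ≥ δn the accumulated noise has second moment O(n) over O(n) steps.
Chebyshev's inequality on a finite grid makes it uniformly o(n) (`exists_measure_noiseSum_le`), and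
a discrete Grönwall inequality gives closeness to the fluid curve as long as leaves remain and the
fluid mass is bounded below (`tendsto_measure_fluid`).

The fluid equation. Put S for the mass and q = 1 + y + 2z. On the simplex S' = -2q and Z' = -3qZ/S,
so C = Z/S^(3/2) and K = q² - 4z are conserved. The trajectory is then explicit in r = √S, and S
solves a scalar autonomous equation. Positivity of X amounts to K < 4 + C²S. If K ≤ 4, X stays
positive until all mass is gone. If K > 4, X vanishes at S = (K - 4)/C² > 0 and becomes negative
afterwards. The hypothesis on p₁ and p₃ excludes K = 4, C = 0, where X is identically 0.

Extinction. Comparison is made up to tExt - η, where X is bounded below, so leaves persist. Beyond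
that, either few half-edges are left and every step uses up two of them, or the fluid X soon turns
negative, which the true count cannot do. In both cases the process freezes by tExt + η
(`tendsto_measure_not_dead`), and it moves only O(η) in between. -/

namespace KarpSipser

/-! ### The fluid limit -/

/-- The total mass of a triple. -/
def mass (u : ℝ × ℝ × ℝ) : ℝ := u.1 + u.2.1 + u.2.2

theorem continuous_mass : Continuous mass := by
  unfold mass; fun_prop

theorem abs_mass_sub_le (u v : ℝ × ℝ × ℝ) : |mass u - mass v| ≤ 3 * ‖u - v‖ := by
  have h1 : |u.1 - v.1| ≤ ‖u - v‖ := norm_fst_le (u - v)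
  have h2 : |u.2.1 - v.2.1| ≤ ‖u - v‖ := (norm_fst_le (u - v).2).trans (norm_snd_le (u - v))
  have h3 : |u.2.2 - v.2.2| ≤ ‖u - v‖ := (norm_snd_le (u - v).2).trans (norm_snd_le (u - v))
  rw [abs_le] at *
  unfold mass
  constructor <;> linarith [h1.1, h1.2, h2.1, h2.2, h3.1, h3.2]

/-- The drift on the simplex `x + y + z = 1`. -/
theorem drift_eq_of_sum_eq_one {x y z : ℝ} (h : x + y + z = 1) :
    drift x y z = (-1 - x + (y + 2 * z) * (y - x), -2 * y + (y + 2 * z) * (2 * z - 2 * y),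
      -3 * z - 3 * z * (y + 2 * z)) := by
  obtain rfl : x = 1 - y - z := by linarith
  unfold drift
  refine Prod.ext ?_ (Prod.ext ?_ ?_) <;> simp only <;> ring

theorem contDiffOn_drift {a b c : ℝ × ℝ × ℝ → ℝ} {s : Set (ℝ × ℝ × ℝ)} (ha : ContDiffOn ℝ 1 a s)
    (hb : ContDiffOn ℝ 1 b s) (hc : ContDiffOn ℝ 1 c s) :
    ContDiffOn ℝ 1 (fun u => drift (a u) (b u) (c u)) s := by
  unfold drift; fun_prop

theorem contDiffOn_phi : ContDiffOn ℝ 1 phi {u | mass u ≠ 0} := by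
  have hS : ContDiffOn ℝ 1 mass {u | mass u ≠ 0} := by
    unfold mass; fun_prop
  have h1 : ContDiffOn ℝ 1 (fun u => u.1 / mass u) {u | mass u ≠ 0} :=
    contDiffOn_fst.div hS fun u hu => hu
  have h2 : ContDiffOn ℝ 1 (fun u => u.2.1 / mass u) {u | mass u ≠ 0} :=
    (contDiff_fst.comp contDiff_snd).contDiffOn.div hS fun u hu => hu
  have h3 : ContDiffOn ℝ 1 (fun u => u.2.2 / mass u) {u | mass u ≠ 0} :=
    (contDiff_snd.comp contDiff_snd).contDiffOn.div hS fun u hu => hu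
  exact contDiffOn_drift h1 h2 h3

theorem continuousOn_phi : ContinuousOn phi {u | mass u ≠ 0} := contDiffOn_phi.continuousOn

theorem isOpen_mass_ne_zero : IsOpen {u | mass u ≠ 0} :=
  isOpen_ne_fun continuous_mass continuous_const

/-- `φ` is Lipschitz on bounded sets where the total mass is bounded below. -/
theorem exists_lipschitzOnWith_phi {δ : ℝ} (hδ : 0 < δ) (R : ℝ) :
    ∃ L, LipschitzOnWith L phi {u | ‖u‖ ≤ R ∧ δ ≤ mass u} := by
  have hset : {u : ℝ × ℝ × ℝ | ‖u‖ ≤ R ∧ δ ≤ mass u} =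
      Metric.closedBall 0 R ∩ {u | δ ≤ mass u} := by
    ext u; simp
  have hconv : Convex ℝ {u : ℝ × ℝ × ℝ | δ ≤ mass u} := by
    have : IsLinearMap ℝ mass := by
      constructor <;> intros <;> simp [mass] <;> ring
    exact convex_halfSpace_ge this δ
  rw [hset]
  refine ContDiffOn.exists_lipschitzOnWith (n := 1) ?_ one_ne_zero ?_ ?_
  · exact contDiffOn_phi.mono fun u hu => (hδ.trans_le hu.2).ne'
  · exact (convex_closedBall _ _).inter hconv
  · exact (isCompact_closedBall _ _).inter_right (isClosed_le continuous_const continuous_mass)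

/-- Global flow of a scalar autonomous equation `S' = -g(S)`, `S(0) = 1`, where the continuous
function `g` is bounded between positive constants. -/
theorem exists_scalar_flow (g : ℝ → ℝ) (hg : Continuous g) {m M : ℝ} (hm : 0 < m)
    (hmg : ∀ s, m ≤ g s) (hgM : ∀ s, g s ≤ M) :
    ∃ S : ℝ → ℝ, S 0 = 1 ∧ StrictAnti S ∧ Function.Surjective S ∧
      ∀ t, HasDerivAt S (-g (S t)) t := by
  have hpos : ∀ s, 0 < g s := fun s => hm.trans_le (hmg s)
  have hM : 0 < M := (hpos 0).trans_le (hgM 0)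
  have hinv : Continuous fun s => (g s)⁻¹ := hg.inv₀ fun s => (hpos s).ne'
  -- Separation of variables: the solution satisfies H(S(t)) = -t, so S is obtained by inverting
  -- `H`.
  set H : ℝ → ℝ := fun s => ∫ x in (1 : ℝ)..s, (g x)⁻¹ with hH
  have hder : ∀ s, HasDerivAt H (g s)⁻¹ s := fun s =>
    intervalIntegral.integral_hasDerivAt_right (hinv.intervalIntegrable _ _)
      (hinv.stronglyMeasurableAtFilter _ _) hinv.continuousAt
  have hmono : StrictMono H := strictMono_of_deriv_pos fun s => by
    rw [(hder s).deriv]; exact inv_pos.2 (hpos s)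
  have hcont : Continuous H := continuous_iff_continuousAt.2 fun s => (hder s).continuousAt
  have hH1 : H 1 = 0 := by simp [hH]
  -- The upper bound on `g` makes `H` grow at rate at least 1/M, hence surjective; this is what
  -- makes the flow global.
  have hmono' : Monotone fun s => H s - M⁻¹ * s := by
    have hd : ∀ s, HasDerivAt (fun s => H s - M⁻¹ * s) ((g s)⁻¹ - M⁻¹ * 1) s := fun s =>
      (hder s).sub ((hasDerivAt_id s).const_mul _)
    refine monotone_of_deriv_nonneg (fun s => (hd s).differentiableAt) fun s => ?_
    rw [(hd s).deriv, mul_one, sub_nonneg]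
    exact inv_anti₀ (hpos s) (hgM s)
  have htop : Tendsto H atTop atTop := by
    refine tendsto_atTop_mono' _ (f₁ := fun s => M⁻¹ * s - M⁻¹) ?_ ?_
    · filter_upwards [eventually_ge_atTop 1] with s hs
      have := hmono' hs
      simp only [hH1] at this
      linarith
    · exact tendsto_atTop_add_const_right _ _ (tendsto_id.const_mul_atTop (inv_pos.2 hM))
  have hbot : Tendsto H atBot atBot := by
    refine tendsto_atBot_mono' _ (f₁ := fun s => M⁻¹ * s - M⁻¹) ?_ ?_
    · filter_upwards [eventually_le_atBot 1] with s hs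
      have := hmono' hs
      simp only [hH1] at this
      linarith
    · exact tendsto_atBot_add_const_right _ _ (tendsto_id.const_mul_atBot (inv_pos.2 hM))
  set e := hmono.orderIsoOfSurjective H (hcont.surjective htop hbot) with he
  have hHe : ∀ t, H (e.symm t) = t := fun t => e.apply_symm_apply t
  refine ⟨fun t => e.symm (-t), ?_, ?_, ?_, fun t => ?_⟩
  · apply hmono.injective
    simp only [hHe, hH1, neg_zero]
  · exact fun a b hab => e.symm.strictMono (neg_lt_neg hab)
  · intro s
    refine ⟨-H s, ?_⟩
    apply hmono.injective
    simp only [hHe, neg_neg]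
  · have h1 : HasDerivAt e.symm ((g (e.symm (-t)))⁻¹)⁻¹ (-t) :=
      HasDerivAt.of_local_left_inverse e.symm.continuous.continuousAt (hder _)
        (inv_pos.2 (hpos _)).ne' (Eventually.of_forall hHe)
    rw [inv_inv] at h1
    exact (h1.comp t (hasDerivAt_neg t)).congr_deriv (by simp)

/-- The fluid trajectory as a function of `r`, the square root of the total mass. The constants
`C = Z / S ^ (3 / 2)` and `K = (1 + y + 2 z) ^ 2 - 4 z` are first integrals of the equation. -/
noncomputable def fluidCurve (C K r : ℝ) : ℝ × ℝ × ℝ :=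
  (r ^ 2 * (2 - √(K + 4 * C * r) + C * r), r ^ 2 * (√(K + 4 * C * r) - 1 - 2 * (C * r)),
    r ^ 2 * (C * r))

theorem mass_fluidCurve (C K r : ℝ) : mass (fluidCurve C K r) = r ^ 2 := by
  simp only [mass, fluidCurve]; ring

theorem continuous_fluidCurve (C K : ℝ) : Continuous (fluidCurve C K) := by
  unfold fluidCurve; fun_prop

theorem phi_fluidCurve {C K r : ℝ} (hr : r ≠ 0) :
    phi (fluidCurve C K r) =
      drift (2 - √(K + 4 * C * r) + C * r) (√(K + 4 * C * r) - 1 - 2 * (C * r)) (C * r) := by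
  have hm : (fluidCurve C K r).1 + (fluidCurve C K r).2.1 + (fluidCurve C K r).2.2 = r ^ 2 :=
    mass_fluidCurve C K r
  have h2 : r ^ 2 ≠ 0 := pow_ne_zero 2 hr
  simp only [phi, hm]
  simp only [fluidCurve, mul_div_cancel_left₀ _ h2]

/-- If the total mass `S` solves the scalar equation, then the curve solves `γ' = φ(γ)`. -/
theorem hasDerivAt_fluidCurve {C K : ℝ} (hC : 0 ≤ C) (hK : 0 < K) {S : ℝ → ℝ} {t : ℝ}
    (hS : 0 < S t) (hd : HasDerivAt S (-(2 * √(K + 4 * C * √(S t)))) t) :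
    HasDerivAt (fun t => fluidCurve C K √(S t)) (phi (fluidCurve C K √(S t))) t := by
  have hr : 0 < √(S t) := Real.sqrt_pos.2 hS
  -- On the curve q = √(K + 4Cr) equals 1 + y + 2z. From S' = -2q follow r' = -q/r and then q' =
  -- -2C/r; the rest is algebra.
  have hdr : HasDerivAt (fun t => √(S t)) (-√(K + 4 * C * √(S t)) / √(S t)) t := by
    refine (hd.sqrt hS.ne').congr_deriv ?_
    field_simp
  rw [phi_fluidCurve hr.ne', drift_eq_of_sum_eq_one (by ring)]
  set r : ℝ → ℝ := fun t => √(S t) with hrdef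
  change 0 < r t at hr
  change HasDerivAt r (-√(K + 4 * C * r t) / r t) t at hdr
  change HasDerivAt (fun t => fluidCurve C K (r t)) _ t
  change HasDerivAt _ (-1 - (2 - √(K + 4 * C * r t) + C * r t) + (_ - 1 - 2 * (C * r t) + _) * _,
    _, _) t
  have hq0 : 0 < K + 4 * C * r t := by positivity
  have hdq : HasDerivAt (fun t => √(K + 4 * C * r t)) (-(2 * C) / r t) t := by
    have h1 : HasDerivAt (fun t => K + 4 * C * r t)
        (4 * C * (-√(K + 4 * C * r t) / r t)) t := (hdr.const_mul (4 * C)).const_add K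
    refine (h1.sqrt hq0.ne').congr_deriv ?_
    have := Real.sqrt_pos.2 hq0
    field_simp
    ring
  set q : ℝ → ℝ := fun t => √(K + 4 * C * r t) with hqdef
  have hd2 : HasDerivAt (fun t => r t ^ 2) (-2 * q t) t := by
    refine (hdr.pow 2).congr_deriv ?_
    change _ * _ * (- q t / r t) = _
    field_simp
    norm_num
    ring
  have hCr := hdr.const_mul C
  have hX : HasDerivAt (fun t => r t ^ 2 * (2 - q t + C * r t)) _ t :=
    hd2.mul ((hdq.const_sub 2).add hCr)
  have hY : HasDerivAt (fun t => r t ^ 2 * (q t - 1 - 2 * (C * r t))) _ t :=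
    hd2.mul ((hdq.sub_const 1).sub (hCr.const_mul 2))
  have hZ : HasDerivAt (fun t => r t ^ 2 * (C * r t)) _ t := hd2.mul hCr
  refine (hX.prodMk (hY.prodMk hZ)).congr_deriv ?_
  change (-2 * q t * (2 - q t + C * r t) + r t ^ 2 * (-(-(2 * C) / r t) + C * (-q t / r t)),
    -2 * q t * (q t - 1 - 2 * (C * r t)) +
      r t ^ 2 * (-(2 * C) / r t - 2 * (C * (-q t / r t))),
    -2 * q t * (C * r t) + r t ^ 2 * (C * (-q t / r t))) =
    (-1 - (2 - q t + C * r t) + (q t - 1 - 2 * (C * r t) + 2 * (C * r t)) *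
      (q t - 1 - 2 * (C * r t) - (2 - q t + C * r t)),
      -2 * (q t - 1 - 2 * (C * r t)) + (q t - 1 - 2 * (C * r t) + 2 * (C * r t)) *
      (2 * (C * r t) - 2 * (q t - 1 - 2 * (C * r t))),
      -3 * (C * r t) - 3 * (C * r t) * (q t - 1 - 2 * (C * r t) + 2 * (C * r t)))
  refine Prod.ext ?_ (Prod.ext ?_ ?_) <;> simp only <;> field_simp <;> ring

/-- X has the sign of 2 + Cr - √(K + 4Cr), and the terms 4Cr cancel on squaring. -/
theorem fluidCurve_fst_pos_iff {C K r : ℝ} (hC : 0 ≤ C) (hr : 0 < r) :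
    0 < (fluidCurve C K r).1 ↔ K < 4 + (C * r) ^ 2 := by
  have h0 : 0 ≤ C * r := by positivity
  have : 0 < (fluidCurve C K r).1 ↔ √(K + 4 * C * r) < 2 + C * r := by
    simp only [fluidCurve]
    rw [mul_pos_iff_of_pos_left (by positivity)]
    constructor <;> intro h <;> linarith
  rw [this, Real.sqrt_lt' (by positivity)]
  constructor <;> intro h <;> nlinarith

theorem fluidCurve_fst_neg_iff {C K r : ℝ} (hC : 0 ≤ C) (hr : 0 < r) :
    (fluidCurve C K r).1 < 0 ↔ 4 + (C * r) ^ 2 < K := by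
  have h0 : 0 ≤ C * r := by positivity
  have : (fluidCurve C K r).1 < 0 ↔ 2 + C * r < √(K + 4 * C * r) := by
    simp only [fluidCurve]
    rw [← neg_pos, ← mul_neg, mul_pos_iff_of_pos_left (by positivity)]
    constructor <;> intro h <;> linarith
  rw [this, Real.lt_sqrt (by positivity)]
  constructor <;> intro h <;> nlinarith

/-- A solution `γ` of the fluid equation whose first coordinate hits `0` at time `tExt`. It either
dies with all its mass, or it can be continued beyond `tExt` and its first coordinate then becomes
negative. -/
structure IsFluidTrajectory (p : ℝ × ℝ × ℝ) (tExt : ℝ) (γ : ℝ → ℝ × ℝ × ℝ) : Prop where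
  nonneg : 0 ≤ tExt
  continuous : Continuous γ
  initial : γ 0 = p
  pos : ∀ t ∈ Set.Ico 0 tExt, 0 < (γ t).1 ∧ 0 < mass (γ t)
  hits : (γ tExt).1 = 0
  hasDerivAt : ∀ t, 0 ≤ t → 0 < mass (γ t) → HasDerivAt γ (phi (γ t)) t
  end_cases : γ tExt = 0 ∨ ∀ η > 0, ∃ T ∈ Set.Ioo tExt (tExt + η), (γ T).1 < 0 ∧
    ∀ t ∈ Set.Icc 0 T, 0 < mass (γ t)

/-- Existence of the fluid trajectory. -/
theorem exists_fluid_trajectory {p₁ p₂ C : ℝ} (h₁ : 0 ≤ p₁) (h₂ : 0 ≤ p₂) (h₃ : 0 ≤ C)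
    (hsum : p₁ + p₂ + C = 1) (hp : 0 < p₁ ∨ 0 < C) :
    ∃ (tExt : ℝ) (γ : ℝ → ℝ × ℝ × ℝ), IsFluidTrajectory (p₁, p₂, C) tExt γ := by
  set K := (1 + p₂ + 2 * C) ^ 2 - 4 * C with hKdef
  have hK : 1 ≤ K := by rw [hKdef]; nlinarith [mul_nonneg h₂ h₃, sq_nonneg p₂, sq_nonneg C]
  have hK0 : 0 < K := by linarith
  -- Truncation at the initial mass 1 keeps `g` bounded. For negative `s` the inner square root is
  -- 0, so `g` is constant there. The lower bound 2 comes from K ≥ 1.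
  set g : ℝ → ℝ := fun s => 2 * √(K + 4 * C * √(min s 1)) with hg
  obtain ⟨S, hS0, hSanti, hSsurj, hSd⟩ := exists_scalar_flow g (by fun_prop) (m := 2)
    (M := 2 * √(K + 4 * C)) two_pos
    (fun s => by
      have : 1 ≤ √(K + 4 * C * √(min s 1)) := Real.one_le_sqrt.2 (by
        have : 0 ≤ 4 * C * √(min s 1) := by positivity
        linarith)
      simp only [hg]; linarith)
    (fun s => by
      have h1 : √(min s 1) ≤ 1 := Real.sqrt_le_one.2 (min_le_right _ _)
      simp only [hg]
      have h2 : 4 * C * √(min s 1) ≤ 4 * C := by nlinarith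
      gcongr)
  have hScont : Continuous S := continuous_iff_continuousAt.2 fun t => (hSd t).continuousAt
  set γ : ℝ → ℝ × ℝ × ℝ := fun t => fluidCurve C K √(S t) with hγ
  have hmass : ∀ t, mass (γ t) = √(S t) ^ 2 := fun t => mass_fluidCurve _ _ _
  have hmass_pos : ∀ t, 0 < mass (γ t) ↔ 0 < S t := fun t => by
    rw [hmass]
    constructor
    · intro h
      by_contra hn
      simp [Real.sqrt_eq_zero_of_nonpos (not_lt.1 hn)] at h
    · intro h
      have := Real.sqrt_pos.2 h
      positivity
  have hγ0 : γ 0 = (p₁, p₂, C) := by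
    have hq : √(K + 4 * C * 1) = 1 + p₂ + 2 * C := by
      rw [show K + 4 * C * 1 = (1 + p₂ + 2 * C) ^ 2 by rw [hKdef]; ring]
      exact Real.sqrt_sq (by positivity)
    simp only [hγ, hS0, Real.sqrt_one, fluidCurve, hq]
    refine Prod.ext ?_ (Prod.ext ?_ ?_) <;> simp only <;> linarith
  have hcont : Continuous γ := (continuous_fluidCurve C K).comp (Real.continuous_sqrt.comp hScont)
  have hode : ∀ t, 0 ≤ t → 0 < mass (γ t) → HasDerivAt γ (phi (γ t)) t := by
    intro t ht hm
    have hSt := (hmass_pos t).1 hm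
    have hSle : S t ≤ 1 := hS0 ▸ hSanti.antitone ht
    refine hasDerivAt_fluidCurve h₃ hK0 hSt ?_
    have := hSd t
    simp only [hg, min_eq_left hSle] at this
    exact this
  -- This is p₁ ≥ 0 read at r = 1. When K > 4 it forces C > 0 and (K - 4)/C² ≤ 1, so the zero of X
  -- does not lie in the past.
  have hx0 : K ≤ 4 + C ^ 2 := by
    rw [hKdef]
    have : 1 + p₂ + 2 * C ≤ 2 + C := by linarith
    nlinarith
  rcases le_or_gt K 4 with hK4 | hK4
  · obtain ⟨tExt, ht⟩ := hSsurj 0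
    have ht0 : 0 ≤ tExt := by
      by_contra hn
      have := hSanti (not_le.1 hn)
      rw [hS0, ht] at this
      linarith
    have hend : γ tExt = 0 := by
      simp only [hγ, ht, Real.sqrt_zero, fluidCurve]
      simp
    refine ⟨tExt, γ, ht0, hcont, hγ0, fun t htt => ?_, by rw [hend]; rfl, hode, Or.inl hend⟩
    have hSt : 0 < S t := by simpa [ht] using hSanti htt.2
    refine ⟨(fluidCurve_fst_pos_iff h₃ (Real.sqrt_pos.2 hSt)).2 ?_, (hmass_pos t).2 hSt⟩
    -- With C = 0 the strict inequality K < 4 is needed, and p₁ > 0 provides it.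
    rcases h₃.eq_or_lt with hC0 | hC0
    · have hp1 : 0 < p₁ := hp.resolve_right (by rw [← hC0]; exact lt_irrefl _)
      have : K < 4 := by
        rw [hKdef, ← hC0]
        have : p₂ < 1 := by linarith
        nlinarith
      have := sq_nonneg (C * √(S t))
      linarith
    · have h := mul_pos hC0 (Real.sqrt_pos.2 hSt)
      have : 0 < (C * √(S t)) ^ 2 := by positivity
      linarith
  · have hC0 : 0 < C := by
      rcases h₃.eq_or_lt with hC0 | hC0
      · rw [← hC0] at hx0; linarith
      · exact hC0
    -- The mass at which X vanishes.
    set s := (K - 4) / C ^ 2 with hs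
    have hs0 : 0 < s := div_pos (by linarith) (by positivity)
    have hs1 : s ≤ 1 := by rw [hs, div_le_one (by positivity)]; linarith
    obtain ⟨tExt, ht⟩ := hSsurj s
    have hsC : C ^ 2 * s = K - 4 := by rw [hs]; field_simp
    have ht0 : 0 ≤ tExt := by
      by_contra hn
      have := hSanti (not_le.1 hn)
      rw [hS0, ht] at this
      linarith
    have hsq : ∀ t, 0 < S t → (C * √(S t)) ^ 2 = C ^ 2 * S t := fun t h => by
      rw [mul_pow, Real.sq_sqrt h.le]
    have hpos_iff : ∀ t, 0 < S t → (0 < (γ t).1 ↔ s < S t) := fun t h => by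
      rw [hγ, fluidCurve_fst_pos_iff h₃ (Real.sqrt_pos.2 h), hsq t h]
      rw [show K = 4 + C ^ 2 * s by linarith, add_lt_add_iff_left,
        mul_lt_mul_iff_right₀ (by positivity)]
    have hneg_iff : ∀ t, 0 < S t → ((γ t).1 < 0 ↔ S t < s) := fun t h => by
      rw [hγ, fluidCurve_fst_neg_iff h₃ (Real.sqrt_pos.2 h), hsq t h]
      rw [show K = 4 + C ^ 2 * s by linarith, add_lt_add_iff_left,
        mul_lt_mul_iff_right₀ (by positivity)]
    refine ⟨tExt, γ, ht0, hcont, hγ0, fun t htt => ?_, ?_, hode, Or.inr fun η hη => ?_⟩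
    · have hSt : s < S t := by simpa [ht] using hSanti htt.2
      exact ⟨(hpos_iff t (hs0.trans hSt)).2 hSt, (hmass_pos t).2 (hs0.trans hSt)⟩
    · have h1 := (hpos_iff tExt (by rw [ht]; exact hs0)).not
      have h2 := (hneg_iff tExt (by rw [ht]; exact hs0)).not
      rw [ht] at h1 h2
      exact le_antisymm (not_lt.1 (h1.2 (lt_irrefl _))) (not_lt.1 (h2.2 (lt_irrefl _)))
    -- Just after tExt the mass is below `s`, so X < 0; stopping no later than the time when S = s/2
    -- keeps the mass positive.
    · obtain ⟨T', hT'⟩ := hSsurj (s / 2)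
      have hlt : tExt < T' := by
        by_contra hn
        have := hSanti.antitone (not_lt.1 hn)
        rw [ht, hT'] at this
        linarith
      refine ⟨min T' (tExt + η / 2), ⟨lt_min hlt (by linarith), ?_⟩, ?_, ?_⟩
      · exact (min_le_right _ _).trans_lt (by linarith)
      · have h1 : s / 2 ≤ S (min T' (tExt + η / 2)) := hT' ▸ hSanti.antitone (min_le_left _ _)
        refine (hneg_iff _ (by linarith)).2 ?_
        exact ht ▸ hSanti (lt_min hlt (by linarith))
      · intro t htt
        have h1 : s / 2 ≤ S t := hT' ▸ hSanti.antitone (htt.2.trans (min_le_left _ _))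
        exact (hmass_pos t).2 (by linarith)

/-- Local uniqueness for `γ' = φ(γ)` away from the set where the total mass vanishes. -/
theorem eqOn_of_fluid_solutions {γ η : ℝ → ℝ × ℝ × ℝ} {T : ℝ}
    (hγc : ContinuousOn γ (Set.Icc 0 T)) (hηc : ContinuousOn η (Set.Icc 0 T))
    (h0 : γ 0 = η 0)
    (hγ : ∀ t ∈ Set.Ico 0 T, HasDerivWithinAt γ (phi (γ t)) (Set.Ici t) t)
    (hη : ∀ t ∈ Set.Ico 0 T, HasDerivWithinAt η (phi (η t)) (Set.Ici t) t)
    (hm : ∀ t ∈ Set.Ico 0 T, mass (γ t) ≠ 0) : Set.EqOn γ η (Set.Icc 0 T) := by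
  rcases lt_or_ge T 0 with hT | hT
  · simp [Set.Icc_eq_empty (not_le.2 hT)]
  have hclosed : IsClosed ({t | γ t = η t} ∩ Set.Icc 0 T) := by
    have := (hγc.prodMk hηc).preimage_isClosed_of_isClosed isClosed_Icc isClosed_diagonal
    convert this using 1
    ext t; simp [and_comm]
  -- Continuous induction: the set of agreement is closed, and at a point of agreement local
  -- Lipschitz uniqueness extends it to the right. Nonzero mass is needed for one curve only, since
  -- both take the same value there.
  refine fun t ht => hclosed.Icc_subset_of_forall_exists_gt (by exact h0) ?_ ht
  rintro x ⟨hx, hxT⟩ y hy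
  change γ x = η x at hx
  obtain ⟨L, N, hN, hL⟩ :=
    (contDiffOn_phi.contDiffAt (isOpen_mass_ne_zero.mem_nhds (hm x hxT))).exists_lipschitzOnWith
  have hev : ∀ {f : ℝ → ℝ × ℝ × ℝ}, ContinuousOn f (Set.Icc 0 T) → N ∈ 𝓝 (f x) →
      ∀ᶠ t in 𝓝[≥] x, f t ∈ N := by
    intro f hf hfN
    have hc : ContinuousWithinAt f (Set.Ici x) x := by
      refine (hf x ⟨hxT.1, hxT.2.le⟩).mono_of_mem_nhdsWithin ?_
      exact Icc_mem_nhdsGE_of_mem hxT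
    exact hc hfN
  have h1 := (hev hγc hN).and (hev hηc (hx ▸ hN))
  obtain ⟨b, hb, hbN⟩ := (mem_nhdsGE_iff_exists_Ico_subset' hy).1 h1
  have hxb : x < min b (min y T) := lt_min hb (lt_min hy hxT.2)
  set c := min b (min y T) with hc
  have hcb : c ≤ b := min_le_left _ _
  have hcy : c ≤ y := (min_le_right _ _).trans (min_le_left _ _)
  have hcT : c ≤ T := (min_le_right _ _).trans (min_le_right _ _)
  have hsub : Set.Ico x c ⊆ Set.Ico 0 T := fun t ht => ⟨hxT.1.trans ht.1, ht.2.trans_le hcT⟩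
  have hsub' : Set.Icc x c ⊆ Set.Icc 0 T := fun t ht => ⟨hxT.1.trans ht.1, ht.2.trans hcT⟩
  have := ODE_solution_unique_of_mem_Icc_right (v := fun _ => phi) (s := fun _ => N) (K := L)
    (a := x) (b := c) (f := γ) (g := η) (fun _ _ => hL) (hγc.mono hsub')
    (fun t ht => hγ t (hsub ht)) (fun t ht => (hbN ⟨ht.1, ht.2.trans_le hcb⟩).1) (hηc.mono hsub')
    (fun t ht => hη t (hsub ht)) (fun t ht => (hbN ⟨ht.1, ht.2.trans_le hcb⟩).2) hx
  exact ⟨c, this ⟨hxb.le, le_rfl⟩, hxb, hcy⟩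

theorem IsFluidTrajectory.isFluidSolution {p : ℝ × ℝ × ℝ} {tExt : ℝ} {γ : ℝ → ℝ × ℝ × ℝ}
    (hγ : IsFluidTrajectory p tExt γ) : IsFluidSolution p tExt γ where
  nonneg := hγ.nonneg
  continuousOn := hγ.continuous.continuousOn
  initial := hγ.initial
  hasDeriv t ht := (hγ.hasDerivAt t ht.1 (hγ.pos t ht).2).hasDerivWithinAt
  ne_zero t ht := (hγ.pos t ht).1.ne'
  hits := hγ.hits

/-- The fluid solution is unique. -/
theorem IsFluidTrajectory.eq_of_isFluidSolution {p : ℝ × ℝ × ℝ} {tExt T : ℝ}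
    {γ η : ℝ → ℝ × ℝ × ℝ} (hγ : IsFluidTrajectory p tExt γ) (hη : IsFluidSolution p T η) :
    T = tExt ∧ Set.EqOn η γ (Set.Icc 0 tExt) := by
  obtain ⟨ht, hγc, hγ0, hpos, hhit, hode, -⟩ := hγ
  have key : Set.EqOn γ η (Set.Icc 0 (min T tExt)) := by
    refine eqOn_of_fluid_solutions hγc.continuousOn
      (hη.continuousOn.mono (Set.Icc_subset_Icc_right (min_le_left _ _)))
      (by rw [hγ0, hη.initial]) (fun t htt => ?_) (fun t htt => ?_) fun t htt => ?_
    · have h := hpos t ⟨htt.1, htt.2.trans_le (min_le_right _ _)⟩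
      exact (hode t htt.1 h.2).hasDerivWithinAt
    · have htT : t ∈ Set.Ico 0 T := ⟨htt.1, htt.2.trans_le (min_le_left _ _)⟩
      exact (hη.hasDeriv t htT).mono_of_mem_nhdsWithin (Icc_mem_nhdsGE_of_mem htT)
    · exact (hpos t ⟨htt.1, htt.2.trans_le (min_le_right _ _)⟩).2.ne'
  have hend := key ⟨le_min hη.nonneg ht, le_rfl⟩
  -- If the times differed, the curve stopping first would have X = 0 where the other still has X ≠
  -- 0.
  have hT : T = tExt := by
    rcases lt_trichotomy T tExt with h | h | h
    · rw [min_eq_left h.le] at hend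
      have := (hpos T ⟨hη.nonneg, h⟩).1
      rw [hend, hη.hits] at this
      exact absurd this (lt_irrefl _)
    · exact h
    · rw [min_eq_right h.le] at hend
      exact absurd (hend ▸ hhit) (hη.ne_zero tExt ⟨ht, h⟩)
  subst hT
  rw [min_self] at key
  exact ⟨rfl, key.symm⟩

/-! ### Averages over nested finite sets -/

section Average
variable {H : Type*}

/-- The average of `L` over the finite set `B`. -/
noncomputable def avg (B : Finset H) (L : H → ℝ) : ℝ := (∑ m ∈ B, L m) / B.card

theorem abs_avg_le {B : Finset H} {L : H → ℝ} {c : ℝ} (hc : 0 ≤ c) (hL : ∀ m ∈ B, |L m| ≤ c) :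
    |avg B L| ≤ c := by
  unfold avg
  rw [abs_div, Nat.abs_cast]
  refine div_le_of_le_mul₀ (by positivity) hc ?_
  calc |∑ m ∈ B, L m| ≤ ∑ m ∈ B, |L m| := Finset.abs_sum_le_sum_abs _ _
    _ ≤ ∑ _m ∈ B, c := Finset.sum_le_sum hL
    _ = c * B.card := by rw [Finset.sum_const, nsmul_eq_mul, mul_comm]

/-- Excluding boundedly many half-edges costs O(1/|A|), because |A| (avg B - avg A) = |A \ B| avg B
- ∑ over A \ B of L. -/
theorem abs_avg_sub_avg_le [DecidableEq H] {A B : Finset H} (hBA : B ⊆ A) (hB : B.Nonempty) {L : H → ℝ} {c : ℝ}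
    (hc : 0 ≤ c) (hL : ∀ m ∈ A, |L m| ≤ c) :
    |avg B L - avg A L| ≤ 2 * c * (A \ B).card / A.card := by
  have hB0 : (0 : ℝ) < B.card := by exact_mod_cast hB.card_pos
  have hA0 : (0 : ℝ) < A.card := by exact_mod_cast (hB.mono hBA).card_pos
  have hcard : (A.card : ℝ) = (A \ B).card + B.card := by
    exact_mod_cast (Finset.card_sdiff_add_card_eq_card hBA).symm
  have hsum : ∑ m ∈ A, L m = ∑ m ∈ A \ B, L m + ∑ m ∈ B, L m :=
    (Finset.sum_sdiff hBA).symm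
  have h1 : |∑ m ∈ A \ B, L m| ≤ c * (A \ B).card := by
    calc |∑ m ∈ A \ B, L m| ≤ ∑ m ∈ A \ B, |L m| := Finset.abs_sum_le_sum_abs _ _
      _ ≤ ∑ _m ∈ A \ B, c := Finset.sum_le_sum fun m hm => hL m (Finset.sdiff_subset hm)
      _ = c * (A \ B).card := by rw [Finset.sum_const, nsmul_eq_mul, mul_comm]
  have h2 : |avg B L| ≤ c := abs_avg_le hc fun m hm => hL m (hBA hm)
  have h3 : avg B L - avg A L =
      ((A \ B).card * avg B L - ∑ m ∈ A \ B, L m) / A.card := by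
    unfold avg
    rw [hsum]
    field_simp
    rw [hcard]
    ring
  rw [h3, abs_div, abs_of_pos hA0]
  gcongr
  have h4 : |((A \ B).card : ℝ) * avg B L| ≤ (A \ B).card * c := by
    rw [abs_mul, Nat.abs_cast]; gcongr
  calc _ ≤ |((A \ B).card : ℝ) * avg B L| + |∑ m ∈ A \ B, L m| := abs_sub _ _
    _ ≤ _ := by linarith

end Average

/-! ### Exchangeable weights on pairings -/

section Pairings
variable {H : Type*} [DecidableEq H]

/-- Fixed-point-free involutions. -/
abbrev PairingOn (H : Type*) : Type _ :=
  {σ : Equiv.Perm H // (∀ h, σ (σ h) = h) ∧ ∀ h, σ h ≠ h}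

/-- Conjugation of a pairing by a transposition. -/
def swapPairing (a b : H) (σ : PairingOn H) : PairingOn H :=
  ⟨Equiv.swap a b * σ.1 * Equiv.swap a b, fun h => by simp [σ.2.1], fun h e => by
    have := congrArg (Equiv.swap a b) e
    simp only [Equiv.Perm.mul_apply, Equiv.swap_apply_self] at this
    exact σ.2.2 _ this⟩

theorem swapPairing_apply (a b : H) (σ : PairingOn H) (h : H) :
    (swapPairing a b σ).1 h = Equiv.swap a b (σ.1 (Equiv.swap a b h)) := rfl

theorem swapPairing_involutive (a b : H) : Function.Involutive (swapPairing a b) := fun σ => by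
  apply Subtype.ext
  ext h
  simp [swapPairing_apply]

/-- The weight `W` on pairings is invariant under exchanging two elements of `B`. -/
def SwapInvariant (B : Finset H) (W : PairingOn H → ℝ) : Prop :=
  ∀ a ∈ B, ∀ b ∈ B, ∀ σ, W (swapPairing a b σ) = W σ

/-- The restriction of the weight `W` to the pairings that pair `g` with `h`. -/
def restrictWeight (W : PairingOn H → ℝ) (g h : H) (σ : PairingOn H) : ℝ :=
  if σ.1 g = h then W σ else 0

theorem SwapInvariant.mono {A B : Finset H} {W : PairingOn H → ℝ} (hW : SwapInvariant A W)
    (hBA : B ⊆ A) : SwapInvariant B W :=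
  fun a ha b hb σ => hW a (hBA ha) b (hBA hb) σ

/-- Exchanging two elements other than `g` and `h` does not affect whether they are paired together.
Hence edges can be revealed one at a time, keeping the rest exchangeable. Restricted weights play
the role of unnormalised conditional laws. -/
theorem SwapInvariant.restrictWeight {B : Finset H} {W : PairingOn H → ℝ}
    (hW : SwapInvariant B W) {g h : H} (hg : g ∉ B) (hh : h ∉ B) :
    SwapInvariant B (restrictWeight W g h) := by
  intro a ha b hb σ
  have hne : ∀ {x}, x ∉ B → x ≠ a ∧ x ≠ b := fun hx =>
    ⟨fun e => hx (e ▸ ha), fun e => hx (e ▸ hb)⟩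
  have h1 : (swapPairing a b σ).1 g = h ↔ σ.1 g = h := by
    rw [swapPairing_apply, Equiv.swap_apply_of_ne_of_ne (hne hg).1 (hne hg).2,
      Equiv.swap_apply_eq_iff, Equiv.swap_apply_of_ne_of_ne (hne hh).1 (hne hh).2]
  simp only [KarpSipser.restrictWeight, h1, hW a ha b hb σ]

theorem restrictWeight_nonneg {W : PairingOn H → ℝ} (hW : ∀ σ, 0 ≤ W σ) (g h : H)
    (σ : PairingOn H) : 0 ≤ restrictWeight W g h σ := by
  unfold restrictWeight; split_ifs <;> simp [hW]

theorem restrictWeight_ne_zero {W : PairingOn H → ℝ} {g h : H} {σ : PairingOn H}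
    (hσ : restrictWeight W g h σ ≠ 0) : σ.1 g = h ∧ W σ ≠ 0 := by
  unfold restrictWeight at hσ
  split_ifs at hσ with h1
  · exact ⟨h1, hσ⟩
  · exact absurd rfl hσ

variable [Fintype H]

/-- Decomposition according to the partner of `g`. -/
theorem sum_weight_eq_sum_restrictWeight {W : PairingOn H → ℝ} {B : Finset H} {g : H}
    (hsupp : ∀ σ, W σ ≠ 0 → σ.1 g ∈ B) (F : PairingOn H → H → ℝ) :
    ∑ σ, W σ * F σ (σ.1 g) = ∑ h ∈ B, ∑ σ, restrictWeight W g h σ * F σ h := by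
  rw [Finset.sum_comm]
  refine Finset.sum_congr rfl fun σ _ => ?_
  by_cases hσ : W σ = 0
  · simp [hσ, restrictWeight]
  · simp only [restrictWeight, ite_mul, zero_mul]
    rw [Finset.sum_ite_eq, if_pos (hsupp σ hσ)]

/-- Conjugation by the transposition of `a` and `b` carries the pairings with `h` matched to `a`
onto those with `h` matched to `b` and preserves `W`. -/
theorem sum_restrictWeight_eq {W : PairingOn H → ℝ} {B : Finset H} {h : H} (hh : h ∉ B)
    (hW : SwapInvariant B W) {a b : H} (ha : a ∈ B) (hb : b ∈ B) :
    ∑ σ, restrictWeight W h a σ = ∑ σ, restrictWeight W h b σ := by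
  rw [← Equiv.sum_comp (swapPairing_involutive a b).toPerm]
  refine Finset.sum_congr rfl fun σ _ => ?_
  have hne : h ≠ a ∧ h ≠ b := ⟨fun e => hh (e ▸ ha), fun e => hh (e ▸ hb)⟩
  have h1 : (swapPairing a b σ).1 h = a ↔ σ.1 h = b := by
    rw [swapPairing_apply, Equiv.swap_apply_of_ne_of_ne hne.1 hne.2, Equiv.swap_apply_eq_iff,
      Equiv.swap_apply_left]
  simp only [Function.Involutive.coe_toPerm, restrictWeight, h1, hW a ha b hb σ]

/-- Under an exchangeable weight, the partner of `h` is uniformly distributed on `B`. -/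
theorem sum_weight_mul_apply {W : PairingOn H → ℝ} {B : Finset H} {h : H} (hh : h ∉ B)
    (hW : SwapInvariant B W) (hsupp : ∀ σ, W σ ≠ 0 → σ.1 h ∈ B) (L : H → ℝ) :
    ∑ σ, W σ * L (σ.1 h) = (∑ σ, W σ) * avg B L := by
  have h1 : ∑ σ, W σ = ∑ m ∈ B, ∑ σ, restrictWeight W h m σ := by
    simpa using sum_weight_eq_sum_restrictWeight hsupp fun _ _ => 1
  have h2 := sum_weight_eq_sum_restrictWeight hsupp fun _ m => L m
  rcases B.eq_empty_or_nonempty with rfl | ⟨b, hb⟩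
  · rw [h2]; simp [avg]
  have hB0 : (B.card : ℝ) ≠ 0 := by
    have : 0 < B.card := Finset.card_pos.2 ⟨b, hb⟩
    positivity
  have h3 : ∀ m ∈ B, ∑ σ, restrictWeight W h m σ = (∑ σ, W σ) / B.card := by
    intro m hm
    rw [h1, Finset.sum_congr rfl fun a ha => sum_restrictWeight_eq hh hW ha hm,
      Finset.sum_const, nsmul_eq_mul]
    field_simp
  rw [h2, Finset.sum_congr rfl fun m hm => by rw [← Finset.sum_mul, h3 m hm], ← Finset.mul_sum]
  unfold avg
  ring

/-- Under an exchangeable weight, the partner of `h` lies in a small set with small probability. -/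
theorem sum_weight_indicator_le {W : PairingOn H → ℝ} {B : Finset H} {h : H} (hh : h ∉ B)
    (hW0 : ∀ σ, 0 ≤ W σ) (hW : SwapInvariant B W) (hsupp : ∀ σ, W σ ≠ 0 → σ.1 h ∈ B)
    (p : H → Prop) [DecidablePred p] (hp : (B.filter p).card ≤ 3) {S : ℕ} (hS0 : 0 < S)
    (hS : S ≤ 2 * B.card) :
    ∑ σ, W σ * (if p (σ.1 h) then 1 else 0) ≤ 6 / S * ∑ σ, W σ := by
  rw [sum_weight_mul_apply hh hW hsupp fun m => if p m then 1 else 0, mul_comm]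
  refine mul_le_mul_of_nonneg_right ?_ (Finset.sum_nonneg fun σ _ => hW0 σ)
  unfold avg
  rw [Finset.sum_boole]
  have hS' : (S : ℝ) ≤ 2 * B.card := by exact_mod_cast hS
  have hp' : ((B.filter p).card : ℝ) ≤ 3 := by exact_mod_cast hp
  have hS0' : (0 : ℝ) < S := by exact_mod_cast hS0
  rw [div_le_div_iff₀ (by linarith) hS0']
  nlinarith

end Pairings

/-! ### Degrees and one step of the exploration for a fixed pairing -/

section Degrees
variable {H V : Type*} [DecidableEq V] (π : H → V)

/-- The elements of `A` attached to the vertex `v`. -/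
def fiber (A : Finset H) (v : V) : Finset H := A.filter fun h => π h = v

/-- The number of elements of `A` attached to the vertex `v`. -/
def deg (A : Finset H) (v : V) : ℕ := (fiber π A v).card

/-- The set that is left when the neighbour of `g` is removed. -/
def removeSet (σ : PairingOn H) (A : Finset H) (g : H) : Finset H :=
  A.filter fun h => π h ≠ π (σ.1 g) ∧ π (σ.1 h) ≠ π (σ.1 g)

/-- The change of the potential when the half-edge `m` is erased. -/
def gain (c : ℕ → ℝ) (A : Finset H) (m : H) : ℝ := c (deg π A (π m) - 1) - c (deg π A (π m))

variable {π}

theorem mem_fiber {A : Finset H} {v : V} {h : H} : h ∈ fiber π A v ↔ h ∈ A ∧ π h = v := by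
  simp [fiber]

theorem deg_removeSet_self (σ : PairingOn H) (A : Finset H) (g : H) :
    deg π (removeSet π σ A g) (π (σ.1 g)) = 0 := by
  simp only [deg, Finset.card_eq_zero, Finset.eq_empty_iff_forall_notMem, mem_fiber, removeSet,
    Finset.mem_filter]
  tauto

/-- The half-edges lost at `u` are exactly the partners of the half-edges that join the removed
vertex to `u`; parallel edges are counted with multiplicity. -/
theorem deg_removeSet [DecidableEq H] {σ : PairingOn H} {A : Finset H} (hA : ∀ h ∈ A, σ.1 h ∈ A) {g : H} {u : V}
    (hu : u ≠ π (σ.1 g)) :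
    deg π (removeSet π σ A g) u =
      deg π A u - ((fiber π A (π (σ.1 g))).filter fun h => π (σ.1 h) = u).card := by
  have h1 : fiber π (removeSet π σ A g) u =
      fiber π A u \ ((fiber π A (π (σ.1 g))).filter fun h => π (σ.1 h) = u).image σ.1 := by
    ext h
    simp only [mem_fiber, removeSet, Finset.mem_filter, Finset.mem_sdiff, Finset.mem_image]
    constructor
    · rintro ⟨⟨h1, h2, h3⟩, rfl⟩
      refine ⟨⟨h1, rfl⟩, ?_⟩
      rintro ⟨h', ⟨⟨_, h6⟩, -⟩, rfl⟩
      rw [σ.2.1] at h3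
      exact h3 h6
    · rintro ⟨⟨h1, rfl⟩, h2⟩
      refine ⟨⟨h1, hu, fun h3 => h2 ⟨σ.1 h, ⟨⟨hA h h1, h3⟩, ?_⟩, σ.2.1 h⟩⟩, rfl⟩
      rw [σ.2.1]
  have h2 : ((fiber π A (π (σ.1 g))).filter fun h => π (σ.1 h) = u).image σ.1 ⊆ fiber π A u := by
    intro h
    simp only [mem_fiber, Finset.mem_filter, Finset.mem_image]
    rintro ⟨h', ⟨⟨h3, -⟩, h4⟩, rfl⟩
    exact ⟨hA _ h3, h4⟩
  unfold deg
  rw [h1, Finset.card_sdiff_of_subset h2, Finset.card_image_of_injective _ σ.1.injective]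

/-- At most six half-edges are removed in a step. -/
theorem card_sdiff_removeSet_le [DecidableEq H] [Fintype H]
    (hπ : ∀ v, (fiber π (Finset.univ : Finset H) v).card ≤ 3) (σ : PairingOn H) (A : Finset H)
    (g : H) : (A \ removeSet π σ A g).card ≤ 6 := by
  have h1 : A \ removeSet π σ A g ⊆ fiber π Finset.univ (π (σ.1 g)) ∪
      (fiber π Finset.univ (π (σ.1 g))).image σ.1 := by
    intro h
    simp only [removeSet, Finset.mem_sdiff, Finset.mem_filter, Finset.mem_union, mem_fiber,
      Finset.mem_univ, true_and, Finset.mem_image]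
    rintro ⟨h1, h2⟩
    by_cases h3 : π h = π (σ.1 g)
    · exact Or.inl h3
    · by_cases h4 : π (σ.1 h) = π (σ.1 g)
      · exact Or.inr ⟨σ.1 h, h4, σ.2.1 h⟩
      · exact absurd ⟨h1, h3, h4⟩ h2
  calc _ ≤ _ := Finset.card_le_card h1
    _ ≤ _ := Finset.card_union_le _ _
    _ ≤ 3 + 3 := add_le_add (hπ _) (Finset.card_image_le.trans (hπ _))

theorem deg_le_three [Fintype H] (hπ : ∀ v, (fiber π (Finset.univ : Finset H) v).card ≤ 3)
    (A : Finset H) (v : V) : deg π A v ≤ 3 :=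
  (Finset.card_le_card (Finset.filter_subset_filter _ (Finset.subset_univ A))).trans (hπ v)

theorem abs_gain_le {c : ℕ → ℝ} (hc0 : ∀ k, 0 ≤ c k) (hc3 : ∀ k, c k ≤ 3) (A : Finset H) (m : H) :
    |gain π c A m| ≤ 3 := by
  unfold gain
  rw [abs_le]
  constructor <;> linarith [hc0 (deg π A (π m) - 1), hc3 (deg π A (π m) - 1),
    hc0 (deg π A (π m)), hc3 (deg π A (π m))]

variable [Fintype V]

/-- The sum over all vertices of a function of their degree. -/
noncomputable def potential (π : H → V) (c : ℕ → ℝ) (A : Finset H) : ℝ := ∑ v, c (deg π A v)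

/-- A vertex whose fibre changes loses at least one half-edge, and its term moves by at most 3. -/
theorem abs_potential_sub_le [DecidableEq H] {c : ℕ → ℝ} (hc0 : ∀ k, 0 ≤ c k) (hc3 : ∀ k, c k ≤ 3)
    {A A' : Finset H} (hA : A' ⊆ A) :
    |potential π c A' - potential π c A| ≤ 3 * (A \ A').card := by
  have hcard : (A \ A').card = ∑ v, (fiber π (A \ A') v).card :=
    Finset.card_eq_sum_card_fiberwise fun x _ => Finset.mem_coe.2 (Finset.mem_univ (π x))
  unfold potential
  rw [← Finset.sum_sub_distrib, hcard, Nat.cast_sum, Finset.mul_sum]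
  refine (Finset.abs_sum_le_sum_abs _ _).trans (Finset.sum_le_sum fun v _ => ?_)
  rcases (fiber π (A \ A') v).eq_empty_or_nonempty with he | he
  · have : fiber π A' v = fiber π A v := by
      ext h
      have h1 : h ∉ fiber π (A \ A') v := by rw [he]; exact Finset.notMem_empty h
      simp only [mem_fiber, Finset.mem_sdiff] at h1 ⊢
      have := @hA h
      tauto
    simp [deg, this]
  · have h1 : (1 : ℝ) ≤ (fiber π (A \ A') v).card := by exact_mod_cast he.card_pos
    have h2 : |c (deg π A' v) - c (deg π A v)| ≤ 3 := by
      rw [abs_le]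
      constructor <;> linarith [hc0 (deg π A v), hc3 (deg π A v), hc0 (deg π A' v),
        hc3 (deg π A' v)]
    linarith

/-- The change of the potential in a step, when the removed vertex has neither loops nor multiple
edges. -/
theorem potential_removeSet_sub [DecidableEq H] {σ : PairingOn H} {A : Finset H} (hA : ∀ h ∈ A, σ.1 h ∈ A) {g : H}
    {c : ℕ → ℝ} (hc : c 0 = 0)
    (hloop : ∀ h ∈ fiber π A (π (σ.1 g)), π (σ.1 h) ≠ π (σ.1 g))
    (hmult : ∀ h ∈ fiber π A (π (σ.1 g)), ∀ h' ∈ fiber π A (π (σ.1 g)), h ≠ h' →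
      π (σ.1 h) ≠ π (σ.1 h')) :
    potential π c (removeSet π σ A g) - potential π c A =
      -c (deg π A (π (σ.1 g))) + ∑ h ∈ fiber π A (π (σ.1 g)), gain π c A (σ.1 h) := by
  set v := π (σ.1 g) with hv
  -- Vertex by vertex: the removed vertex drops to degree 0, and any other vertex loses at most one
  -- half-edge, so the inner sum has at most one nonzero term.
  have key : ∀ u, c (deg π (removeSet π σ A g) u) - c (deg π A u) =
      (if u = v then -c (deg π A v) else 0) +
        ∑ h ∈ fiber π A v, if π (σ.1 h) = u then gain π c A (σ.1 h) else 0 := by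
    intro u
    by_cases hu : u = v
    · rw [hu, if_pos rfl, Finset.sum_eq_zero fun h hh => if_neg (hloop h hh), hv,
        deg_removeSet_self, hc]
      ring
    · rw [if_neg hu, zero_add, deg_removeSet hA hu, ← Finset.sum_filter]
      rcases ((fiber π A v).filter fun h => π (σ.1 h) = u).eq_empty_or_nonempty with he | ⟨h, hh⟩
      · rw [he]; simp
      · have hs : ((fiber π A v).filter fun h => π (σ.1 h) = u) = {h} := by
          refine Finset.eq_singleton_iff_unique_mem.2 ⟨hh, fun h' hh' => ?_⟩
          rw [Finset.mem_filter] at hh hh'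
          by_contra hne
          exact hmult h' hh'.1 h hh.1 hne (hh'.2.trans hh.2.symm)
        rw [hs, Finset.sum_singleton, Finset.card_singleton, gain, (Finset.mem_filter.1 hh).2]
  unfold potential
  rw [← Finset.sum_sub_distrib, Finset.sum_congr rfl fun u _ => key u, Finset.sum_add_distrib,
    Finset.sum_ite_eq', if_pos (Finset.mem_univ _), Finset.sum_comm]
  congr 1
  exact Finset.sum_congr rfl fun h _ => by rw [Finset.sum_ite_eq, if_pos (Finset.mem_univ _)]

end Degrees

/-! ### The drift of one step for an exchangeable pairing -/

section Drift
variable {H V : Type*} [DecidableEq H] [DecidableEq V] {π : H → V}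

/-- The other half-edges at the vertex of `h₀`. -/
def siblings (π : H → V) (A : Finset H) (h₀ : H) : Finset H := (fiber π A (π h₀)).erase h₀

/-- First-order approximation of the change of the potential when `g` is paired with `h₀`. -/
noncomputable def linearChange (π : H → V) (c : ℕ → ℝ) (A : Finset H) (σ : PairingOn H) (h₀ : H) :
    ℝ :=
  -- The term `-c 1` is the leaf at `g`, whose degree drops from 1 to 0.
  -c (deg π A (π h₀)) - c 1 + ∑ h ∈ siblings π A h₀, gain π c A (σ.1 h)

/-- The number of loops and of pairs of parallel edges at the vertex of `h₀`. -/
noncomputable def defects (π : H → V) (A : Finset H) (σ : PairingOn H) (h₀ : H) : ℝ :=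
  ∑ h ∈ siblings π A h₀, ((if π (σ.1 h) = π h₀ then 1 else 0) +
    -- The case `σ.1 h = h'` is a loop, already counted. Excluding it leaves the partner of `h'`
    -- undetermined once that of `h` is known.
    ∑ h' ∈ (siblings π A h₀).erase h, if σ.1 h ≠ h' ∧ π (σ.1 h') = π (σ.1 h) then 1 else 0)

/-- The mean of `linearChange`, when the partners are chosen independently and uniformly. -/
noncomputable def meanChange (π : H → V) (c : ℕ → ℝ) (A : Finset H) (h₀ : H) : ℝ :=
  -c (deg π A (π h₀)) - c 1 + ((deg π A (π h₀) : ℝ) - 1) * avg A (gain π c A)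

/-- The asymptotic drift of the potential in a step. -/
noncomputable def meanDrift (π : H → V) (c : ℕ → ℝ) (A : Finset H) : ℝ :=
  avg A (meanChange π c A)

theorem card_siblings {A : Finset H} {h₀ : H} (hh : h₀ ∈ A) :
    ((siblings π A h₀).card : ℝ) = (deg π A (π h₀) : ℝ) - 1 := by
  have h1 : h₀ ∈ fiber π A (π h₀) := mem_fiber.2 ⟨hh, rfl⟩
  have h2 := Finset.card_erase_add_one h1
  unfold siblings deg
  rw [eq_sub_iff_add_eq]
  exact_mod_cast h2

theorem ne_of_mem_siblings {A : Finset H} {g h₀ h : H} (hg : g ∈ A) (hg1 : deg π A (π g) = 1)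
    (hh₀ : h₀ ∈ A.erase g) (hh : h ∈ siblings π A h₀) : h ≠ g := by
  rintro rfl
  obtain ⟨x, hx⟩ := Finset.card_eq_one.1 hg1
  have h1 : h₀ ∈ fiber π A (π h) :=
    mem_fiber.2 ⟨Finset.mem_of_mem_erase hh₀, (mem_fiber.1 (Finset.mem_of_mem_erase hh)).2.symm⟩
  have h2 : h ∈ fiber π A (π h) := mem_fiber.2 ⟨hg, rfl⟩
  rw [hx, Finset.mem_singleton] at h1 h2
  exact Finset.ne_of_mem_erase hh₀ (h1.trans h2.symm)

/-- The half-edges `g` and `h₀` are matched to each other, so neither is available to `h`. -/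
theorem apply_mem_of_restrictWeight_ne_zero {W : PairingOn H → ℝ} {A : Finset H}
    (hsupp : ∀ σ, W σ ≠ 0 → ∀ h ∈ A, σ.1 h ∈ A) {g h₀ h : H} (hg : h ≠ g) (hh₀ : h ≠ h₀)
    (hh : h ∈ A) {σ : PairingOn H} (hσ : restrictWeight W g h₀ σ ≠ 0) :
    σ.1 h ∈ A \ {g, h₀, h} := by
  obtain ⟨h1, h2⟩ := restrictWeight_ne_zero hσ
  have h3 := hsupp σ h2 h hh
  have h4 := σ.2.1 h
  have h5 := σ.2.2 h
  have h6 := σ.2.1 g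
  simp only [Finset.mem_sdiff, Finset.mem_insert, Finset.mem_singleton, not_or]
  refine ⟨h3, fun e => ?_, fun e => ?_, h5⟩
  · rw [e, h1] at h4; exact hh₀ h4.symm
  · rw [e, ← h1, h6] at h4; exact hg h4.symm

/-- At most five half-edges are ever set aside at once, so at least half of `A` remains available.
-/
theorem card_le_two_mul_card_sdiff {A T : Finset H} (hA : 10 ≤ A.card) (hT : T.card ≤ 5) :
    A.card ≤ 2 * (A \ T).card := by
  have := Finset.le_card_sdiff T A
  omega

variable [Fintype H]

theorem card_siblings_le
    (hπ : ∀ v, (fiber π (Finset.univ : Finset H) v).card ≤ 3) {A : Finset H} {h₀ : H} (hh : h₀ ∈ A) : (siblings π A h₀).card ≤ 2 := by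
  have h1 : h₀ ∈ fiber π A (π h₀) := mem_fiber.2 ⟨hh, rfl⟩
  have h2 := Finset.card_erase_add_one h1
  have h3 := deg_le_three hπ A (π h₀)
  unfold siblings deg at *
  omega

/-- Without defects the linear approximation is exact. -/
theorem abs_potential_change_sub_linearChange_le
    (hπ : ∀ v, (fiber π (Finset.univ : Finset H) v).card ≤ 3) [Fintype V] {σ : PairingOn H} {A : Finset H}
    (hA : ∀ h ∈ A, σ.1 h ∈ A) {g : H} (hg : g ∈ A) (hg1 : deg π A (π g) = 1)
    {c : ℕ → ℝ} (hc : c 0 = 0) (hc0 : ∀ k, 0 ≤ c k) (hc3 : ∀ k, c k ≤ 3) :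
    |potential π c (removeSet π σ A g) - potential π c A - linearChange π c A σ (σ.1 g)| ≤
      30 * defects π A σ (σ.1 g) := by
  have hmem : σ.1 g ∈ fiber π A (π (σ.1 g)) := mem_fiber.2 ⟨hA g hg, rfl⟩
  have huniq : ∀ h ∈ A, π h = π g → h = g := by
    intro h hh he
    obtain ⟨x, hx⟩ := Finset.card_eq_one.1 hg1
    have h1 : h ∈ fiber π A (π g) := mem_fiber.2 ⟨hh, he⟩
    have h2 : g ∈ fiber π A (π g) := mem_fiber.2 ⟨hg, rfl⟩
    rw [hx, Finset.mem_singleton] at h1 h2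
    rw [h1, h2]
  have hvg : π g ≠ π (σ.1 g) := fun e => σ.2.2 g (huniq _ (hA g hg) e.symm)
  have hterm : ∀ h ∈ siblings π A (σ.1 g), (0 : ℝ) ≤ (if π (σ.1 h) = π (σ.1 g) then 1 else 0) +
      ∑ h' ∈ (siblings π A (σ.1 g)).erase h,
        if σ.1 h ≠ h' ∧ π (σ.1 h') = π (σ.1 h) then 1 else 0 := fun h _ =>
    add_nonneg (by positivity) (Finset.sum_nonneg fun _ _ => by positivity)
  by_cases hgood : (∀ h ∈ siblings π A (σ.1 g), π (σ.1 h) ≠ π (σ.1 g)) ∧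
      ∀ h ∈ siblings π A (σ.1 g), ∀ h' ∈ (siblings π A (σ.1 g)).erase h,
        ¬ (σ.1 h ≠ h' ∧ π (σ.1 h') = π (σ.1 h))
  · have hloop : ∀ h ∈ fiber π A (π (σ.1 g)), π (σ.1 h) ≠ π (σ.1 g) := by
      intro h hh
      by_cases he : h = σ.1 g
      · rw [he, σ.2.1]; exact hvg
      · exact hgood.1 h (Finset.mem_erase.2 ⟨he, hh⟩)
    have hg' : ∀ h ∈ fiber π A (π (σ.1 g)), h ≠ σ.1 g → π (σ.1 h) ≠ π g := by
      intro h hh hne he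
      have := huniq _ (hA h (mem_fiber.1 hh).1) he
      exact hne (by rw [← this, σ.2.1])
    have hmult : ∀ h ∈ fiber π A (π (σ.1 g)), ∀ h' ∈ fiber π A (π (σ.1 g)), h ≠ h' →
        π (σ.1 h) ≠ π (σ.1 h') := by
      intro h hh h' hh' hne
      by_cases he : h = σ.1 g
      · subst he
        rw [σ.2.1]
        exact (hg' h' hh' hne.symm).symm
      by_cases he' : h' = σ.1 g
      · subst he'
        rw [σ.2.1]
        exact hg' h hh hne
      · intro e
        refine hgood.2 h (Finset.mem_erase.2 ⟨he, hh⟩) h'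
          (Finset.mem_erase.2 ⟨hne.symm, Finset.mem_erase.2 ⟨he', hh'⟩⟩) ⟨?_, e.symm⟩
        intro e2
        exact hloop h hh (by rw [e2]; exact (mem_fiber.1 hh').2)
    rw [potential_removeSet_sub hA hc hloop hmult]
    have h1 : ∑ h ∈ fiber π A (π (σ.1 g)), gain π c A (σ.1 h) =
        gain π c A g + ∑ h ∈ siblings π A (σ.1 g), gain π c A (σ.1 h) := by
      rw [siblings, Finset.sum_erase_eq_sub hmem, σ.2.1]; ring
    have h2 : gain π c A g = -c 1 := by simp [gain, hg1, hc]
    rw [h1, h2, linearChange]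
    ring_nf
    simp only [abs_zero]
    exact mul_nonneg (Finset.sum_nonneg hterm) (by norm_num)
  -- With a defect crude bounds suffice: six lost half-edges change the potential by at most 18, the
  -- linear change is at most 3 + 3 + 6, and 18 + 12 = 30.
  · have hdef : 1 ≤ defects π A σ (σ.1 g) := by
      rw [not_and_or] at hgood
      push Not at hgood
      rcases hgood with ⟨h, hh, he⟩ | ⟨h, hh, h', hh', hne, he⟩
      · refine le_trans ?_ (Finset.single_le_sum hterm hh)
        rw [if_pos he]
        exact le_add_of_nonneg_right (Finset.sum_nonneg fun _ _ => by positivity)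
      · refine le_trans ?_ (Finset.single_le_sum hterm hh)
        refine le_trans ?_ (le_add_of_nonneg_left (by positivity))
        refine le_trans ?_ (Finset.single_le_sum (fun _ _ => by positivity) hh')
        rw [if_pos ⟨hne, he⟩]
    have h1 : |potential π c (removeSet π σ A g) - potential π c A| ≤ 18 := by
      refine (abs_potential_sub_le hc0 hc3 (Finset.filter_subset _ _)).trans ?_
      have : ((A \ removeSet π σ A g).card : ℝ) ≤ 6 := by
        exact_mod_cast card_sdiff_removeSet_le hπ σ A g
      change 3 * ((A \ removeSet π σ A g).card : ℝ) ≤ 18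
      linarith
    have h2 : |∑ h ∈ siblings π A (σ.1 g), gain π c A (σ.1 h)| ≤ 6 := by
      calc _ ≤ ∑ h ∈ siblings π A (σ.1 g), |gain π c A (σ.1 h)| := Finset.abs_sum_le_sum_abs _ _
        _ ≤ ∑ _h ∈ siblings π A (σ.1 g), (3 : ℝ) :=
          Finset.sum_le_sum fun h _ => abs_gain_le hc0 hc3 A _
        _ = (siblings π A (σ.1 g)).card * 3 := by simp
        _ ≤ 2 * 3 := by
          gcongr
          exact_mod_cast card_siblings_le hπ (hA g hg)
        _ = 6 := by norm_num
    have h3 : |linearChange π c A σ (σ.1 g)| ≤ 12 := by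
      unfold linearChange
      rw [abs_le] at h2 ⊢
      constructor <;> linarith [h2.1, h2.2, hc0 1, hc3 1, hc0 (deg π A (π (σ.1 g))),
        hc3 (deg π A (π (σ.1 g)))]
    have := abs_sub (potential π c (removeSet π σ A g) - potential π c A)
      (linearChange π c A σ (σ.1 g))
    linarith

/-- Expected number of defects, given the partner of `g`. -/
theorem sum_restrictWeight_defects_le
    (hπ : ∀ v, (fiber π (Finset.univ : Finset H) v).card ≤ 3) {W : PairingOn H → ℝ} {A : Finset H} (hW0 : ∀ σ, 0 ≤ W σ)
    (hW : SwapInvariant A W) (hsupp : ∀ σ, W σ ≠ 0 → ∀ h ∈ A, σ.1 h ∈ A) {g h₀ : H} (hg : g ∈ A)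
    (hg1 : deg π A (π g) = 1) (hh₀ : h₀ ∈ A.erase g) (hA : 10 ≤ A.card) :
    ∑ σ, restrictWeight W g h₀ σ * defects π A σ h₀ ≤
      24 / A.card * ∑ σ, restrictWeight W g h₀ σ := by
  set W₀ := restrictWeight W g h₀ with hW₀
  have hW₀0 : ∀ σ, 0 ≤ W₀ σ := restrictWeight_nonneg hW0 g h₀
  have hW₀inv : ∀ h, SwapInvariant (A \ {g, h₀, h}) W₀ := fun h =>
    (hW.mono Finset.sdiff_subset).restrictWeight (by simp) (by simp)
  have hW₀s : 0 ≤ ∑ σ, W₀ σ := Finset.sum_nonneg fun σ _ => hW₀0 σ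
  have hA0 : 0 < A.card := by omega
  have hsib : ∀ h ∈ siblings π A h₀, h ∈ A ∧ h ≠ h₀ ∧ h ≠ g := fun h hh =>
    ⟨(mem_fiber.1 (Finset.mem_of_mem_erase hh)).1, Finset.ne_of_mem_erase hh,
      ne_of_mem_siblings hg hg1 hh₀ hh⟩
  have hloop : ∀ h ∈ siblings π A h₀,
      ∑ σ, W₀ σ * (if π (σ.1 h) = π h₀ then 1 else 0) ≤ 6 / A.card * ∑ σ, W₀ σ := by
    intro h hh
    obtain ⟨h1, h2, h3⟩ := hsib h hh
    exact sum_weight_indicator_le (B := A \ {g, h₀, h}) (by simp) hW₀0 (hW₀inv h)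
      (fun σ hσ => apply_mem_of_restrictWeight_ne_zero hsupp h3 h2 h1 hσ)
      (fun x => π x = π h₀) (deg_le_three hπ _ _) hA0
      (card_le_two_mul_card_sdiff hA (Finset.card_le_three.trans (by norm_num)))
  have hmult : ∀ h ∈ siblings π A h₀, ∀ h' ∈ (siblings π A h₀).erase h,
      ∑ σ, W₀ σ * (if σ.1 h ≠ h' ∧ π (σ.1 h') = π (σ.1 h) then 1 else 0) ≤
        6 / A.card * ∑ σ, W₀ σ := by
    intro h hh h' hh'
    obtain ⟨h1, h2, h3⟩ := hsib h hh
    obtain ⟨h1', h2', h3'⟩ := hsib h' (Finset.mem_of_mem_erase hh')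
    have hne : h' ≠ h := Finset.ne_of_mem_erase hh'
    have hs : ∀ σ, W₀ σ ≠ 0 → σ.1 h ∈ A \ {g, h₀, h} := fun σ hσ =>
      apply_mem_of_restrictWeight_ne_zero hsupp h3 h2 h1 hσ
    -- The partner `m` of `h` is revealed too; then `h'` has to hit one of the at most three
    -- half-edges at the vertex of `m`.
    rw [sum_weight_eq_sum_restrictWeight hs fun σ m =>
      if m ≠ h' ∧ π (σ.1 h') = π m then 1 else 0]
    have htot : ∑ σ, W₀ σ = ∑ m ∈ A \ {g, h₀, h}, ∑ σ, restrictWeight W₀ h m σ := by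
      simpa using sum_weight_eq_sum_restrictWeight hs fun _ _ => 1
    rw [htot, Finset.mul_sum]
    refine Finset.sum_le_sum fun m hm => ?_
    have hm0 : ∀ σ, 0 ≤ restrictWeight W₀ h m σ := restrictWeight_nonneg hW₀0 h m
    by_cases hmh : m = h'
    · simp only [hmh, ne_eq, not_true_eq_false, false_and, if_false, mul_zero,
        Finset.sum_const_zero]
      exact mul_nonneg (by positivity) (Finset.sum_nonneg fun σ _ => hmh ▸ hm0 σ)
    · simp only [ne_eq, hmh, not_false_eq_true, true_and]
      refine sum_weight_indicator_le (B := A \ {g, h₀, h, m, h'}) (by simp) hm0 ?_ ?_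
        (fun x => π x = π m) (deg_le_three hπ _ _) hA0
        (card_le_two_mul_card_sdiff hA Finset.card_le_five)
      · refine ((hW₀inv h).mono ?_).restrictWeight (by simp) (by simp)
        exact Finset.sdiff_subset_sdiff subset_rfl (by
          intro x; simp only [Finset.mem_insert, Finset.mem_singleton]; tauto)
      · intro σ hσ
        obtain ⟨h4, h5⟩ := restrictWeight_ne_zero hσ
        have h6 := apply_mem_of_restrictWeight_ne_zero hsupp h3' h2' h1' h5
        have h7 := σ.2.1 h'
        have h8 := σ.2.1 h
        simp only [Finset.mem_sdiff, Finset.mem_insert, Finset.mem_singleton, not_or] at h6 ⊢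
        refine ⟨h6.1, h6.2.1, h6.2.2.1, fun e => ?_, fun e => ?_, h6.2.2.2⟩
        · rw [e, h4] at h7; exact hmh h7
        · rw [e, ← h4, h8] at h7; exact hne h7.symm
  have hexp : ∑ σ, W₀ σ * defects π A σ h₀ =
      ∑ h ∈ siblings π A h₀, (∑ σ, W₀ σ * (if π (σ.1 h) = π h₀ then 1 else 0) +
        ∑ h' ∈ (siblings π A h₀).erase h,
          ∑ σ, W₀ σ * (if σ.1 h ≠ h' ∧ π (σ.1 h') = π (σ.1 h) then 1 else 0)) := by
    unfold defects
    simp only [Finset.mul_sum, mul_add]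
    rw [Finset.sum_comm]
    refine Finset.sum_congr rfl fun h _ => ?_
    rw [Finset.sum_add_distrib]
    congr 1
    rw [Finset.sum_comm]
  have hcard2 : ((siblings π A h₀).card : ℝ) ≤ 2 := by
    exact_mod_cast card_siblings_le hπ (Finset.mem_of_mem_erase hh₀)
  -- Each of at most two siblings contributes `b` for a loop and `b` for a parallel edge with the
  -- other one: 2 · 2 · 6 = 24.
  set b := 6 / (A.card : ℝ) * ∑ σ, W₀ σ with hb
  have hb0 : 0 ≤ b := mul_nonneg (by positivity) hW₀s
  calc _ = _ := hexp
    _ ≤ ∑ h ∈ siblings π A h₀, (b + b) := by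
      refine Finset.sum_le_sum fun h hh => add_le_add (hloop h hh) ?_
      refine (Finset.sum_le_sum (hmult h hh)).trans ?_
      rw [Finset.sum_const, nsmul_eq_mul]
      have : (((siblings π A h₀).erase h).card : ℝ) ≤ 1 := by
        have h1 := Finset.card_erase_add_one hh
        have h2 := card_siblings_le hπ (Finset.mem_of_mem_erase hh₀)
        exact_mod_cast (by omega : ((siblings π A h₀).erase h).card ≤ 1)
      nlinarith
    _ = (siblings π A h₀).card * (b + b) := by rw [Finset.sum_const, nsmul_eq_mul]
    _ ≤ 2 * (b + b) := by gcongr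
    _ = _ := by rw [hb]; ring

/-- Expected linear change, given the partner of `g`. -/
theorem abs_sum_restrictWeight_linearChange_sub_le
    (hπ : ∀ v, (fiber π (Finset.univ : Finset H) v).card ≤ 3) {W : PairingOn H → ℝ} {A : Finset H}
    (hW0 : ∀ σ, 0 ≤ W σ)
    (hW : SwapInvariant A W) (hsupp : ∀ σ, W σ ≠ 0 → ∀ h ∈ A, σ.1 h ∈ A) {g h₀ : H} (hg : g ∈ A)
    (hg1 : deg π A (π g) = 1) (hh₀ : h₀ ∈ A.erase g) (hA : 10 ≤ A.card)
    {c : ℕ → ℝ} (hc0 : ∀ k, 0 ≤ c k) (hc3 : ∀ k, c k ≤ 3) :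
    |∑ σ, restrictWeight W g h₀ σ * linearChange π c A σ h₀ -
      (∑ σ, restrictWeight W g h₀ σ) * meanChange π c A h₀| ≤
      36 / A.card * ∑ σ, restrictWeight W g h₀ σ := by
  set W₀ := restrictWeight W g h₀ with hW₀
  have hW₀0 : ∀ σ, 0 ≤ W₀ σ := restrictWeight_nonneg hW0 g h₀
  have hW₀s : 0 ≤ ∑ σ, W₀ σ := Finset.sum_nonneg fun σ _ => hW₀0 σ
  have hA0 : 0 < A.card := by omega
  have hA0' : (0 : ℝ) < A.card := by exact_mod_cast hA0
  have hsib : ∀ h ∈ siblings π A h₀,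
      ∑ σ, W₀ σ * gain π c A (σ.1 h) = (∑ σ, W₀ σ) * avg (A \ {g, h₀, h}) (gain π c A) := by
    intro h hh
    refine sum_weight_mul_apply (by simp)
      ((hW.mono Finset.sdiff_subset).restrictWeight (by simp) (by simp)) (fun σ hσ => ?_) _
    exact apply_mem_of_restrictWeight_ne_zero hsupp (ne_of_mem_siblings hg hg1 hh₀ hh)
      (Finset.ne_of_mem_erase hh) (mem_fiber.1 (Finset.mem_of_mem_erase hh)).1 hσ
  have hexp : ∑ σ, W₀ σ * linearChange π c A σ h₀ - (∑ σ, W₀ σ) * meanChange π c A h₀ =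
      (∑ σ, W₀ σ) * ∑ h ∈ siblings π A h₀,
        (avg (A \ {g, h₀, h}) (gain π c A) - avg A (gain π c A)) := by
    unfold linearChange meanChange
    simp only [mul_add, Finset.sum_add_distrib, Finset.mul_sum]
    rw [Finset.sum_comm (s := Finset.univ), Finset.sum_congr rfl hsib, ← Finset.sum_mul,
      ← card_siblings (Finset.mem_of_mem_erase hh₀), ← Finset.mul_sum, ← Finset.mul_sum,
      Finset.sum_sub_distrib, Finset.sum_const, nsmul_eq_mul]
    ring
  -- Three excluded half-edges and gains bounded by 3 give 2 · 3 · 3 = 18.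
  have hdiff : ∀ h ∈ siblings π A h₀,
      |avg (A \ {g, h₀, h}) (gain π c A) - avg A (gain π c A)| ≤ 18 / A.card := by
    intro h _
    have hcard := card_le_two_mul_card_sdiff (T := {g, h₀, h}) hA
      (Finset.card_le_three.trans (by norm_num))
    refine (abs_avg_sub_avg_le Finset.sdiff_subset (Finset.card_pos.1 (by omega)) (c := 3)
      (by norm_num) fun m _ => abs_gain_le hc0 hc3 A m).trans ?_
    gcongr
    have : ((A \ (A \ {g, h₀, h})).card : ℝ) ≤ 3 := by
      have h1 : A \ (A \ {g, h₀, h}) ⊆ {g, h₀, h} := by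
        intro x; simp only [Finset.mem_sdiff]; tauto
      exact_mod_cast (Finset.card_le_card h1).trans Finset.card_le_three
    linarith
  have hcard2 : ((siblings π A h₀).card : ℝ) ≤ 2 := by
    exact_mod_cast card_siblings_le hπ (Finset.mem_of_mem_erase hh₀)
  rw [hexp, abs_mul, abs_of_nonneg hW₀s, mul_comm]
  refine mul_le_mul_of_nonneg_right ?_ hW₀s
  calc _ ≤ ∑ h ∈ siblings π A h₀, _ := Finset.abs_sum_le_sum_abs _ _
    _ ≤ ∑ _h ∈ siblings π A h₀, 18 / (A.card : ℝ) := Finset.sum_le_sum hdiff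
    _ = (siblings π A h₀).card * (18 / (A.card : ℝ)) := by rw [Finset.sum_const, nsmul_eq_mul]
    _ ≤ 2 * (18 / (A.card : ℝ)) := by gcongr
    _ = _ := by ring

theorem abs_meanChange_le
    (hπ : ∀ v, (fiber π (Finset.univ : Finset H) v).card ≤ 3) {A : Finset H} {h₀ : H} (hh₀ : h₀ ∈ A)
    {c : ℕ → ℝ} (hc0 : ∀ k, 0 ≤ c k) (hc3 : ∀ k, c k ≤ 3) : |meanChange π c A h₀| ≤ 12 := by
  have h1 : |avg A (gain π c A)| ≤ 3 := abs_avg_le (by norm_num) fun m _ => abs_gain_le hc0 hc3 A m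
  have h2 : ((siblings π A h₀).card : ℝ) ≤ 2 := by exact_mod_cast card_siblings_le hπ hh₀
  have h3 : (0 : ℝ) ≤ (siblings π A h₀).card := by positivity
  unfold meanChange
  rw [← card_siblings hh₀]
  have h4 : |((siblings π A h₀).card : ℝ) * avg A (gain π c A)| ≤ 2 * 3 := by
    rw [abs_mul, Nat.abs_cast]; gcongr
  rw [abs_le] at h4 ⊢
  constructor <;> linarith [h4.1, h4.2, hc0 1, hc3 1, hc0 (deg π A (π h₀)), hc3 (deg π A (π h₀))]

/-- The mean change of the potential in a step, under an exchangeable weight. -/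
theorem abs_sum_weight_potential_change_sub_le
    (hπ : ∀ v, (fiber π (Finset.univ : Finset H) v).card ≤ 3) [Fintype V] {W : PairingOn H → ℝ} {A : Finset H}
    (hW0 : ∀ σ, 0 ≤ W σ)
    (hW : SwapInvariant A W) (hsupp : ∀ σ, W σ ≠ 0 → ∀ h ∈ A, σ.1 h ∈ A) {g : H} (hg : g ∈ A)
    (hg1 : deg π A (π g) = 1) (hA : 10 ≤ A.card)
    {c : ℕ → ℝ} (hc : c 0 = 0) (hc0 : ∀ k, 0 ≤ c k) (hc3 : ∀ k, c k ≤ 3) :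
    |∑ σ, W σ * (potential π c (removeSet π σ A g) - potential π c A - meanDrift π c A)| ≤
      1000 / A.card * ∑ σ, W σ := by
  have hs : ∀ σ, W σ ≠ 0 → σ.1 g ∈ A.erase g := fun σ hσ =>
    Finset.mem_erase.2 ⟨σ.2.2 g, hsupp σ hσ g hg⟩
  have hWs : 0 ≤ ∑ σ, W σ := Finset.sum_nonneg fun σ _ => hW0 σ
  have hA0' : (0 : ℝ) < A.card := by exact_mod_cast (by omega : 0 < A.card)
  have htot : ∑ σ, W σ = ∑ h ∈ A.erase g, ∑ σ, restrictWeight W g h σ := by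
    simpa using sum_weight_eq_sum_restrictWeight hs fun _ _ => 1
  -- Three successive replacements: discarding defects costs 30 · 24 = 720, averaging over the
  -- partners of the siblings 36, averaging over the partner of `g` 2 · 12 = 24. The total 780 is
  -- below 1000.
  have h1 : |∑ σ, W σ * (potential π c (removeSet π σ A g) - potential π c A -
      linearChange π c A σ (σ.1 g))| ≤ 720 / A.card * ∑ σ, W σ := by
    calc _ ≤ ∑ σ, |W σ * (potential π c (removeSet π σ A g) - potential π c A -
          linearChange π c A σ (σ.1 g))| := Finset.abs_sum_le_sum_abs _ _
      _ ≤ ∑ σ, 30 * (W σ * defects π A σ (σ.1 g)) := by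
        refine Finset.sum_le_sum fun σ _ => ?_
        rw [abs_mul, abs_of_nonneg (hW0 σ)]
        by_cases hσ : W σ = 0
        · simp [hσ]
        · have := abs_potential_change_sub_linearChange_le hπ (hsupp σ hσ) hg hg1 hc hc0 hc3
          nlinarith [hW0 σ]
      _ = 30 * ∑ h ∈ A.erase g, ∑ σ, restrictWeight W g h σ * defects π A σ h := by
        rw [← Finset.mul_sum, sum_weight_eq_sum_restrictWeight hs fun σ h => defects π A σ h]
      _ ≤ 30 * ∑ h ∈ A.erase g, 24 / A.card * ∑ σ, restrictWeight W g h σ := by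
        gcongr with h hh
        exact sum_restrictWeight_defects_le hπ hW0 hW hsupp hg hg1 hh hA
      _ = _ := by rw [← Finset.mul_sum, ← htot]; ring
  have h2 : |∑ σ, W σ * (linearChange π c A σ (σ.1 g) - meanChange π c A (σ.1 g))| ≤
      36 / A.card * ∑ σ, W σ := by
    rw [sum_weight_eq_sum_restrictWeight hs fun σ h => linearChange π c A σ h - meanChange π c A h,
      htot, Finset.mul_sum]
    refine (Finset.abs_sum_le_sum_abs _ _).trans (Finset.sum_le_sum fun h hh => ?_)
    have := abs_sum_restrictWeight_linearChange_sub_le hπ hW0 hW hsupp hg hg1 hh hA hc0 hc3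
    rwa [Finset.sum_mul, ← Finset.sum_sub_distrib,
      Finset.sum_congr rfl fun σ _ => (mul_sub _ _ _).symm] at this
  have h3 : |∑ σ, W σ * (meanChange π c A (σ.1 g) - meanDrift π c A)| ≤
      24 / A.card * ∑ σ, W σ := by
    simp only [mul_sub, Finset.sum_sub_distrib]
    rw [sum_weight_mul_apply (Finset.notMem_erase g A) (hW.mono (Finset.erase_subset _ _)) hs,
      ← Finset.sum_mul, ← mul_sub, abs_mul, abs_of_nonneg hWs, mul_comm]
    refine mul_le_mul_of_nonneg_right ?_ hWs
    have hce := Finset.card_erase_add_one hg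
    refine (abs_avg_sub_avg_le (Finset.erase_subset _ _) (Finset.card_pos.1 (by omega)) (c := 12)
      (by norm_num) fun m hm => abs_meanChange_le hπ hm hc0 hc3).trans ?_
    gcongr
    rw [Finset.sdiff_erase_self hg]
    norm_num
  have hsplit : ∑ σ, W σ * (potential π c (removeSet π σ A g) - potential π c A -
      meanDrift π c A) =
      ∑ σ, W σ * (potential π c (removeSet π σ A g) - potential π c A -
        linearChange π c A σ (σ.1 g)) +
      ∑ σ, W σ * (linearChange π c A σ (σ.1 g) - meanChange π c A (σ.1 g)) +
      ∑ σ, W σ * (meanChange π c A (σ.1 g) - meanDrift π c A) := by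
    rw [← Finset.sum_add_distrib, ← Finset.sum_add_distrib]
    exact Finset.sum_congr rfl fun σ _ => by ring
  rw [hsplit]
  refine (abs_add_three _ _ _).trans ((add_le_add (add_le_add h1 h2) h3).trans ?_)
  rw [← add_mul, ← add_mul]
  refine mul_le_mul_of_nonneg_right ?_ hWs
  rw [← add_div, ← add_div]
  gcongr
  norm_num

end Drift

/-! ### Counts of half-edges as potentials -/

section Counts
variable {d : DegreeSequence}

/-- The projection of a half-edge to its vertex. -/
abbrev vertexOf (h : HalfEdge d) : Vertex d := h.1

theorem card_fiber_vertexOf_le (v : Vertex d) :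
    (fiber vertexOf (Finset.univ : Finset (HalfEdge d)) v).card ≤ 3 := by
  have h1 : fiber vertexOf (Finset.univ : Finset (HalfEdge d)) v ⊆
      Finset.univ.image fun i : Fin (Vertex.degree v) => (⟨v, i⟩ : HalfEdge d) := by
    rintro ⟨w, i⟩ h
    obtain rfl : w = v := (mem_fiber.1 h).2
    exact Finset.mem_image.2 ⟨i, Finset.mem_univ _, rfl⟩
  refine (Finset.card_le_card h1).trans (Finset.card_image_le.trans ?_)
  rw [Finset.card_univ, Fintype.card_fin]
  rcases v with v | v | v <;> simp [Vertex.degree]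

/-- The elements of `A` attached to a vertex of degree `i`. -/
def legsOf (A : Finset (HalfEdge d)) (i : ℕ) : Finset (HalfEdge d) :=
  A.filter fun h => deg vertexOf A (vertexOf h) = i

theorem legs_eq_legsOf (s : State d) (i : ℕ) : State.legs s i = legsOf s.2 i := rfl

theorem remove_eq (s : State d) (g : HalfEdge d) :
    State.remove s g = (s.1, removeSet vertexOf s.1 s.2 g) := rfl

/-- The function of the degree whose potential counts the half-edges at vertices of degree `i`. -/
noncomputable def legWeight (i k : ℕ) : ℝ := if k = i then i else 0

theorem legWeight_nonneg (i k : ℕ) : 0 ≤ legWeight i k := by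
  unfold legWeight; positivity

theorem legWeight_le {i : ℕ} (hi : i ≤ 3) (k : ℕ) : legWeight i k ≤ 3 := by
  unfold legWeight
  split_ifs
  · exact_mod_cast hi
  · norm_num

theorem legWeight_zero (i : ℕ) : legWeight i 0 = 0 := by
  unfold legWeight
  split_ifs with h
  · simp [← h]
  · rfl

/-- A vertex of degree `i` carries `i` of these half-edges. This turns the counts into potentials,
to which the one-step estimate applies. -/
theorem card_legsOf (A : Finset (HalfEdge d)) (i : ℕ) :
    ((legsOf A i).card : ℝ) = potential vertexOf (legWeight i) A := by
  have h1 : (legsOf A i).card = ∑ v, (fiber vertexOf (legsOf A i) v).card :=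
    Finset.card_eq_sum_card_fiberwise fun x _ => Finset.mem_coe.2 (Finset.mem_univ (vertexOf x))
  rw [h1, potential, Nat.cast_sum]
  refine Finset.sum_congr rfl fun v _ => ?_
  unfold legWeight
  split_ifs with h
  · have : fiber vertexOf (legsOf A i) v = fiber vertexOf A v := by
      ext x
      simp only [mem_fiber, legsOf, Finset.mem_filter]
      constructor
      · tauto
      · rintro ⟨h2, h3⟩
        exact ⟨⟨h2, h3 ▸ h⟩, h3⟩
    rw [this]
    exact_mod_cast h
  · have : fiber vertexOf (legsOf A i) v = ∅ := by
      ext x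
      simp only [mem_fiber, legsOf, Finset.mem_filter, Finset.notMem_empty, iff_false]
      rintro ⟨⟨-, h2⟩, h3⟩
      exact h (h3 ▸ h2)
    simp [this]

theorem sum_deg_eq (A : Finset (HalfEdge d)) (f : ℕ → ℝ) :
    ∑ h ∈ A, f (deg vertexOf A (vertexOf h)) =
      f 1 * (legsOf A 1).card + f 2 * (legsOf A 2).card + f 3 * (legsOf A 3).card := by
  have hmem : ∀ h ∈ A, deg vertexOf A (vertexOf h) ∈ Finset.Icc 1 3 := fun h hh =>
    Finset.mem_Icc.2 ⟨Finset.card_pos.2 ⟨h, mem_fiber.2 ⟨hh, rfl⟩⟩,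
      deg_le_three card_fiber_vertexOf_le A _⟩
  rw [← Finset.sum_fiberwise_of_maps_to hmem]
  have h1 : ∀ i, ∑ h ∈ A with deg vertexOf A (vertexOf h) = i, f (deg vertexOf A (vertexOf h)) =
      f i * (legsOf A i).card := fun i => by
    rw [Finset.sum_congr rfl fun h hh => by rw [(Finset.mem_filter.1 hh).2], Finset.sum_const,
      nsmul_eq_mul, mul_comm]
    rfl
  simp only [h1]
  rw [show Finset.Icc 1 3 = {1, 2, 3} by decide]
  simp [add_assoc]

theorem card_eq_sum_legsOf (A : Finset (HalfEdge d)) :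
    (A.card : ℝ) = (legsOf A 1).card + (legsOf A 2).card + (legsOf A 3).card := by
  simpa using sum_deg_eq A fun _ => 1

/-- The rescaled triple as a function of the set of unmatched half-edges. -/
noncomputable def rescaledOf (A : Finset (HalfEdge d)) : ℝ × ℝ × ℝ :=
  ((legsOf A 1).card / (d.size : ℝ), (legsOf A 2).card / (d.size : ℝ),
    (legsOf A 3).card / (d.size : ℝ))

theorem rescaled_eq_rescaledOf (s : State d) : s.rescaled = rescaledOf s.2 := rfl

theorem mass_rescaledOf (A : Finset (HalfEdge d)) : mass (rescaledOf A) = A.card / d.size := by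
  rw [mass, rescaledOf, card_eq_sum_legsOf A]; ring

/-- The asymptotic drifts of the three counts are the components of `φ`. -/
theorem phi_rescaledOf {A : Finset (HalfEdge d)} (hA : A.Nonempty) (hd : 0 < d.size) :
    phi (rescaledOf A) = (meanDrift vertexOf (legWeight 1) A, meanDrift vertexOf (legWeight 2) A,
      meanDrift vertexOf (legWeight 3) A) := by
  have hn : (d.size : ℝ) ≠ 0 := by positivity
  have hS0 : (A.card : ℝ) ≠ 0 := by
    have := hA.card_pos
    positivity
  have hS := card_eq_sum_legsOf A
  have hphi : phi (rescaledOf A) = drift ((legsOf A 1).card / A.card) ((legsOf A 2).card / A.card)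
      ((legsOf A 3).card / A.card) := by
    have hm : (rescaledOf A).1 + (rescaledOf A).2.1 + (rescaledOf A).2.2 = A.card / d.size :=
      mass_rescaledOf A
    simp only [phi, hm]
    simp only [rescaledOf]
    congr 1 <;> field_simp
  have hsum : ((legsOf A 1).card / A.card : ℝ) + (legsOf A 2).card / A.card +
      (legsOf A 3).card / A.card = 1 := by
    rw [← add_div, ← add_div, ← hS, div_self hS0]
  -- The neighbour has a size-biased degree. It has y + 2z further half-edges on average, each
  -- hitting a size-biased vertex and lowering its degree by one.
  have hmean : ∀ c : ℕ → ℝ, meanDrift vertexOf c A =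
      -(c 1 * ((legsOf A 1).card / A.card) + c 2 * ((legsOf A 2).card / A.card) +
        c 3 * ((legsOf A 3).card / A.card)) - c 1 +
      ((legsOf A 2).card / A.card + 2 * ((legsOf A 3).card / A.card)) *
        ((c 0 - c 1) * ((legsOf A 1).card / A.card) + (c 1 - c 2) * ((legsOf A 2).card / A.card) +
        (c 2 - c 3) * ((legsOf A 3).card / A.card)) := by
    intro c
    have h1 : avg A (gain vertexOf c A) = (c 0 - c 1) * ((legsOf A 1).card / A.card) +
        (c 1 - c 2) * ((legsOf A 2).card / A.card) + (c 2 - c 3) * ((legsOf A 3).card / A.card) := by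
      have := sum_deg_eq A fun k => c (k - 1) - c k
      unfold avg gain
      rw [this]
      norm_num
      ring
    have h2 := sum_deg_eq A fun k => -c k - c 1 + ((k : ℝ) - 1) * avg A (gain vertexOf c A)
    unfold meanDrift
    rw [← h1]
    conv_lhs => rw [avg]
    unfold meanChange
    rw [h2]
    generalize avg A (gain vertexOf c A) = Λ
    generalize ((legsOf A 1).card : ℝ) = X at *
    generalize ((legsOf A 2).card : ℝ) = Y at *
    generalize ((legsOf A 3).card : ℝ) = Z at *
    field_simp
    rw [hS]
    push_cast
    ring
  rw [hphi, drift_eq_of_sum_eq_one hsum]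
  have hw : ∀ i : ℕ, legWeight i i = i := fun i => if_pos rfl
  have hw' : ∀ {i k : ℕ}, k ≠ i → legWeight i k = 0 := fun h => if_neg h
  simp only [hmean, hw, hw' (show 0 ≠ 1 by decide), hw' (show 2 ≠ 1 by decide),
    hw' (show 3 ≠ 1 by decide), hw' (show 0 ≠ 2 by decide), hw' (show 1 ≠ 2 by decide),
    hw' (show 3 ≠ 2 by decide), hw' (show 0 ≠ 3 by decide), hw' (show 1 ≠ 3 by decide),
    hw' (show 2 ≠ 3 by decide)]
  generalize ((legsOf A 1).card / A.card : ℝ) = x at *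
  generalize ((legsOf A 2).card / A.card : ℝ) = y at *
  generalize ((legsOf A 3).card / A.card : ℝ) = z at *
  refine Prod.ext ?_ (Prod.ext ?_ ?_) <;> push_cast <;> ring

theorem abs_meanDrift_le (A : Finset (HalfEdge d)) {c : ℕ → ℝ} (hc0 : ∀ k, 0 ≤ c k)
    (hc3 : ∀ k, c k ≤ 3) : |meanDrift vertexOf c A| ≤ 12 :=
  abs_avg_le (by norm_num) fun _ hm => abs_meanChange_le card_fiber_vertexOf_le hm hc0 hc3

end Counts

/-! ### Trajectories of the exploration -/

section Trajectories
variable {d : DegreeSequence}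

theorem stepProb_ne_zero {s s' : State d} (h : stepProb s s' ≠ 0) :
    (legsOf s.2 1 = ∅ ∧ s' = s) ∨
      ∃ g ∈ legsOf s.2 1, s' = (s.1, removeSet vertexOf s.1 s.2 g) := by
  unfold stepProb at h
  split_ifs at h with h1 h2
  · exact Or.inl ⟨h1, h2⟩
  · exact absurd rfl h
  · right
    by_contra hn
    push Not at hn
    apply h
    have : ∀ g ∈ State.legs s 1, State.remove s g ≠ s' := fun g hg e => hn g hg e.symm
    classical
    rw [Finset.filter_false_of_mem this]
    simp

/-- Possible trajectories of the exploration. -/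
structure IsTrajectory (s : ℕ → State d) : Prop where
  initial : (s 0).2 = Finset.univ
  step : ∀ k, stepProb (s k) (s (k + 1)) ≠ 0

theorem removeSet_closed {σ : Pairing d} {A : Finset (HalfEdge d)} (hA : ∀ h ∈ A, σ.1 h ∈ A)
    (g : HalfEdge d) : ∀ h ∈ removeSet vertexOf σ A g, σ.1 h ∈ removeSet vertexOf σ A g := by
  intro h hh
  simp only [removeSet, Finset.mem_filter] at hh ⊢
  refine ⟨hA h hh.1, hh.2.2, ?_⟩
  rw [σ.2.1]
  exact hh.2.1

theorem step_fst {s s' : State d} (h : stepProb s s' ≠ 0) : s'.1 = s.1 := by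
  rcases stepProb_ne_zero h with ⟨-, rfl⟩ | ⟨g, -, rfl⟩ <;> rfl

theorem step_subset {s s' : State d} (h : stepProb s s' ≠ 0) : s'.2 ⊆ s.2 := by
  rcases stepProb_ne_zero h with ⟨-, rfl⟩ | ⟨g, -, rfl⟩
  · exact subset_rfl
  · exact Finset.filter_subset _ _

theorem step_closed {s s' : State d} (h : stepProb s s' ≠ 0) (hs : ∀ h ∈ s.2, s.1.1 h ∈ s.2) :
    ∀ h ∈ s'.2, s'.1.1 h ∈ s'.2 := by
  rcases stepProb_ne_zero h with ⟨-, rfl⟩ | ⟨g, -, rfl⟩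
  · exact hs
  · exact removeSet_closed hs g

theorem step_card_sdiff_le {s s' : State d} (h : stepProb s s' ≠ 0) : (s.2 \ s'.2).card ≤ 6 := by
  rcases stepProb_ne_zero h with ⟨-, rfl⟩ | ⟨g, -, rfl⟩
  · simp
  · exact card_sdiff_removeSet_le card_fiber_vertexOf_le s.1 s.2 g

theorem step_eq_of_legsOf_eq_empty {s s' : State d} (h : stepProb s s' ≠ 0)
    (hs : legsOf s.2 1 = ∅) : s' = s := by
  rcases stepProb_ne_zero h with ⟨-, h1⟩ | ⟨g, hg, -⟩
  · exact h1
  · rw [hs] at hg; exact absurd hg (Finset.notMem_empty g)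

/-- The edge between the chosen leaf and its neighbour is always erased. -/
theorem step_card_add_two_le {s s' : State d} (h : stepProb s s' ≠ 0)
    (hs : ∀ h ∈ s.2, s.1.1 h ∈ s.2) (hl : legsOf s.2 1 ≠ ∅) : s'.2.card + 2 ≤ s.2.card := by
  rcases stepProb_ne_zero h with ⟨h1, -⟩ | ⟨g, hg, rfl⟩
  · exact absurd h1 hl
  · have hgA : g ∈ s.2 := (Finset.mem_filter.1 hg).1
    have hsub : ({g, s.1.1 g} : Finset (HalfEdge d)) ⊆ s.2 \ removeSet vertexOf s.1 s.2 g := by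
      intro x hx
      simp only [Finset.mem_insert, Finset.mem_singleton] at hx
      rcases hx with rfl | rfl
      · simp [removeSet, hgA]
      · simp [removeSet, hs g hgA]
    have h2 := Finset.card_le_card hsub
    rw [Finset.card_pair (s.1.2.2 g).symm] at h2
    have h3 := Finset.card_sdiff_add_card_eq_card
      (show removeSet vertexOf s.1 s.2 g ⊆ s.2 from Finset.filter_subset _ _)
    change (removeSet vertexOf s.1 s.2 g).card + 2 ≤ _
    omega

theorem step_abs_potential_sub_le {s s' : State d} (h : stepProb s s' ≠ 0) {c : ℕ → ℝ}
    (hc0 : ∀ k, 0 ≤ c k) (hc3 : ∀ k, c k ≤ 3) :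
    |potential vertexOf c s'.2 - potential vertexOf c s.2| ≤ 18 := by
  refine (abs_potential_sub_le hc0 hc3 (step_subset h)).trans ?_
  have : ((s.2 \ s'.2).card : ℝ) ≤ 6 := by exact_mod_cast step_card_sdiff_le h
  linarith

variable {s : ℕ → State d}

theorem IsTrajectory.closed (hs : IsTrajectory s) (k : ℕ) : ∀ h ∈ (s k).2, (s k).1.1 h ∈ (s k).2 := by
  induction k with
  | zero => rw [hs.initial]; exact fun _ _ => Finset.mem_univ _
  | succ k ih => exact step_closed (hs.step k) ih

theorem IsTrajectory.fst_eq (hs : IsTrajectory s) (k : ℕ) : (s k).1 = (s 0).1 := by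
  induction k with
  | zero => rfl
  | succ k ih => rw [step_fst (hs.step k), ih]

theorem IsTrajectory.antitone (hs : IsTrajectory s) : Antitone fun k => (s k).2 :=
  antitone_nat_of_succ_le fun k => step_subset (hs.step k)

theorem IsTrajectory.frozen (hs : IsTrajectory s) {k : ℕ} (hk : legsOf (s k).2 1 = ∅) {l : ℕ}
    (hkl : k ≤ l) : s l = s k := by
  induction l, hkl using Nat.le_induction with
  | base => rfl
  | succ l _ ih =>
    rw [← ih] at hk ⊢
    exact step_eq_of_legsOf_eq_empty (hs.step l) hk

/-- As long as there are leaves, every step removes at least two half-edges. -/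
theorem IsTrajectory.card_add_le (hs : IsTrajectory s) (k l : ℕ)
    (hl : ∀ i, k ≤ i → i < k + l → legsOf (s i).2 1 ≠ ∅) :
    (s (k + l)).2.card + 2 * l ≤ (s k).2.card := by
  induction l with
  | zero => simp
  | succ l ih =>
    have h1 := ih fun i hi hil => hl i hi (by omega)
    have h2 := step_card_add_two_le (hs.step (k + l)) (hs.closed _) (hl (k + l) (by omega) (by omega))
    rw [← add_assoc]
    omega

end Trajectories

/-! ### The law of the exploration -/

section Weights
variable {d : DegreeSequence}

/-- The probability of following the path `B` for `k` steps with the pairing `σ`. -/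
noncomputable def pathWeight (k : ℕ) (σ : Pairing d) (B : ℕ → Finset (HalfEdge d)) : ℝ :=
  (initialProb (σ, B 0) * ∏ i ∈ Finset.range k, stepProb (σ, B i) (σ, B (i + 1))).toReal

theorem pathWeight_nonneg (k : ℕ) (σ : Pairing d) (B : ℕ → Finset (HalfEdge d)) :
    0 ≤ pathWeight k σ B := ENNReal.toReal_nonneg

theorem pathWeight_ne_zero {k : ℕ} {σ : Pairing d} {B : ℕ → Finset (HalfEdge d)}
    (h : pathWeight k σ B ≠ 0) :
    B 0 = Finset.univ ∧ ∀ i < k, stepProb (σ, B i) (σ, B (i + 1)) ≠ 0 := by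
  have h1 : initialProb (σ, B 0) * ∏ i ∈ Finset.range k, stepProb (σ, B i) (σ, B (i + 1)) ≠ 0 :=
    fun e => h (by rw [pathWeight, e, ENNReal.toReal_zero])
  rw [mul_ne_zero_iff, Finset.prod_ne_zero_iff] at h1
  refine ⟨?_, fun i hi => h1.2 i (Finset.mem_range.2 hi)⟩
  by_contra hn
  exact h1.1 (if_neg hn)

theorem closed_of_pathWeight_ne_zero {k : ℕ} {σ : Pairing d} {B : ℕ → Finset (HalfEdge d)}
    (h : pathWeight k σ B ≠ 0) {i : ℕ} (hi : i ≤ k) : ∀ x ∈ B i, σ.1 x ∈ B i := by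
  obtain ⟨h0, hstep⟩ := pathWeight_ne_zero h
  induction i with
  | zero => rw [h0]; exact fun _ _ => Finset.mem_univ _
  | succ i ih => exact step_closed (hstep i hi) (ih (by omega))

theorem subset_of_pathWeight_ne_zero {k : ℕ} {σ : Pairing d} {B : ℕ → Finset (HalfEdge d)}
    (h : pathWeight k σ B ≠ 0) {i : ℕ} (hi : i ≤ k) : B k ⊆ B i := by
  obtain ⟨-, hstep⟩ := pathWeight_ne_zero h
  induction hi using Nat.decreasingInduction with
  | self => exact subset_rfl
  | of_succ i hi ih => exact ih.trans (step_subset (hstep i hi))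

/-- The half-edge `g` is itself erased, so `σ` and `τ` agree on it and remove the same vertex. A
half-edge kept under `σ` is kept under `τ` because `A'` is closed under `τ`. -/
theorem removeSet_eq_of_agree {σ τ : Pairing d} {A A' : Finset (HalfEdge d)} {g : HalfEdge d}
    (hτ : ∀ x ∈ A', τ.1 x ∈ A') (hagree : ∀ x ∉ A', τ.1 x = σ.1 x)
    (h : removeSet vertexOf σ A g = A') : removeSet vertexOf τ A g = A' := by
  have hg : τ.1 g = σ.1 g := hagree g fun hg => by
    rw [← h] at hg
    exact (Finset.mem_filter.1 hg).2.2 rfl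
  ext x
  have hmem : ∀ y, y ∈ A' ↔ y ∈ A ∧ vertexOf y ≠ vertexOf (σ.1 g) ∧
      vertexOf (σ.1 y) ≠ vertexOf (σ.1 g) := fun y => by rw [← h]; exact Finset.mem_filter
  rw [removeSet, Finset.mem_filter, hg]
  by_cases hx : x ∈ A'
  · simp only [hx, iff_true]
    exact ⟨((hmem x).1 hx).1, ((hmem x).1 hx).2.1, ((hmem _).1 (hτ x hx)).2.1⟩
  · rw [hagree x hx, ← hmem]

/-- The transition to `A'` reveals nothing about how `A'` is paired internally; this is the source
of exchangeability. -/
theorem stepProb_congr {σ τ : Pairing d} {A A' : Finset (HalfEdge d)}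
    (hσ : ∀ x ∈ A', σ.1 x ∈ A') (hτ : ∀ x ∈ A', τ.1 x ∈ A') (hagree : ∀ x ∉ A', τ.1 x = σ.1 x) :
    stepProb (τ, A) (τ, A') = stepProb (σ, A) (σ, A') := by
  have h1 : ∀ g, State.remove (τ, A) g = (τ, A') ↔ State.remove (σ, A) g = (σ, A') := by
    intro g
    simp only [remove_eq, Prod.mk.injEq, true_and]
    exact ⟨removeSet_eq_of_agree hσ fun x hx => (hagree x hx).symm, removeSet_eq_of_agree hτ hagree⟩
  have h2 : State.legs (τ, A) 1 = State.legs (σ, A) 1 := rfl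
  unfold stepProb
  classical
  rw [h2, Finset.filter_congr fun g _ => h1 g]
  simp only [Prod.mk.injEq, true_and]

/-- Given the path, the pairing of the remaining half-edges is exchangeable. -/
theorem pathWeight_swapPairing (k : ℕ) (B : ℕ → Finset (HalfEdge d)) :
    SwapInvariant (B k) fun σ => pathWeight k σ B := by
  have key : ∀ a ∈ B k, ∀ b ∈ B k, ∀ σ, pathWeight k σ B ≠ 0 →
      pathWeight k (swapPairing a b σ) B = pathWeight k σ B := by
    intro a ha b hb σ h
    have hcl := fun i hi => closed_of_pathWeight_ne_zero h (i := i) hi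
    have hsub := fun i hi => subset_of_pathWeight_ne_zero h (i := i) hi
    have hswap : ∀ i ≤ k, ∀ x ∈ B i, Equiv.swap a b x ∈ B i := by
      intro i hi x hx
      by_cases h1 : x = a
      · rw [h1, Equiv.swap_apply_left]; exact hsub i hi hb
      by_cases h2 : x = b
      · rw [h2, Equiv.swap_apply_right]; exact hsub i hi ha
      · rwa [Equiv.swap_apply_of_ne_of_ne h1 h2]
    have hne : ∀ x ∉ B k, Equiv.swap a b x = x := fun x hx =>
      Equiv.swap_apply_of_ne_of_ne (fun e => hx (e ▸ ha)) fun e => hx (e ▸ hb)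
    -- Since `B k` is closed under `σ`, the swap moves neither `x` nor its partner.
    have hagree : ∀ i ≤ k, ∀ x ∉ B i, (swapPairing a b σ).1 x = σ.1 x := by
      intro i hi x hx
      have hxk : x ∉ B k := fun e => hx (hsub i hi e)
      rw [swapPairing_apply, hne x hxk, hne]
      intro e
      have := hcl k le_rfl _ e
      rw [σ.2.1] at this
      exact hxk this
    unfold pathWeight
    congr 1
    congr 1
    refine Finset.prod_congr rfl fun i hi => ?_
    have hik : i + 1 ≤ k := Finset.mem_range.1 hi
    refine stepProb_congr (hcl _ hik) (fun x hx => ?_) (hagree _ hik)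
    rw [swapPairing_apply]
    exact hswap _ hik _ (hcl _ hik _ (hswap _ hik _ hx))
  intro a ha b hb σ
  -- A zero weight stays zero, since `key` applied to the swapped pairing would otherwise lead back
  -- to a nonzero one.
  by_cases h : pathWeight k σ B = 0
  · by_contra hn
    have h1 : pathWeight k (swapPairing a b σ) B ≠ 0 := fun e => hn (e.trans h.symm)
    have h2 := key a ha b hb _ h1
    rw [swapPairing_involutive a b σ] at h2
    exact hn h2.symm
  · exact key a ha b hb σ h

theorem sum_stepProb_mul (σ : Pairing d) {A : Finset (HalfEdge d)} (hA : legsOf A 1 ≠ ∅)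
    (Ψ : Finset (HalfEdge d) → ℝ) :
    ∑ A', (stepProb (σ, A) (σ, A')).toReal * Ψ A' =
      (∑ g ∈ legsOf A 1, Ψ (removeSet vertexOf σ A g)) / (legsOf A 1).card := by
  classical
  have h1 : ∀ A', (stepProb (σ, A) (σ, A')).toReal =
      (∑ g ∈ legsOf A 1, if removeSet vertexOf σ A g = A' then 1 else 0) /
        (legsOf A 1).card := by
    intro A'
    have h2 : ∀ g, State.remove (σ, A) g = (σ, A') ↔ removeSet vertexOf σ A g = A' := fun g => by
      simp only [remove_eq, Prod.mk.injEq, true_and]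
    unfold stepProb
    rw [legs_eq_legsOf, if_neg hA, ENNReal.toReal_div, ENNReal.toReal_natCast,
      ENNReal.toReal_natCast, Finset.sum_boole]
    simp only [h2]
  simp only [h1, div_mul_eq_mul_div, ← Finset.sum_div, Finset.sum_mul]
  rw [Finset.sum_comm]
  simp

end Weights

/-! ### Laws of histories and the drift tested against the past -/

section Law
variable {d : DegreeSequence} {Ω : Type*} [MeasurableSpace Ω] {P : Measure Ω}
  {ξ : ℕ → Ω → State d}

theorem IsExploration.measurableSet (hξ : IsExploration P d ξ) (k : ℕ) (p : State d → Prop) :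
    MeasurableSet {ω | p (ξ k ω)} := by
  have h1 : {ω | p (ξ k ω)} = ⋃ s ∈ {s | p s}, {ω | ξ k ω = s} := by ext; simp
  rw [h1]
  exact MeasurableSet.biUnion (Set.to_countable _) fun s _ => hξ.measurable k s

/-- Almost surely, the exploration follows a possible trajectory. -/
theorem IsExploration.ae_isTrajectory (hξ : IsExploration P d ξ) :
    ∀ᵐ ω ∂P, IsTrajectory fun k => ξ k ω := by
  have h0 : ∀ᵐ ω ∂P, (ξ 0 ω).2 = Finset.univ := by
    rw [ae_iff]
    refine measure_mono_null (t := ⋃ s : {s : State d // s.2 ≠ Finset.univ},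
      {ω | ∀ i ≤ 0, ξ i ω = s.1}) (fun ω hω => ?_) (measure_iUnion_null fun s => ?_)
    · refine Set.mem_iUnion.2 ⟨⟨ξ 0 ω, hω⟩, fun i hi => ?_⟩
      rw [Nat.le_zero.1 hi]
    · rw [hξ.law 0 fun _ => s.1, initialProb, if_neg s.2, zero_mul]
  have hstep : ∀ k, ∀ᵐ ω ∂P, stepProb (ξ k ω) (ξ (k + 1) ω) ≠ 0 := by
    intro k
    rw [ae_iff]
    -- Finite histories become sequences by repeating their last state. There are finitely many, so
    -- the union of the null ones is null.
    set T : (Fin (k + 2) → State d) → ℕ → State d := fun q i => q ⟨min i (k + 1), by omega⟩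
    refine measure_mono_null (t := ⋃ q : {q : Fin (k + 2) → State d //
      stepProb (T q k) (T q (k + 1)) = 0}, {ω | ∀ i ≤ k + 1, ξ i ω = T q.1 i})
      (fun ω hω => ?_) (measure_iUnion_null fun q => ?_)
    · have hT : ∀ i ≤ k + 1, T (fun i => ξ i ω) i = ξ i ω := fun i hi => by
        simp only [T, min_eq_left hi]
      refine Set.mem_iUnion.2 ⟨⟨fun i => ξ i ω, ?_⟩, fun i hi => (hT i hi).symm⟩
      rw [hT k (by omega), hT (k + 1) le_rfl]
      simpa using hω
    · rw [hξ.law (k + 1) (T q.1), Finset.prod_range_succ, q.2, mul_zero, mul_zero]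
  filter_upwards [h0, ae_all_iff.2 hstep] with ω h1 h2
  exact ⟨h1, h2⟩

theorem integral_comp_of_finite [IsProbabilityMeasure P] {α : Type*} [Fintype α] {Q : Ω → α}
    (hQ : ∀ a, MeasurableSet {ω | Q ω = a}) (F : α → ℝ) :
    Integrable (fun ω => F (Q ω)) P ∧ ∫ ω, F (Q ω) ∂P = ∑ a, P.real {ω | Q ω = a} * F a := by
  let _ : MeasurableSpace α := ⊤
  have hQm : Measurable Q := measurable_to_countable' hQ
  have hF : Measurable F := measurable_from_top
  have : IsProbabilityMeasure (P.map Q) := Measure.isProbabilityMeasure_map hQm.aemeasurable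
  have hi : Integrable F (P.map Q) := Integrable.of_finite
  refine ⟨(integrable_map_measure hF.aestronglyMeasurable hQm.aemeasurable).1 hi, ?_⟩
  rw [← integral_map hQm.aemeasurable hF.aestronglyMeasurable, integral_fintype hi]
  refine Finset.sum_congr rfl fun a _ => ?_
  rw [map_measureReal_apply hQm (measurableSet_singleton a), smul_eq_mul]
  rfl

/-- A finite history as an infinite sequence. -/
def extend {α : Type*} {k : ℕ} (A : Fin (k + 1) → α) (i : ℕ) : α := A ⟨min i k, by omega⟩

theorem extend_apply {α : Type*} {k : ℕ} (B : ℕ → α) {i : ℕ} (hi : i ≤ k) :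
    extend (fun j : Fin (k + 1) => B j) i = B i := by
  simp only [extend, min_eq_left hi]

theorem IsExploration.measurableSet_history (hξ : IsExploration P d ξ) (k : ℕ)
    (a : Pairing d × (Fin (k + 1) → Finset (HalfEdge d)) × Finset (HalfEdge d)) :
    MeasurableSet {ω | ((ξ 0 ω).1, (fun i : Fin (k + 1) => (ξ i ω).2), (ξ (k + 1) ω).2) = a} := by
  have h1 : {ω | ((ξ 0 ω).1, (fun i : Fin (k + 1) => (ξ i ω).2), (ξ (k + 1) ω).2) = a} =
      {ω | (ξ 0 ω).1 = a.1} ∩ ((⋂ i : Fin (k + 1), {ω | (ξ i ω).2 = a.2.1 i}) ∩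
        {ω | (ξ (k + 1) ω).2 = a.2.2}) := by
    ext ω
    simp [Prod.ext_iff, funext_iff]
  rw [h1]
  exact (hξ.measurableSet 0 fun s => s.1 = a.1).inter
    ((MeasurableSet.iInter fun i : Fin (k + 1) => hξ.measurableSet i fun s => s.2 = a.2.1 i).inter
      (hξ.measurableSet (k + 1) fun s => s.2 = a.2.2))

/-- The pairing is recorded at time 0 only, because it is almost surely constant. It is kept apart
from the unmatched sets so that it can be summed out for a fixed history. -/
theorem IsExploration.measureReal_history (hξ : IsExploration P d ξ) (k : ℕ)
    (σ : Pairing d) (A : Fin (k + 1) → Finset (HalfEdge d)) (A' : Finset (HalfEdge d)) :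
    P.real {ω | ((ξ 0 ω).1, (fun i : Fin (k + 1) => (ξ i ω).2), (ξ (k + 1) ω).2) = (σ, A, A')} =
      pathWeight k σ (extend A) * (stepProb (σ, extend A k) (σ, A')).toReal := by
  set s : ℕ → State d := fun i => (σ, if i ≤ k then extend A i else A') with hs
  have h1 : P {ω | ((ξ 0 ω).1, (fun i : Fin (k + 1) => (ξ i ω).2), (ξ (k + 1) ω).2) = (σ, A, A')} =
      P {ω | ∀ i ≤ k + 1, ξ i ω = s i} := by
    refine measure_congr ?_
    filter_upwards [hξ.ae_isTrajectory] with ω hω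
    refine propext ?_
    change ((ξ 0 ω).1, (fun i : Fin (k + 1) => (ξ i ω).2), (ξ (k + 1) ω).2) = (σ, A, A') ↔
      ∀ i ≤ k + 1, ξ i ω = s i
    simp only [Prod.mk.injEq, hs]
    constructor
    · rintro ⟨e1, e2, e3⟩ i hi
      refine Prod.ext ((hω.fst_eq i).trans e1) ?_
      simp only
      split_ifs with hik
      · rw [← e2]; exact (extend_apply (fun j => (ξ j ω).2) hik).symm
      · obtain rfl : i = k + 1 := by omega
        exact e3
    · intro h
      refine ⟨by rw [h 0 (by omega)], ?_, by rw [h (k + 1) le_rfl]; simp⟩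
      ext1 i
      have hik : (i : ℕ) ≤ k := by omega
      rw [h i (by omega)]
      simp only [hik, if_true, extend, min_eq_left hik]
  rw [Measure.real, h1, hξ.law (k + 1) s, Finset.prod_range_succ, ← mul_assoc, ENNReal.toReal_mul,
    pathWeight]
  have h2 : ∀ i ≤ k, s i = (σ, extend A i) := fun i hi => by simp only [hs, hi, if_true]
  have h3 : s (k + 1) = (σ, A') := by simp [hs]
  rw [h2 0 (by omega), h2 k le_rfl, h3, Finset.prod_congr rfl fun i hi => by
    rw [h2 i (Finset.mem_range.1 hi).le, h2 (i + 1) (Finset.mem_range.1 hi)]]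

variable [IsProbabilityMeasure P]

set_option synthInstance.maxSize 512 in
theorem IsExploration.integrable_history (hξ : IsExploration P d ξ) (k : ℕ)
    (G : (Fin (k + 1) → Finset (HalfEdge d)) → Finset (HalfEdge d) → ℝ) :
    Integrable (fun ω => G (fun i => (ξ i ω).2) (ξ (k + 1) ω).2) P :=
  (integral_comp_of_finite (hξ.measurableSet_history k) fun a => G a.2.1 a.2.2).1

set_option synthInstance.maxSize 512 in
-- With the history fixed outside and the pairing summed inside, `pathWeight` acts as the
-- unnormalised conditional law of the pairing.
theorem IsExploration.integral_history (hξ : IsExploration P d ξ) (k : ℕ)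
    (G : (Fin (k + 1) → Finset (HalfEdge d)) → Finset (HalfEdge d) → ℝ) :
    ∫ ω, G (fun i => (ξ i ω).2) (ξ (k + 1) ω).2 ∂P =
      ∑ A, ∑ σ : Pairing d, pathWeight k σ (extend A) *
        ∑ A', (stepProb (σ, extend A k) (σ, A')).toReal * G A A' := by
  rw [(integral_comp_of_finite (hξ.measurableSet_history k) fun a => G a.2.1 a.2.2).2,
    Fintype.sum_prod_type, Finset.sum_congr rfl fun σ _ => Fintype.sum_prod_type _,
    Finset.sum_comm]
  refine Finset.sum_congr rfl fun A _ => Finset.sum_congr rfl fun σ _ => ?_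
  rw [Finset.mul_sum]
  refine Finset.sum_congr rfl fun A' _ => ?_
  rw [hξ.measureReal_history, mul_assoc]

/-- The drift of the potential, tested against a function of the past. -/
theorem IsExploration.abs_integral_mul_potential_change_le (hξ : IsExploration P d ξ) (k : ℕ)
    {s₀ : ℝ} (hs₀ : 10 ≤ s₀) {F : (Fin (k + 1) → Finset (HalfEdge d)) → ℝ}
    (hF : ∀ A, F A ≠ 0 → legsOf (A (Fin.last k)) 1 ≠ ∅ ∧ s₀ ≤ (A (Fin.last k)).card)
    {c : ℕ → ℝ} (hc : c 0 = 0) (hc0 : ∀ k, 0 ≤ c k) (hc3 : ∀ k, c k ≤ 3) :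
    |∫ ω, F (fun i => (ξ i ω).2) * (potential vertexOf c (ξ (k + 1) ω).2 -
      potential vertexOf c (ξ k ω).2 - meanDrift vertexOf c (ξ k ω).2) ∂P| ≤
      1000 / s₀ * ∫ ω, |F fun i => (ξ i ω).2| ∂P := by
  have h1 := hξ.integral_history k fun A A' => F A * (potential vertexOf c A' -
    potential vertexOf c (A (Fin.last k)) - meanDrift vertexOf c (A (Fin.last k)))
  have h2 := hξ.integral_history k fun A _ => |F A|
  simp only [Fin.val_last] at h1
  rw [h1, h2, Finset.mul_sum]
  refine (Finset.abs_sum_le_sum_abs _ _).trans (Finset.sum_le_sum fun A _ => ?_)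
  by_cases hFA : F A = 0
  · simp [hFA]
  obtain ⟨hl, hs⟩ := hF A hFA
  have hext : extend A k = A (Fin.last k) := by simp [extend, Fin.last]
  rw [hext]
  set B := A (Fin.last k) with hB
  have hl0 : (0 : ℝ) < (legsOf B 1).card := by
    exact_mod_cast Finset.card_pos.2 (Finset.nonempty_iff_ne_empty.2 hl)
  set w : Pairing d → ℝ := fun σ => pathWeight k σ (extend A) with hw
  have hw0 : ∀ σ, 0 ≤ w σ := fun σ => pathWeight_nonneg _ _ _
  have hws : 0 ≤ ∑ σ, w σ := Finset.sum_nonneg fun σ _ => hw0 σ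
  have hB10 : 10 ≤ B.card := by exact_mod_cast hs₀.trans hs
  -- `F` depends on the unmatched sets alone, so for a fixed history it is a constant factor and the
  -- weights `w` are exchangeable on `B`.
  have hinner : ∀ g ∈ legsOf B 1, |∑ σ, w σ * (potential vertexOf c (removeSet vertexOf σ B g) -
      potential vertexOf c B - meanDrift vertexOf c B)| ≤ 1000 / s₀ * ∑ σ, w σ := by
    intro g hg
    obtain ⟨hgB, hg1⟩ := Finset.mem_filter.1 hg
    refine (abs_sum_weight_potential_change_sub_le card_fiber_vertexOf_le hw0 ?_ ?_ hgB hg1 hB10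
      hc hc0 hc3).trans ?_
    · have := pathWeight_swapPairing k (extend A)
      rwa [hext] at this
    · intro σ hσ
      have := closed_of_pathWeight_ne_zero hσ le_rfl
      rwa [hext] at this
    · gcongr
  have hR : ∑ σ, w σ * ∑ A', (stepProb (σ, B) (σ, A')).toReal * |F A| = (∑ σ, w σ) * |F A| := by
    rw [Finset.sum_mul]
    refine Finset.sum_congr rfl fun σ _ => ?_
    rw [sum_stepProb_mul σ hl fun _ => |F A|, Finset.sum_const, nsmul_eq_mul,
      mul_div_cancel_left₀ _ hl0.ne']
  have hL : ∑ σ, w σ * ∑ A', (stepProb (σ, B) (σ, A')).toReal * (F A * (potential vertexOf c A' -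
      potential vertexOf c B - meanDrift vertexOf c B)) =
      F A * ((∑ g ∈ legsOf B 1, ∑ σ, w σ * (potential vertexOf c (removeSet vertexOf σ B g) -
      potential vertexOf c B - meanDrift vertexOf c B)) / (legsOf B 1).card) := by
    rw [Finset.sum_comm, Finset.sum_div, Finset.mul_sum]
    refine Finset.sum_congr rfl fun σ _ => ?_
    rw [sum_stepProb_mul σ hl fun A' => F A * (potential vertexOf c A' -
      potential vertexOf c B - meanDrift vertexOf c B), ← Finset.mul_sum, ← Finset.mul_sum]
    ring
  rw [hR, hL, abs_mul, abs_div, abs_of_pos hl0]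
  have hsum : |∑ g ∈ legsOf B 1, ∑ σ, w σ * (potential vertexOf c (removeSet vertexOf σ B g) -
      potential vertexOf c B - meanDrift vertexOf c B)| / (legsOf B 1).card ≤
      1000 / s₀ * ∑ σ, w σ := by
    rw [div_le_iff₀ hl0]
    calc _ ≤ _ := Finset.abs_sum_le_sum_abs _ _
      _ ≤ ∑ _g ∈ legsOf B 1, 1000 / s₀ * ∑ σ, w σ := Finset.sum_le_sum hinner
      _ = _ := by rw [Finset.sum_const, nsmul_eq_mul, mul_comm]
  nlinarith [abs_nonneg (F A)]

end Law

/-! ### Second moment bound for the noise -/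

section Noise
variable {d : DegreeSequence}

/-- There are leaves, and at least `s₀` half-edges are unmatched. -/
def IsActive (s₀ : ℝ) (A : Finset (HalfEdge d)) : Prop := legsOf A 1 ≠ ∅ ∧ s₀ ≤ A.card

open Classical in
/-- The centred change of the potential in a step from an active state. -/
noncomputable def noise (s₀ : ℝ) (c : ℕ → ℝ) (A A' : Finset (HalfEdge d)) : ℝ :=
  if IsActive s₀ A then
    potential vertexOf c A' - potential vertexOf c A - meanDrift vertexOf c A else 0

/-- The accumulated noise. -/
noncomputable def noiseSum (s₀ : ℝ) (c : ℕ → ℝ) (U : ℕ → Finset (HalfEdge d)) (k : ℕ) : ℝ :=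
  ∑ i ∈ Finset.range k, noise s₀ c (U i) (U (i + 1))

variable {c : ℕ → ℝ}

theorem abs_noise_le (s₀ : ℝ) (hc0 : ∀ k, 0 ≤ c k) (hc3 : ∀ k, c k ≤ 3) {s s' : State d}
    (h : stepProb s s' ≠ 0) : |noise s₀ c s.2 s'.2| ≤ 30 := by
  unfold noise
  split_ifs
  · have h1 := step_abs_potential_sub_le h hc0 hc3
    have h2 := abs_meanDrift_le s.2 hc0 hc3
    exact (abs_sub _ _).trans (by linarith)
  · norm_num

theorem IsTrajectory.abs_noiseSum_sub_le {s : ℕ → State d} (hs : IsTrajectory s) (s₀ : ℝ)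
    (hc0 : ∀ k, 0 ≤ c k) (hc3 : ∀ k, c k ≤ 3) {k l : ℕ} (hkl : k ≤ l) :
    |noiseSum s₀ c (fun i => (s i).2) l - noiseSum s₀ c (fun i => (s i).2) k| ≤
      30 * ((l : ℝ) - k) := by
  unfold noiseSum
  rw [← Finset.sum_Ico_eq_sub _ hkl]
  calc _ ≤ _ := Finset.abs_sum_le_sum_abs _ _
    _ ≤ ∑ _i ∈ Finset.Ico k l, (30 : ℝ) :=
      Finset.sum_le_sum fun i _ => abs_noise_le s₀ hc0 hc3 (hs.step i)
    _ = _ := by rw [Finset.sum_const, Nat.card_Ico, nsmul_eq_mul, Nat.cast_sub hkl, mul_comm]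

variable {Ω : Type*} [MeasurableSpace Ω] {P : Measure Ω} [IsProbabilityMeasure P]
  {ξ : ℕ → Ω → State d}

theorem IsExploration.integrable_noiseSum (hξ : IsExploration P d ξ) (s₀ : ℝ) (k : ℕ)
    (f : ℝ → ℝ) : Integrable (fun ω => f (noiseSum s₀ c (fun i => (ξ i ω).2) k)) P := by
  have := hξ.integrable_history k fun A _ =>
    f (∑ i : Fin k, noise s₀ c (A i.castSucc) (A i.succ))
  refine this.congr (Eventually.of_forall fun ω => ?_)
  simp only [noiseSum, Finset.sum_range, Fin.val_castSucc, Fin.val_succ]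

/-- The noise behaves like a martingale with bounded increments. -/
theorem IsExploration.integral_noiseSum_sq_le (hξ : IsExploration P d ξ) {s₀ : ℝ} (hs₀ : 10 ≤ s₀)
    (hc : c 0 = 0) (hc0 : ∀ k, 0 ≤ c k) (hc3 : ∀ k, c k ≤ 3) (K : ℕ) {k : ℕ} (hk : k ≤ K) :
    ∫ ω, noiseSum s₀ c (fun i => (ξ i ω).2) k ^ 2 ∂P ≤ k * (900 + 60000 * K / s₀) := by
  induction k with
  | zero => simp [noiseSum]
  | succ k ih =>
    have ihk := ih (by omega)
    set M : Ω → ℝ := fun ω => noiseSum s₀ c (fun i => (ξ i ω).2) k with hM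
    set D : Ω → ℝ := fun ω => noise s₀ c (ξ k ω).2 (ξ (k + 1) ω).2 with hD
    classical
    set F : (Fin (k + 1) → Finset (HalfEdge d)) → ℝ := fun A =>
      if IsActive s₀ (A (Fin.last k)) then
        ∑ i : Fin k, noise s₀ c (A i.castSucc) (A i.succ) else 0 with hF
    have hFM : ∀ ω, F (fun i => (ξ i ω).2) = if IsActive s₀ (ξ k ω).2 then M ω else 0 := by
      intro ω
      simp only [hF, hM, noiseSum, Finset.sum_range, Fin.val_castSucc, Fin.val_succ, Fin.val_last]
    have hMD : ∀ ω, M ω * D ω = F (fun i => (ξ i ω).2) *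
        (potential vertexOf c (ξ (k + 1) ω).2 - potential vertexOf c (ξ k ω).2 -
          meanDrift vertexOf c (ξ k ω).2) := by
      intro ω
      rw [hFM]
      simp only [hD, noise]
      split_ifs <;> simp
    have hMb : ∀ᵐ ω ∂P, |M ω| ≤ 30 * K := by
      filter_upwards [hξ.ae_isTrajectory] with ω hω
      have h1 := hω.abs_noiseSum_sub_le s₀ hc0 hc3 (Nat.zero_le k)
      have h2 : (k : ℝ) ≤ K := by exact_mod_cast (by omega : k ≤ K)
      simp only [noiseSum, Finset.range_zero, Finset.sum_empty, sub_zero, Nat.cast_zero] at h1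
      exact h1.trans (by linarith)
    have hFint : Integrable (fun ω => |F fun i => (ξ i ω).2|) P :=
      hξ.integrable_history k fun A _ => |F A|
    -- The past noise is at most 30K and the drift error 1000/s₀. Doubling the product gives the
    -- term 60000K/s₀.
    have hcross : ∫ ω, M ω * D ω ∂P ≤ 30000 * K / s₀ := by
      have h1 := hξ.abs_integral_mul_potential_change_le k hs₀ (F := F) (fun A hA => by
        by_contra hn
        exact hA (if_neg hn)) hc hc0 hc3
      simp only [← hMD] at h1
      have h2 : ∫ ω, |F fun i => (ξ i ω).2| ∂P ≤ 30 * K := by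
        have h3 : ∫ ω, |F fun i => (ξ i ω).2| ∂P ≤ ∫ _ω, (30 * K : ℝ) ∂P := by
          refine integral_mono_ae hFint (integrable_const _) ?_
          filter_upwards [hMb] with ω hω
          rw [hFM]
          split_ifs
          · exact hω
          · rw [abs_zero]; positivity
        simpa using h3
      have hs0 : 0 < s₀ := by linarith
      calc ∫ ω, M ω * D ω ∂P ≤ _ := le_abs_self _
        _ ≤ _ := h1
        _ ≤ 1000 / s₀ * (30 * K) := by gcongr
        _ = _ := by ring
    have hDint : Integrable (fun ω => D ω ^ 2) P :=
      (hξ.integrable_history k fun A A' => noise s₀ c (A (Fin.last k)) A' ^ 2).congr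
        (Eventually.of_forall fun ω => by simp only [hD, Fin.val_last])
    have hsq : ∫ ω, D ω ^ 2 ∂P ≤ 900 := by
      have h3 : ∫ ω, D ω ^ 2 ∂P ≤ ∫ _ω, (900 : ℝ) ∂P := by
        refine integral_mono_ae hDint (integrable_const _) ?_
        filter_upwards [hξ.ae_isTrajectory] with ω hω
        have h4 := abs_noise_le s₀ hc0 hc3 (hω.step k)
        have h5 : D ω ^ 2 ≤ 30 ^ 2 := sq_le_sq' (abs_le.1 h4).1 (abs_le.1 h4).2
        simpa using h5.trans (by norm_num)
      simpa using h3
    have hMint : Integrable (fun ω => M ω ^ 2) P := hξ.integrable_noiseSum s₀ k fun x => x ^ 2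
    have hMDint : Integrable (fun ω => M ω * D ω) P :=
      (hξ.integrable_history k fun A A' => F A * (potential vertexOf c A' -
        potential vertexOf c (A (Fin.last k)) - meanDrift vertexOf c (A (Fin.last k)))).congr
        (Eventually.of_forall fun ω => by simp only [hMD, Fin.val_last])
    have hexp : ∀ ω, noiseSum s₀ c (fun i => (ξ i ω).2) (k + 1) ^ 2 =
        M ω ^ 2 + (2 * (M ω * D ω) + D ω ^ 2) := by
      intro ω
      simp only [hM, hD, noiseSum, Finset.sum_range_succ]
      ring
    simp only [hexp]
    have hsum : Integrable (fun ω => 2 * (M ω * D ω) + D ω ^ 2) P :=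
      (hMDint.const_mul 2).add hDint
    rw [integral_add hMint hsum, integral_add (hMDint.const_mul 2) hDint, integral_const_mul]
    push_cast
    have : 2 * (30000 * (K : ℝ) / s₀) = 60000 * K / s₀ := by ring
    linarith

/-- Chebyshev's inequality, with a bound uniform in k ≤ K for the union over a grid. -/
theorem IsExploration.measure_noiseSum_le (hξ : IsExploration P d ξ) {s₀ : ℝ} (hs₀ : 10 ≤ s₀)
    (hc : c 0 = 0) (hc0 : ∀ k, 0 ≤ c k) (hc3 : ∀ k, c k ≤ 3) {K k : ℕ} (hk : k ≤ K) {b : ℝ}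
    (hb : 0 < b) :
    P {ω | b < |noiseSum s₀ c (fun i => (ξ i ω).2) k|} ≤
      ENNReal.ofReal (K * (900 + 60000 * K / s₀) / b ^ 2) := by
  have h1 := mul_meas_ge_le_integral_of_nonneg (μ := P)
    (f := fun ω => noiseSum s₀ c (fun i => (ξ i ω).2) k ^ 2)
    (Eventually.of_forall fun ω => sq_nonneg _) (hξ.integrable_noiseSum s₀ k fun x => x ^ 2) (b ^ 2)
  have h2 := hξ.integral_noiseSum_sq_le hs₀ hc hc0 hc3 K hk
  have hs0 : 0 < s₀ := by linarith
  have h3 : (k : ℝ) * (900 + 60000 * K / s₀) ≤ K * (900 + 60000 * K / s₀) := by gcongr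
  have h4 : P.real {ω | b ^ 2 ≤ noiseSum s₀ c (fun i => (ξ i ω).2) k ^ 2} ≤
      K * (900 + 60000 * K / s₀) / b ^ 2 := by
    rw [le_div_iff₀ (by positivity), mul_comm]
    exact h1.trans (h2.trans h3)
  calc _ ≤ P {ω | b ^ 2 ≤ noiseSum s₀ c (fun i => (ξ i ω).2) k ^ 2} := by
        refine measure_mono fun ω hω => ?_
        have hω' : b < |noiseSum s₀ c (fun i => (ξ i ω).2) k| := hω
        change b ^ 2 ≤ noiseSum s₀ c (fun i => (ξ i ω).2) k ^ 2
        rw [← sq_abs (noiseSum _ _ _ _)]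
        gcongr
    _ = ENNReal.ofReal (P.real _) := (ofReal_measureReal).symm
    _ ≤ _ := ENNReal.ofReal_le_ofReal h4

/-- Maximal inequality on a grid of mesh `q`. -/
theorem IsExploration.measure_exists_noiseSum_le (hξ : IsExploration P d ξ) {s₀ : ℝ}
    (hs₀ : 10 ≤ s₀) (hc : c 0 = 0) (hc0 : ∀ k, 0 ≤ c k) (hc3 : ∀ k, c k ≤ 3) {q J : ℕ}
    (hq : 0 < q) {b : ℝ} (hb : 0 < b) :
    P {ω | ∃ k ≤ J * q, b + 30 * q < |noiseSum s₀ c (fun i => (ξ i ω).2) k|} ≤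
      ENNReal.ofReal ((J + 1) * ((J * q) * (900 + 60000 * (J * q) / s₀) / b ^ 2)) := by
  have h1 : P {ω | ∃ k ≤ J * q, b + 30 * q < |noiseSum s₀ c (fun i => (ξ i ω).2) k|} ≤
      P (⋃ i ∈ Finset.range (J + 1),
        {ω | b < |noiseSum s₀ c (fun i => (ξ i ω).2) (i * q)|}) := by
    refine measure_mono_ae ?_
    filter_upwards [hξ.ae_isTrajectory] with ω hω
    rintro ⟨k, hk, hbk⟩
    change ω ∈ ⋃ i ∈ Finset.range (J + 1), _
    simp only [Set.mem_iUnion]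
    -- Fewer than `q` steps separate `k` from the grid point below it, and each moves the noise by
    -- at most 30.
    refine ⟨k / q, Finset.mem_range.2 ?_, ?_⟩
    · have := Nat.div_le_of_le_mul (show k ≤ q * J by rw [mul_comm]; exact hk)
      omega
    · have h2 := hω.abs_noiseSum_sub_le s₀ hc0 hc3 (Nat.div_mul_le_self k q)
      have h3 : (k : ℝ) - (k / q * q : ℕ) ≤ q := by
        have := Nat.div_add_mod' k q
        have h4 := Nat.mod_lt k hq
        have h5 : (k : ℝ) ≤ (k / q * q : ℕ) + q := by exact_mod_cast (by omega)
        linarith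
      have h4 := abs_sub_abs_le_abs_sub (noiseSum s₀ c (fun i => (ξ i ω).2) k)
        (noiseSum s₀ c (fun i => (ξ i ω).2) (k / q * q))
      change b < |noiseSum s₀ c (fun i => (ξ i ω).2) (k / q * q)|
      linarith
  refine h1.trans ((measure_biUnion_finset_le _ _).trans ?_)
  calc _ ≤ ∑ _i ∈ Finset.range (J + 1),
        ENNReal.ofReal ((J * q) * (900 + 60000 * (J * q) / s₀) / b ^ 2) := by
        refine Finset.sum_le_sum fun i hi => ?_
        have := hξ.measure_noiseSum_le hs₀ hc hc0 hc3 (K := J * q) (k := i * q)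
          (Nat.mul_le_mul_right q (by have := Finset.mem_range.1 hi; omega)) hb
        exact_mod_cast this
    _ = _ := by
      have hs0 : 0 < s₀ := by linarith
      rw [Finset.sum_const, Finset.card_range, nsmul_eq_mul, ENNReal.ofReal_mul (by positivity)]
      congr 1
      rw [← ENNReal.ofReal_natCast]
      push_cast
      rfl

end Noise

/-- The noise is negligible on the linear time scale, with a bound depending only on the size. -/
theorem exists_measure_noiseSum_le {T δ ε : ℝ} (hδ : 0 < δ) (hε : 0 < ε) :
    ∃ C n₀ : ℝ, ∀ (d : DegreeSequence) (Ω : Type*) [MeasurableSpace Ω] (P : Measure Ω)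
      [IsProbabilityMeasure P] (ξ : ℕ → Ω → State d), IsExploration P d ξ → n₀ ≤ d.size →
      ∀ c : ℕ → ℝ, c 0 = 0 → (∀ k, 0 ≤ c k) → (∀ k, c k ≤ 3) →
      P {ω | ∃ k : ℕ, (k : ℝ) ≤ T * d.size ∧
        ε * d.size < |noiseSum (δ * d.size) c (fun i => (ξ i ω).2) k|} ≤
        ENNReal.ofReal (C / d.size) := by
  -- The mesh is q ≤ en + 1, so 30q ≤ εn/4 + 30 ≤ εn/2 once n ≥ 120/ε; the other half of εn is left
  -- for Chebyshev at the grid points.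
  set e := ε / 120 with he
  have he0 : 0 < e := by positivity
  set J := ⌈T / e⌉₊ with hJ
  -- The number J + 1 of grid points does not depend on n, and each contributes O(n)/n². The
  -- requirement n ≥ 10/δ gives s₀ = δn ≥ 10.
  refine ⟨(J + 1) * ((J * (e + 1)) * (900 + 60000 * (J * (e + 1)) / δ) * 4 / ε ^ 2),
    max 1 (max (10 / δ) (120 / ε)), ?_⟩
  intro d Ω _ P _ ξ hξ hn c hc hc0 hc3
  set n : ℝ := (d.size : ℝ) with hnd
  have hn1 : 1 ≤ n := (le_max_left _ _).trans hn
  have hn2 : 10 / δ ≤ n := (le_max_left _ _).trans ((le_max_right _ _).trans hn)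
  have hn3 : 120 / ε ≤ n := (le_max_right _ _).trans ((le_max_right _ _).trans hn)
  have hn0 : 0 < n := by linarith
  rw [div_le_iff₀ hδ] at hn2
  rw [div_le_iff₀ hε] at hn3
  set q := ⌈e * n⌉₊ with hq
  have hq0 : 0 < q := Nat.ceil_pos.2 (by positivity)
  have hq1 : (q : ℝ) ≤ e * n + 1 := (Nat.ceil_lt_add_one (by positivity)).le
  have hq2 : e * n ≤ q := Nat.le_ceil _
  have hq3 : (q : ℝ) ≤ (e + 1) * n := by linarith
  have h1 := hξ.measure_exists_noiseSum_le (s₀ := δ * n) (by linarith) hc hc0 hc3 (J := J) hq0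
    (b := ε * n / 2) (by positivity)
  refine (measure_mono ?_).trans (h1.trans (ENNReal.ofReal_le_ofReal ?_))
  · rintro ω ⟨k, hk, hkε⟩
    refine ⟨k, ?_, lt_of_le_of_lt ?_ hkε⟩
    · have h2 : (k : ℝ) ≤ J * q := by
        calc (k : ℝ) ≤ T * n := hk
          _ = T / e * (e * n) := by field_simp
          _ ≤ J * q := by
            gcongr
            exact Nat.le_ceil _
      exact_mod_cast h2
    · have : e * n = ε * n / 120 := by rw [he]; ring
      linarith
  · have h2 : (J : ℝ) * q ≤ J * ((e + 1) * n) := by gcongr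
    calc _ ≤ (J + 1) * ((J * ((e + 1) * n)) * (900 + 60000 * (J * ((e + 1) * n)) / (δ * n)) /
          (ε * n / 2) ^ 2) := by gcongr
      _ = _ := by field_simp; ring

/-! ### Comparison of a trajectory with the fluid limit -/

/-- Discrete Grönwall inequality in summed form. -/
theorem le_mul_pow_of_le_add_sum {e : ℕ → ℝ} {a b : ℝ} (hb : 0 ≤ b) {K : ℕ}
    (h : ∀ k ≤ K, e k ≤ a + b * ∑ i ∈ Finset.range k, e i) {k : ℕ} (hk : k ≤ K) :
    e k ≤ a * (1 + b) ^ k := by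
  induction k using Nat.strong_induction_on with
  | _ k ih =>
    have h1 : ∀ m : ℕ, a + b * ∑ i ∈ Finset.range m, a * (1 + b) ^ i = a * (1 + b) ^ m := by
      intro m
      induction m with
      | zero => simp
      | succ m ihm => rw [Finset.sum_range_succ, mul_add, ← add_assoc, ihm]; ring
    calc e k ≤ a + b * ∑ i ∈ Finset.range k, e i := h k hk
      _ ≤ a + b * ∑ i ∈ Finset.range k, a * (1 + b) ^ i := by
        gcongr with i hi
        have := Finset.mem_range.1 hi
        exact ih i this (by omega)
      _ = _ := h1 k

/-- Euler step for a differentiable curve whose derivative varies little. -/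
theorem norm_sub_sub_smul_le {γ γ' : ℝ → ℝ × ℝ × ℝ} {a b ε : ℝ} (hab : a ≤ b)
    (hγ : ∀ t ∈ Set.Icc a b, HasDerivAt γ (γ' t) t)
    (hε : ∀ t ∈ Set.Icc a b, ‖γ' t - γ' a‖ ≤ ε) :
    ‖γ b - γ a - (b - a) • γ' a‖ ≤ ε * (b - a) := by
  have h1 := Convex.norm_image_sub_le_of_norm_hasDerivWithin_le
    (f := fun t => γ t - t • γ' a) (f' := fun t => γ' t - γ' a) (s := Set.Icc a b) (C := ε)
    (x := a) (y := b)
    (fun t ht => by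
      have := (hγ t ht).sub ((hasDerivAt_id t).smul_const (γ' a))
      rw [one_smul] at this
      exact this.hasDerivWithinAt)
    hε (convex_Icc a b) (Set.left_mem_Icc.2 hab) (Set.right_mem_Icc.2 hab)
  rw [Real.norm_of_nonneg (sub_nonneg.2 hab)] at h1
  have h2 : γ b - γ a - (b - a) • γ' a = γ b - b • γ' a - (γ a - a • γ' a) := by
    rw [sub_smul]; abel
  rw [h2]
  exact h1

/-! ### Pathwise comparison of the rescaled counts with the fluid curve -/

section Deterministic
variable {d : DegreeSequence}

theorem card_univ_halfEdge : (Finset.univ : Finset (HalfEdge d)).card = d.size := by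
  rw [Finset.card_univ, Fintype.card_sigma,
    Finset.sum_congr rfl fun v _ => Fintype.card_fin (Vertex.degree v)]
  simp [Fintype.sum_sum_type, Vertex.degree, DegreeSequence.size, mul_comm, add_assoc]

theorem card_le_size (A : Finset (HalfEdge d)) : A.card ≤ d.size :=
  (Finset.card_le_univ A).trans (Finset.card_univ.symm.trans card_univ_halfEdge).le

theorem norm_rescaledOf_le (A : Finset (HalfEdge d)) : ‖rescaledOf A‖ ≤ mass (rescaledOf A) := by
  have h : ∀ i, 0 ≤ ((legsOf A i).card : ℝ) / d.size := fun i => by positivity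
  simp only [rescaledOf, mass, Prod.norm_def, Real.norm_of_nonneg (h _)]
  refine max_le ?_ (max_le ?_ ?_) <;> linarith [h 1, h 2, h 3]

theorem norm_rescaledOf_le_one (A : Finset (HalfEdge d)) : ‖rescaledOf A‖ ≤ 1 := by
  refine (norm_rescaledOf_le A).trans ?_
  rw [mass_rescaledOf]
  exact div_le_one_of_le₀ (by exact_mod_cast card_le_size A) (by positivity)

theorem rescaledOf_eq_potential (A : Finset (HalfEdge d)) :
    rescaledOf A = (d.size : ℝ)⁻¹ • ((potential vertexOf (legWeight 1) A,
      potential vertexOf (legWeight 2) A, potential vertexOf (legWeight 3) A) : ℝ × ℝ × ℝ) := by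
  simp only [rescaledOf, card_legsOf, Prod.smul_mk, smul_eq_mul, div_eq_inv_mul]

theorem norm_rescaledOf_sub_le {A A' : Finset (HalfEdge d)} (hA : A' ⊆ A) :
    ‖rescaledOf A' - rescaledOf A‖ ≤ 3 * (A \ A').card / d.size := by
  have h : ∀ i ≤ 3, |potential vertexOf (legWeight i) A' - potential vertexOf (legWeight i) A| ≤
      3 * (A \ A').card := fun i hi =>
    abs_potential_sub_le (legWeight_nonneg i) (legWeight_le hi) hA
  rw [rescaledOf_eq_potential, rescaledOf_eq_potential, ← smul_sub, norm_smul, norm_inv,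
    Real.norm_natCast, div_eq_inv_mul]
  gcongr
  exact max_le (h 1 (by norm_num)) (max_le (h 2 (by norm_num)) (h 3 le_rfl))

theorem IsTrajectory.norm_rescaledOf_sub_le {s : ℕ → State d} (hs : IsTrajectory s) {k l : ℕ}
    (hkl : k ≤ l) :
    ‖rescaledOf (s l).2 - rescaledOf (s k).2‖ ≤ 18 * ((l : ℝ) - k) / d.size := by
  induction l, hkl using Nat.le_induction with
  | base => simp
  | succ l _ ih =>
    have h1 := KarpSipser.norm_rescaledOf_sub_le (step_subset (hs.step l))
    have h2 : (((s l).2 \ (s (l + 1)).2).card : ℝ) ≤ 6 := by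
      exact_mod_cast step_card_sdiff_le (hs.step l)
    have h3 : 3 * (((s l).2 \ (s (l + 1)).2).card : ℝ) / d.size ≤ 18 / d.size := by
      gcongr; linarith
    have h4 := norm_sub_le_norm_sub_add_norm_sub (rescaledOf (s (l + 1)).2) (rescaledOf (s l).2)
      (rescaledOf (s k).2)
    have h5 : 18 * (((l + 1 : ℕ) : ℝ) - k) / d.size =
        18 / d.size + 18 * ((l : ℝ) - k) / d.size := by push_cast; ring
    rw [h5]
    linarith

/-- As long as the state is active, the counts are the sum of their drifts and of the noise. -/
theorem rescaledOf_eq_add_noise (hd : 0 < d.size) {U : ℕ → Finset (HalfEdge d)} {s₀ : ℝ} {k : ℕ}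
    (hU : ∀ i < k, IsActive s₀ (U i)) :
    rescaledOf (U k) = rescaledOf (U 0) +
      ∑ i ∈ Finset.range k, (d.size : ℝ)⁻¹ • phi (rescaledOf (U i)) +
      (d.size : ℝ)⁻¹ • ((noiseSum s₀ (legWeight 1) U k, noiseSum s₀ (legWeight 2) U k,
        noiseSum s₀ (legWeight 3) U k) : ℝ × ℝ × ℝ) := by
  induction k with
  | zero => ext <;> simp [noiseSum]
  | succ k ih =>
    have hact := hU k (by omega)
    have hne : (U k).Nonempty := by
      obtain ⟨h, hh⟩ := Finset.nonempty_iff_ne_empty.2 hact.1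
      exact ⟨h, (Finset.mem_filter.1 hh).1⟩
    have hnoise : ∀ c, noiseSum s₀ c U (k + 1) = noiseSum s₀ c U k +
        (potential vertexOf c (U (k + 1)) - potential vertexOf c (U k) -
          meanDrift vertexOf c (U k)) := fun c => by
      rw [noiseSum, Finset.sum_range_succ, noise, if_pos hact]
      rfl
    have ih' := ih fun i hi => hU i (by omega)
    rw [Finset.sum_range_succ, phi_rescaledOf hne hd, hnoise, hnoise, hnoise]
    rw [rescaledOf_eq_potential (U k)] at ih'
    rw [rescaledOf_eq_potential (U (k + 1))]
    simp only [Prod.ext_iff, Prod.fst_add, Prod.snd_add, Prod.smul_fst, Prod.smul_snd,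
      smul_eq_mul] at ih' ⊢
    obtain ⟨h1, h2, h3⟩ := ih'
    refine ⟨?_, ?_, ?_⟩ <;> simp only [mul_add, mul_sub] <;> linarith

/-- Comparison of an active trajectory with small noise to a solution of the fluid equation. -/
theorem norm_rescaledOf_sub_fluid_le (hd : 0 < d.size) {U : ℕ → Finset (HalfEdge d)}
    {γ : ℝ → ℝ × ℝ × ℝ} {T R δ ε : ℝ} {L : NNReal} (hR : 1 ≤ R)
    (hL : LipschitzOnWith L phi {u | ‖u‖ ≤ R ∧ δ ≤ mass u})
    (hγD : ∀ t ∈ Set.Icc 0 T, ‖γ t‖ ≤ R ∧ δ ≤ mass (γ t))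
    (hγ : ∀ t ∈ Set.Icc 0 T, HasDerivAt γ (phi (γ t)) t)
    (hmod : ∀ a ∈ Set.Icc 0 T, ∀ b ∈ Set.Icc 0 T, |a - b| ≤ (d.size : ℝ)⁻¹ →
      ‖phi (γ a) - phi (γ b)‖ ≤ ε)
    (hinit : ‖rescaledOf (U 0) - γ 0‖ ≤ ε)
    {K : ℕ} (hK : (K : ℝ) ≤ T * d.size)
    (hnoise : ∀ k ≤ K, ∀ i ∈ Finset.Icc 1 3,
      |noiseSum (δ * d.size) (legWeight i) U k| ≤ ε * d.size)
    (hU : ∀ i < K, IsActive (δ * d.size) (U i)) :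
    ‖rescaledOf (U K) - γ (K / d.size)‖ ≤ (2 + T) * ε * Real.exp (L * T) := by
  set n : ℝ := (d.size : ℝ) with hn
  have hn0 : 0 < n := by rw [hn]; exact_mod_cast hd
  have hT : 0 ≤ T := by
    have : 0 ≤ T * n := (Nat.cast_nonneg K).trans hK
    exact nonneg_of_mul_nonneg_left this hn0
  have hε : 0 ≤ ε := (norm_nonneg _).trans hinit
  set e : ℕ → ℝ := fun k => ‖rescaledOf (U k) - γ (k / n)‖ with he
  have hmem : ∀ k ≤ K, (k : ℝ) / n ∈ Set.Icc 0 T := fun k hk => by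
    refine ⟨by positivity, ?_⟩
    rw [div_le_iff₀ hn0]
    exact le_trans (by exact_mod_cast hk) hK
  have hstep : ∀ i < K, ‖n⁻¹ • phi (rescaledOf (U i)) - (γ ((i + 1 : ℕ) / n) - γ (i / n))‖ ≤
      L / n * e i + ε / n := by
    intro i hi
    have hi0 := hmem i hi.le
    have hi1 := hmem (i + 1) hi
    have hlen : ((i + 1 : ℕ) : ℝ) / n - i / n = n⁻¹ := by push_cast; field_simp; ring
    have hle : (i : ℝ) / n ≤ (i + 1 : ℕ) / n := by rw [← sub_nonneg, hlen]; positivity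
    have h1 := norm_sub_sub_smul_le (γ := γ) (γ' := fun t => phi (γ t)) (ε := ε) hle
      (fun t ht => hγ t ⟨hi0.1.trans ht.1, ht.2.trans hi1.2⟩)
      (fun t ht => hmod t ⟨hi0.1.trans ht.1, ht.2.trans hi1.2⟩ _ hi0 (by
        rw [abs_of_nonneg (sub_nonneg.2 ht.1), ← hlen]
        exact sub_le_sub_right ht.2 _))
    rw [hlen] at h1
    have hmass : δ ≤ mass (rescaledOf (U i)) := by
      rw [mass_rescaledOf, le_div_iff₀ hn0]
      exact (hU i hi).2
    have h2 := hL.norm_sub_le (x := rescaledOf (U i)) (y := γ (i / n))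
      ⟨(norm_rescaledOf_le_one _).trans hR, hmass⟩ (hγD _ hi0)
    have h3 : ‖n⁻¹ • phi (rescaledOf (U i)) - n⁻¹ • phi (γ (i / n))‖ ≤ L / n * e i := by
      rw [← smul_sub, norm_smul, norm_inv, Real.norm_of_nonneg hn0.le]
      calc n⁻¹ * ‖phi (rescaledOf (U i)) - phi (γ (i / n))‖ ≤ n⁻¹ * (L * e i) := by gcongr
        _ = _ := by ring
    calc _ = ‖(n⁻¹ • phi (rescaledOf (U i)) - n⁻¹ • phi (γ (i / n))) -
          (γ ((i + 1 : ℕ) / n) - γ (i / n) - n⁻¹ • phi (γ (i / n)))‖ := by congr 1; abel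
      _ ≤ _ := norm_sub_le _ _
      _ ≤ L / n * e i + ε * n⁻¹ := add_le_add h3 h1
      _ = _ := by rw [div_eq_mul_inv ε]
  -- The constant (2 + T)ε collects ε from the initial value, ε from the noise, and at most Tn Euler
  -- errors of ε/n.
  have hrec : ∀ k ≤ K, e k ≤ (2 + T) * ε + L / n * ∑ i ∈ Finset.range k, e i := by
    intro k hk
    have h1 := rescaledOf_eq_add_noise hd (k := k) fun i hi => hU i (hi.trans_le hk)
    have h2 : γ (k / n) = γ 0 + ∑ i ∈ Finset.range k, (γ ((i + 1 : ℕ) / n) - γ (i / n)) := by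
      rw [Finset.sum_range_sub fun i : ℕ => γ (i / n)]; simp
    set M : ℝ × ℝ × ℝ := (noiseSum (δ * n) (legWeight 1) U k, noiseSum (δ * n) (legWeight 2) U k,
      noiseSum (δ * n) (legWeight 3) U k) with hM
    have hMn : ‖n⁻¹ • M‖ ≤ ε := by
      rw [norm_smul, norm_inv, Real.norm_of_nonneg hn0.le, inv_mul_le_iff₀ hn0, mul_comm]
      exact max_le (hnoise k hk 1 (by decide)) (max_le (hnoise k hk 2 (by decide))
        (hnoise k hk 3 (by decide)))
    have h3 : rescaledOf (U k) - γ (k / n) = (rescaledOf (U 0) - γ 0) +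
        ∑ i ∈ Finset.range k, (n⁻¹ • phi (rescaledOf (U i)) -
          (γ ((i + 1 : ℕ) / n) - γ (i / n))) + n⁻¹ • M := by
      have h6 := Finset.sum_sub_distrib (s := Finset.range k)
        (fun i => n⁻¹ • phi (rescaledOf (U i))) fun i : ℕ => γ ((i + 1 : ℕ) / n) - γ (i / n)
      rw [← hn] at h1
      rw [h1, h2, h6]
      generalize ∑ i ∈ Finset.range k, (γ ((i + 1 : ℕ) / n) - γ (i / n)) = a
      abel
    have h4 : ‖∑ i ∈ Finset.range k, (n⁻¹ • phi (rescaledOf (U i)) -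
        (γ ((i + 1 : ℕ) / n) - γ (i / n)))‖ ≤ L / n * ∑ i ∈ Finset.range k, e i + T * ε := by
      calc _ ≤ ∑ i ∈ Finset.range k, (L / n * e i + ε / n) :=
            norm_sum_le_of_le _ fun i hi => hstep i ((Finset.mem_range.1 hi).trans_le hk)
        _ = L / n * ∑ i ∈ Finset.range k, e i + k / n * ε := by
            rw [Finset.sum_add_distrib, ← Finset.mul_sum, Finset.sum_const, Finset.card_range,
              nsmul_eq_mul]
            ring
        _ ≤ _ := by
            gcongr
            exact (hmem k hk).2
    calc e k = _ := congrArg norm h3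
      _ ≤ _ := norm_add₃_le
      _ ≤ ε + (L / n * ∑ i ∈ Finset.range k, e i + T * ε) + ε :=
        add_le_add (add_le_add hinit h4) hMn
      _ = _ := by ring
  have hfin := le_mul_pow_of_le_add_sum (by positivity) hrec le_rfl
  refine hfin.trans ?_
  have h6 : (1 + L / n) ^ K ≤ Real.exp (L * T) := by
    have h7 : 1 + (L : ℝ) / n ≤ Real.exp (L / n) := by
      rw [add_comm]; exact Real.add_one_le_exp _
    calc (1 + L / n) ^ K ≤ Real.exp (L / n) ^ K := by gcongr
      _ = Real.exp (L * (K / n)) := by rw [← Real.exp_nat_mul]; congr 1; ring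
      _ ≤ _ := by
        gcongr
        exact (hmem K le_rfl).2
  gcongr

end Deterministic

/-! ### Convergence as long as there are leaves -/

/-- Convergence to a solution of the fluid equation with positive mass, as long as there are
leaves. -/
theorem tendsto_measure_fluid {d : ℕ → DegreeSequence}
    (hsize : Tendsto (fun j => (d j).size) atTop atTop) {Ω : ℕ → Type*}
    [∀ j, MeasurableSpace (Ω j)] {P : ∀ j, Measure (Ω j)} [∀ j, IsProbabilityMeasure (P j)]
    {ξ : ∀ j, ℕ → Ω j → State (d j)} (hξ : ∀ j, IsExploration (P j) (d j) (ξ j))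
    {γ : ℝ → ℝ × ℝ × ℝ}
    (hinit : Tendsto (fun j => rescaledOf (Finset.univ : Finset (HalfEdge (d j)))) atTop (𝓝 (γ 0)))
    (hcont : Continuous γ) {T : ℝ} (hT : 0 ≤ T) (hmass : ∀ t ∈ Set.Icc 0 T, 0 < mass (γ t))
    (hγ : ∀ t ∈ Set.Icc 0 T, HasDerivAt γ (phi (γ t)) t) {ε : ℝ} (hε : 0 < ε) :
    Tendsto (fun j => P j {ω | ∃ k : ℕ, (k : ℝ) ≤ T * (d j).size ∧
      (∀ i < k, legsOf (ξ j i ω).2 1 ≠ ∅) ∧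
      ε < ‖rescaledOf (ξ j k ω).2 - γ (k / (d j).size)‖}) atTop (𝓝 0) := by
  obtain ⟨t₀, ht₀, hmin⟩ := isCompact_Icc.exists_isMinOn (Set.nonempty_Icc.2 hT)
    (continuous_mass.comp hcont).continuousOn
  obtain ⟨R₀, hR₀⟩ := (isCompact_Icc (a := (0 : ℝ)) (b := T)).exists_bound_of_continuousOn
    hcont.continuousOn
  set δ := mass (γ t₀) / 2 with hδdef
  have hδ : 0 < δ := half_pos (hmass t₀ ht₀)
  have hδmass : ∀ t ∈ Set.Icc 0 T, 2 * δ ≤ mass (γ t) := fun t ht => by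
    have : mass (γ t₀) ≤ mass (γ t) := hmin ht
    linarith
  set R := max 1 R₀ with hR
  obtain ⟨L, hL⟩ := exists_lipschitzOnWith_phi hδ R
  -- The mass is 3-Lipschitz and at least 2δ along γ, so a state within δ/3 of the curve has mass at
  -- least δ.
  set ε' := min ε (δ / 3) with hε'
  have hε'0 : 0 < ε' := lt_min hε (by positivity)
  set ε₁ := ε' / ((2 + T) * Real.exp (L * T)) with hε₁
  have hε₁0 : 0 < ε₁ := by positivity
  have hε₁' : (2 + T) * ε₁ * Real.exp (L * T) = ε' := by rw [hε₁]; field_simp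
  have hphic : ContinuousOn (fun t => phi (γ t)) (Set.Icc 0 T) :=
    continuousOn_phi.comp hcont.continuousOn fun t ht => (hmass t ht).ne'
  obtain ⟨ρ, hρ, huc⟩ := Metric.uniformContinuousOn_iff.1
    (isCompact_Icc.uniformContinuousOn_of_continuous hphic) ε₁ hε₁0
  obtain ⟨C, n₀, hC⟩ := exists_measure_noiseSum_le (T := T) hδ hε₁0
  have hsizeR : Tendsto (fun j => ((d j).size : ℝ)) atTop atTop :=
    tendsto_natCast_atTop_atTop.comp hsize
  have hbound : ∀ᶠ j in atTop, P j {ω | ∃ k : ℕ, (k : ℝ) ≤ T * (d j).size ∧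
      (∀ i < k, legsOf (ξ j i ω).2 1 ≠ ∅) ∧
      ε < ‖rescaledOf (ξ j k ω).2 - γ (k / (d j).size)‖} ≤
      3 * ENNReal.ofReal (C / (d j).size) := by
    have hev := Metric.tendsto_nhds.1 hinit ε₁ hε₁0
    filter_upwards [hsizeR.eventually_ge_atTop n₀, hsizeR.eventually_gt_atTop ρ⁻¹,
      hsize.eventually_gt_atTop 0, hev] with j hj1 hj2 hj3 hj4
    set n : ℝ := ((d j).size : ℝ) with hn
    have hn0 : 0 < n := by rw [hn]; exact_mod_cast hj3
    set bad : ℕ → Set (Ω j) := fun i => {ω | ∃ k : ℕ, (k : ℝ) ≤ T * n ∧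
      ε₁ * n < |noiseSum (δ * n) (legWeight i) (fun i => (ξ j i ω).2) k|} with hbad
    have hsub : P j {ω | ∃ k : ℕ, (k : ℝ) ≤ T * n ∧ (∀ i < k, legsOf (ξ j i ω).2 1 ≠ ∅) ∧
        ε < ‖rescaledOf (ξ j k ω).2 - γ (k / n)‖} ≤ P j (⋃ i ∈ Finset.Icc 1 3, bad i) := by
      refine measure_mono_ae ?_
      filter_upwards [(hξ j).ae_isTrajectory] with ω hω
      rintro ⟨k, hkT, hkl, hkε⟩
      by_contra hnot
      have hgood : ∀ l : ℕ, (l : ℝ) ≤ T * n → ∀ i ∈ Finset.Icc 1 3,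
          |noiseSum (δ * n) (legWeight i) (fun i => (ξ j i ω).2) l| ≤ ε₁ * n := by
        intro l hl i hi
        by_contra hlt
        apply hnot
        change ω ∈ ⋃ i ∈ Finset.Icc 1 3, bad i
        exact Set.mem_iUnion₂.2 ⟨i, hi, l, hl, not_le.1 hlt⟩
      have hclose : ∀ l ≤ k, (∀ i < l, IsActive (δ * n) (ξ j i ω).2) →
          ‖rescaledOf (ξ j l ω).2 - γ (l / n)‖ ≤ ε' := by
        intro l hl hact
        have hlT : (l : ℝ) ≤ T * n := le_trans (by exact_mod_cast hl) hkT
        rw [← hε₁']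
        refine norm_rescaledOf_sub_fluid_le (U := fun i => (ξ j i ω).2) hj3 (le_max_left 1 R₀) hL
          (fun t ht => ⟨(hR₀ t ht).trans (le_max_right _ _), ?_⟩) hγ
          (fun a ha b hb hab => ?_) ?_ hlT
          (fun m hm => hgood m (le_trans (by exact_mod_cast hm) hlT)) hact
        · linarith [hδmass t ht]
        · have := huc a ha b hb (by
            rw [Real.dist_eq]
            exact hab.trans_lt (inv_lt_of_inv_lt₀ hρ hj2))
          rw [dist_eq_norm] at this
          exact this.le
        · have h0 : (ξ j 0 ω).2 = Finset.univ := hω.initial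
          rw [dist_eq_norm] at hj4
          simp only [h0]
          exact hj4.le
      -- Bootstrap: activity before time `i` gives closeness at time `i`, and closeness gives
      -- activity at time `i`.
      have hact : ∀ i < k, IsActive (δ * n) (ξ j i ω).2 := by
        intro i
        induction i using Nat.strong_induction_on with
        | _ i ih =>
          intro hik
          have h1 := hclose i hik.le fun m hm => ih m hm (hm.trans hik)
          refine ⟨hkl i hik, ?_⟩
          have h2 := (abs_le.1 (abs_mass_sub_le (rescaledOf (ξ j i ω).2) (γ (i / n)))).1
          have h3 : (i : ℝ) / n ∈ Set.Icc 0 T := by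
            refine ⟨by positivity, ?_⟩
            rw [div_le_iff₀ hn0]
            exact le_trans (by exact_mod_cast hik.le) hkT
          have h4 := hδmass _ h3
          have h5 : ε' ≤ δ / 3 := min_le_right _ _
          rw [mass_rescaledOf] at h2
          rw [← le_div_iff₀ hn0]
          linarith
      exact absurd (hclose k le_rfl hact) (not_le.2 ((min_le_left _ _).trans_lt hkε))
    refine hsub.trans ((measure_biUnion_finset_le _ _).trans ?_)
    calc _ ≤ ∑ _i ∈ Finset.Icc 1 3, ENNReal.ofReal (C / n) := by
          refine Finset.sum_le_sum fun i hi => ?_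
          exact hC (d j) (Ω j) (P j) (ξ j) (hξ j) hj1 (legWeight i) (legWeight_zero i)
            (legWeight_nonneg i) (legWeight_le (Finset.mem_Icc.1 hi).2)
      _ = _ := by simp
  refine tendsto_of_tendsto_of_tendsto_of_le_of_le' tendsto_const_nhds ?_
    (Eventually.of_forall fun _ => zero_le) hbound
  have h1 : Tendsto (fun j => ENNReal.ofReal (C / (d j).size)) atTop (𝓝 0) := by
    have := ENNReal.tendsto_ofReal (hsizeR.const_div_atTop C)
    simpa using this
  simpa using ENNReal.Tendsto.const_mul h1 (Or.inr (by norm_num : (3 : ℝ≥0∞) ≠ ⊤))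

/-! ### Convergence of the exploration -/

section Initial
variable {d : DegreeSequence}

theorem deg_univ (v : Vertex d) :
    deg vertexOf (Finset.univ : Finset (HalfEdge d)) v = Vertex.degree v := by
  have h1 : fiber vertexOf (Finset.univ : Finset (HalfEdge d)) v =
      Finset.univ.image fun i : Fin (Vertex.degree v) => (⟨v, i⟩ : HalfEdge d) := by
    ext ⟨w, i⟩
    simp only [mem_fiber, Finset.mem_univ, true_and, Finset.mem_image]
    constructor
    · rintro rfl
      exact ⟨i, rfl⟩
    · rintro ⟨j, hj⟩
      exact (congrArg Sigma.fst hj).symm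
  rw [deg, h1, Finset.card_image_of_injective _ sigma_mk_injective, Finset.card_univ,
    Fintype.card_fin]

theorem rescaledOf_univ : rescaledOf (Finset.univ : Finset (HalfEdge d)) =
    ((d.d₁ : ℝ) / d.size, (2 * d.d₂ : ℝ) / d.size, (3 * d.d₃ : ℝ) / d.size) := by
  have h : ∀ i : ℕ, ((legsOf (Finset.univ : Finset (HalfEdge d)) i).card : ℝ) =
      d.d₁ * legWeight i 1 + (d.d₂ * legWeight i 2 + d.d₃ * legWeight i 3) := by
    intro i
    rw [card_legsOf, potential, Finset.sum_congr rfl fun v _ => by rw [deg_univ]]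
    simp [Fintype.sum_sum_type, Vertex.degree]
  simp only [rescaledOf, h]
  norm_num [legWeight]
  exact ⟨by ring, by ring⟩

theorem fst_rescaledOf_pos_iff (hd : 0 < d.size) (A : Finset (HalfEdge d)) :
    0 < (rescaledOf A).1 ↔ legsOf A 1 ≠ ∅ := by
  have hn : (0 : ℝ) < d.size := by exact_mod_cast hd
  rw [rescaledOf, div_pos_iff_of_pos_right hn, Nat.cast_pos, Finset.card_pos,
    Finset.nonempty_iff_ne_empty]

end Initial

/-- The exploration follows the fluid limit until shortly before its extinction, and dies out
shortly after. -/
structure FollowsFluid {d : DegreeSequence} (s : ℕ → State d) (γ : ℝ → ℝ × ℝ × ℝ)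
    (tExt η ε : ℝ) : Prop where
  isTrajectory : IsTrajectory s
  close : ∀ k : ℕ, (k : ℝ) ≤ max (tExt - η) 0 * d.size →
    ‖rescaledOf (s k).2 - γ (k / d.size)‖ ≤ ε
  alive : ∀ k : ℕ, (k : ℝ) < max (tExt - η) 0 * d.size → legsOf (s k).2 1 ≠ ∅
  dead : ∃ k : ℕ, (k : ℝ) ≤ (tExt + η) * d.size ∧ legsOf (s k).2 1 = ∅

theorem tendsto_measure_zero_of_eventually_le {Ω : ℕ → Type*}
    [∀ j, MeasurableSpace (Ω j)] {P : ∀ j, Measure (Ω j)} {E F : ∀ j, Set (Ω j)}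
    (hF : Tendsto (fun j => P j (F j)) atTop (𝓝 0)) (h : ∀ᶠ j in atTop, P j (E j) ≤ P j (F j)) :
    Tendsto (fun j => P j (E j)) atTop (𝓝 0) :=
  tendsto_of_tendsto_of_tendsto_of_le_of_le' tendsto_const_nhds hF
    (Eventually.of_forall fun _ => zero_le) h

/-! ### Behaviour before and just after the fluid extinction time -/

section Convergence
variable {d : ℕ → DegreeSequence} {Ω : ℕ → Type*} [∀ j, MeasurableSpace (Ω j)]
  {P : ∀ j, Measure (Ω j)} [∀ j, IsProbabilityMeasure (P j)] {ξ : ∀ j, ℕ → Ω j → State (d j)}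
  {p : ℝ × ℝ × ℝ} {tExt : ℝ} {γ : ℝ → ℝ × ℝ × ℝ}

/-- Convergence until shortly before extinction. -/
theorem tendsto_measure_not_close
    (hsize : Tendsto (fun j => (d j).size) atTop atTop)
    (hξ : ∀ j, IsExploration (P j) (d j) (ξ j)) (hγ : IsFluidTrajectory p tExt γ) (hp : 0 < mass p)
    (hinit : Tendsto (fun j => rescaledOf (Finset.univ : Finset (HalfEdge (d j)))) atTop (𝓝 p))
    {η ε : ℝ} (hη : 0 < η) (hε : 0 < ε) :
    Tendsto (fun j => P j {ω | ∃ k : ℕ, (k : ℝ) ≤ max (tExt - η) 0 * (d j).size ∧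
      (∀ i < k, legsOf (ξ j i ω).2 1 ≠ ∅) ∧
      ε < ‖rescaledOf (ξ j k ω).2 - γ (k / (d j).size)‖}) atTop (𝓝 0) := by
  have hmass : ∀ t ∈ Set.Icc 0 (max (tExt - η) 0), 0 < mass (γ t) := by
    intro t ht
    rcases hγ.nonneg.eq_or_lt with h0 | h0
    · have : t = 0 := by
        refine le_antisymm (ht.2.trans (max_le ?_ le_rfl)) ht.1
        linarith
      rw [this, hγ.initial]
      exact hp
    · exact (hγ.pos t ⟨ht.1, ht.2.trans_lt (max_lt (by linarith) h0)⟩).2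
  exact tendsto_measure_fluid hsize hξ (by rw [hγ.initial]; exact hinit) hγ.continuous
    (le_max_right _ _) hmass (fun t ht => hγ.hasDerivAt t ht.1 (hmass t ht)) hε

/-- The exploration dies out shortly after the extinction time of the fluid limit. -/
theorem tendsto_measure_not_dead
    (hsize : Tendsto (fun j => (d j).size) atTop atTop)
    (hξ : ∀ j, IsExploration (P j) (d j) (ξ j)) (hγ : IsFluidTrajectory p tExt γ) (hp : 0 < mass p)
    (hinit : Tendsto (fun j => rescaledOf (Finset.univ : Finset (HalfEdge (d j)))) atTop (𝓝 p))
    {η : ℝ} (hη : 0 < η) :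
    Tendsto (fun j => P j {ω | ∀ k : ℕ, (k : ℝ) ≤ (tExt + η) * (d j).size →
      legsOf (ξ j k ω).2 1 ≠ ∅}) atTop (𝓝 0) := by
  have hsizeR : Tendsto (fun j => ((d j).size : ℝ)) atTop atTop :=
    tendsto_natCast_atTop_atTop.comp hsize
  have hfloor : ∀ {t n : ℝ}, 0 ≤ t → 0 < n → (⌊t * n⌋₊ : ℝ) / n ≤ t ∧
      t - n⁻¹ ≤ (⌊t * n⌋₊ : ℝ) / n := by
    intro t n ht hn
    have h1 := Nat.floor_le (mul_nonneg ht hn.le)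
    have h2 := Nat.lt_floor_add_one (t * n)
    refine ⟨by rwa [div_le_iff₀ hn], ?_⟩
    rw [le_div_iff₀ hn, sub_mul, inv_mul_cancel₀ hn.ne']
    linarith
  rcases hγ.end_cases with hend | hend
  -- The fluid mass vanishes: shortly before tExt it is below η, so the true rescaled mass is below
  -- η + 3 · η/3 = 2η.
  · have ht0 : 0 < tExt := by
      rcases hγ.nonneg.eq_or_lt with h0 | h0
      · rw [← h0, hγ.initial] at hend
        rw [hend] at hp
        simp [mass] at hp
      · exact h0
    have hcm : Tendsto (fun t => mass (γ t)) (𝓝 tExt) (𝓝 0) := by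
      have := (continuous_mass.comp hγ.continuous).tendsto tExt
      rwa [Function.comp_apply, hend, show mass 0 = 0 by simp [mass]] at this
    obtain ⟨ρ, hρ, hρm⟩ := Metric.eventually_nhds_iff.1 (hcm.eventually_lt_const hη)
    set η' := min ρ tExt / 2 with hη'
    have hη'0 : 0 < η' := half_pos (lt_min hρ ht0)
    have hη'ρ : η' ≤ ρ / 2 := by rw [hη']; gcongr; exact min_le_left _ _
    have hη't : η' ≤ tExt / 2 := by rw [hη']; gcongr; exact min_le_right _ _
    have hm : max (tExt - η') 0 = tExt - η' := max_eq_left (by linarith)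
    refine tendsto_measure_zero_of_eventually_le
      (tendsto_measure_not_close hsize hξ hγ hp hinit hη'0 (show 0 < η / 3 by positivity)) ?_
    filter_upwards [hsizeR.eventually_gt_atTop (2 / ρ), hsize.eventually_gt_atTop 0] with j hj hj0
    set n : ℝ := ((d j).size : ℝ) with hn
    have hn0 : 0 < n := by rw [hn]; exact_mod_cast hj0
    have hnρ : n⁻¹ < ρ / 2 := by
      rw [inv_lt_comm₀ hn0 (by positivity), inv_div]; exact hj
    refine measure_mono_ae ?_
    filter_upwards [(hξ j).ae_isTrajectory] with ω hω
    intro hall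
    change ∀ k : ℕ, (k : ℝ) ≤ (tExt + η) * n → legsOf (ξ j k ω).2 1 ≠ ∅ at hall
    obtain ⟨hk1, hk2⟩ := hfloor (t := tExt - η') (by linarith) hn0
    set k₀ := ⌊(tExt - η') * n⌋₊ with hk₀
    have hk1' : (k₀ : ℝ) ≤ (tExt - η') * n := by rwa [div_le_iff₀ hn0] at hk1
    have hk1'' : (tExt - η') * n ≤ (tExt + η) * n := by gcongr; linarith
    refine ⟨k₀, by rw [hm]; exact hk1', fun i hi => hall i ?_, ?_⟩
    · have : (i : ℝ) ≤ k₀ := by exact_mod_cast hi.le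
      linarith
    · by_contra hclose
      have h1 := (abs_le.1 ((abs_mass_sub_le (rescaledOf (ξ j k₀ ω).2) (γ (k₀ / n))).trans
        (mul_le_mul_of_nonneg_left (not_lt.1 hclose) (by norm_num)))).2
      have h2 : mass (γ (k₀ / n)) < η := hρm (by
        rw [Real.dist_eq, abs_lt]
        constructor <;> linarith)
      rw [mass_rescaledOf] at h1
      have h3 : ((ξ j k₀ ω).2.card : ℝ) < 2 * η * n := by
        rw [← div_lt_iff₀ hn0]
        change ((ξ j k₀ ω).2.card : ℝ) / n < _
        linarith
      set k₁ := ⌊(tExt + η) * n⌋₊ with hk₁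
      have hk₁' : (k₁ : ℝ) ≤ (tExt + η) * n := Nat.floor_le (by positivity)
      have hk₁'' : (tExt + η) * n < k₁ + 1 := Nat.lt_floor_add_one _
      have hle : k₀ ≤ k₁ := Nat.floor_le_floor hk1''
      -- Leaves at all times up to `k₁` would mean more than ηn steps from `k₀` on, erasing two
      -- half-edges each, although fewer than 2ηn are left.
      have h4 := hω.card_add_le k₀ (k₁ + 1 - k₀) fun i _ hi => hall i (by
        have : (i : ℝ) ≤ k₁ := by exact_mod_cast (by omega : i ≤ k₁)
        linarith)
      have h5 : 2 * ((k₁ : ℝ) + 1 - k₀) ≤ (ξ j k₀ ω).2.card := by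
        have h6 : 2 * (k₁ + 1) ≤ (ξ j k₀ ω).2.card + 2 * k₀ := by omega
        have h7 : 2 * ((k₁ : ℝ) + 1) ≤ (ξ j k₀ ω).2.card + 2 * k₀ := by exact_mod_cast h6
        linarith
      have h8 : η * n ≤ (tExt + η) * n - (tExt - η') * n := by nlinarith
      linarith
  -- The fluid X is negative at a time T < tExt + η; a process with leaves up to T would have to
  -- follow it there, while its own count is nonnegative.
  · obtain ⟨T, hT, hTneg, hTmass⟩ := hend η hη
    have hT0 : 0 ≤ T := hγ.nonneg.trans hT.1.le
    set ε := -(γ T).1 / 2 with hε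
    have hε0 : 0 < ε := by rw [hε]; linarith
    have hcx : Tendsto (fun t => (γ t).1) (𝓝 T) (𝓝 (γ T).1) :=
      (continuous_fst.comp hγ.continuous).tendsto T
    obtain ⟨ρ, hρ, hρm⟩ := Metric.eventually_nhds_iff.1
      (hcx.eventually_lt_const (show (γ T).1 < -ε by rw [hε]; linarith))
    refine tendsto_measure_zero_of_eventually_le
      (tendsto_measure_fluid hsize hξ (by rw [hγ.initial]; exact hinit) hγ.continuous hT0 hTmass
        (fun t ht => hγ.hasDerivAt t ht.1 (hTmass t ht)) hε0) ?_
    filter_upwards [hsizeR.eventually_gt_atTop (1 / ρ), hsize.eventually_gt_atTop 0] with j hj hj0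
    set n : ℝ := ((d j).size : ℝ) with hn
    have hn0 : 0 < n := by rw [hn]; exact_mod_cast hj0
    have hnρ : n⁻¹ < ρ := by
      rw [inv_lt_comm₀ hn0 hρ, ← one_div]; exact hj
    refine measure_mono fun ω hall => ?_
    change ∀ k : ℕ, (k : ℝ) ≤ (tExt + η) * n → legsOf (ξ j k ω).2 1 ≠ ∅ at hall
    obtain ⟨hk1, hk2⟩ := hfloor hT0 hn0
    set k₀ := ⌊T * n⌋₊ with hk₀
    have hk1' : (k₀ : ℝ) ≤ T * n := by rwa [div_le_iff₀ hn0] at hk1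
    have hk1'' : T * n ≤ (tExt + η) * n := by gcongr; exact hT.2.le
    refine ⟨k₀, hk1', fun i hi => hall i ?_, ?_⟩
    · have : (i : ℝ) ≤ k₀ := by exact_mod_cast hi.le
      linarith
    · have h1 : (γ (k₀ / n)).1 < -ε := hρm (by
        rw [Real.dist_eq, abs_lt]
        constructor <;> linarith)
      have h2 : 0 ≤ (rescaledOf (ξ j k₀ ω).2).1 := by
        simp only [rescaledOf]; positivity
      have h3 : |(rescaledOf (ξ j k₀ ω).2).1 - (γ (k₀ / n)).1| ≤
        ‖rescaledOf (ξ j k₀ ω).2 - γ (k₀ / n)‖ :=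
        norm_fst_le (rescaledOf (ξ j k₀ ω).2 - γ (k₀ / n))
      have h4 := le_abs_self ((rescaledOf (ξ j k₀ ω).2).1 - (γ (k₀ / n)).1)
      change ε < ‖rescaledOf (ξ j k₀ ω).2 - γ (k₀ / n)‖
      linarith

/-- With high probability, the exploration follows the fluid limit. -/
theorem tendsto_measure_not_followsFluid
    (hsize : Tendsto (fun j => (d j).size) atTop atTop)
    (hξ : ∀ j, IsExploration (P j) (d j) (ξ j)) (hγ : IsFluidTrajectory p tExt γ) (hp : 0 < mass p)
    (hinit : Tendsto (fun j => rescaledOf (Finset.univ : Finset (HalfEdge (d j)))) atTop (𝓝 p))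
    {η ε : ℝ} (hη : 0 < η) (hε : 0 < ε) :
    Tendsto (fun j => P j {ω | ¬ FollowsFluid (fun k => ξ j k ω) γ tExt η ε}) atTop (𝓝 0) := by
  set m := max (tExt - η) 0 with hm
  have hm0 : 0 ≤ m := le_max_right _ _
  -- Half the minimum of X on [0, m]. If tExt = 0 the interval is empty and any `b` serves.
  obtain ⟨b, hb, hbX⟩ : ∃ b > 0, ∀ t ∈ Set.Ico 0 m, b < (γ t).1 := by
    rcases hγ.nonneg.eq_or_lt with h0 | h0
    · refine ⟨1, one_pos, fun t ht => ?_⟩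
      have : m ≤ 0 := max_le (by linarith) le_rfl
      exact absurd (ht.1.trans_lt ht.2) (not_lt.2 this)
    · obtain ⟨t₀, ht₀, hmin⟩ := isCompact_Icc.exists_isMinOn (Set.nonempty_Icc.2 hm0)
        (continuous_fst.comp hγ.continuous).continuousOn
      have hpos := (hγ.pos t₀ ⟨ht₀.1, ht₀.2.trans_lt (max_lt (by linarith) h0)⟩).1
      refine ⟨(γ t₀).1 / 2, half_pos hpos, fun t ht => ?_⟩
      have : (γ t₀).1 ≤ (γ t).1 := hmin ⟨ht.1, ht.2.le⟩
      linarith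
  have h1 := tendsto_measure_not_close hsize hξ hγ hp hinit hη (lt_min hε hb)
  have h2 := tendsto_measure_not_dead hsize hξ hγ hp hinit hη
  have h3 := h1.add h2
  rw [add_zero] at h3
  refine tendsto_of_tendsto_of_tendsto_of_le_of_le' tendsto_const_nhds h3
    (Eventually.of_forall fun _ => zero_le) ?_
  filter_upwards [hsize.eventually_gt_atTop 0] with j hj0
  set n : ℝ := ((d j).size : ℝ) with hn
  have hn0 : 0 < n := by rw [hn]; exact_mod_cast hj0
  refine le_trans (measure_mono_ae ?_) (measure_union_le _ _)
  filter_upwards [(hξ j).ae_isTrajectory] with ω hω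
  intro hnot
  by_contra hgood
  have hgood' : ¬ ((∃ k : ℕ, (k : ℝ) ≤ m * n ∧ (∀ i < k, legsOf (ξ j i ω).2 1 ≠ ∅) ∧
      min ε b < ‖rescaledOf (ξ j k ω).2 - γ (k / n)‖) ∨
      ∀ k : ℕ, (k : ℝ) ≤ (tExt + η) * n → legsOf (ξ j k ω).2 1 ≠ ∅) := hgood
  push Not at hgood'
  obtain ⟨hclose, k₁, hk₁, hdead⟩ := hgood'
  apply hnot
  -- Induction: leaves before `k` give closeness within `b` at `k`, and since the fluid X exceeds
  -- `b`, there are leaves at `k`.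
  have halive : ∀ k : ℕ, (k : ℝ) < m * n → legsOf (ξ j k ω).2 1 ≠ ∅ := by
    intro k
    induction k using Nat.strong_induction_on with
    | _ k ih =>
      intro hk
      have h4 := hclose k hk.le fun i hi =>
        Finset.nonempty_iff_ne_empty.2 (ih i hi (lt_trans (by exact_mod_cast hi) hk))
      have h5 : b < (γ (k / n)).1 := hbX _ ⟨by positivity, by rwa [div_lt_iff₀ hn0]⟩
      have h6 : |(rescaledOf (ξ j k ω).2).1 - (γ (k / n)).1| ≤
        ‖rescaledOf (ξ j k ω).2 - γ (k / n)‖ :=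
        norm_fst_le (rescaledOf (ξ j k ω).2 - γ (k / n))
      have h7 := neg_abs_le ((rescaledOf (ξ j k ω).2).1 - (γ (k / n)).1)
      have h8 : min ε b ≤ b := min_le_right _ _
      exact (fst_rescaledOf_pos_iff hj0 _).1 (by linarith)
  refine ⟨hω, fun k hk => ?_, halive, k₁, hk₁, hdead⟩
  exact (hclose k hk fun i hi => Finset.nonempty_iff_ne_empty.2 (halive i
    (lt_of_lt_of_le (by exact_mod_cast hi) hk))).trans (min_le_left _ _)

end Convergence

/-! ### Deterministic consequences of following the fluid limit -/

section Consequences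
variable {d : DegreeSequence} {s : ℕ → State d} {γ : ℝ → ℝ × ℝ × ℝ} {tExt η ε : ℝ}

/-- The field `alive` bounds the extinction time below. The field `dead` bounds it above and shows
that the infimum is attained, so the default value of `sInf ∅` plays no role. -/
theorem FollowsFluid.abs_extinctionTime_sub_le {Ω : Type*} {ξ : ℕ → Ω → State d} {ω : Ω}
    (h : FollowsFluid (fun k => ξ k ω) γ tExt η ε) (hd : 0 < d.size) :
    |(extinctionTime ξ ω : ℝ) / d.size - tExt| ≤ η := by
  have hn0 : (0 : ℝ) < d.size := by exact_mod_cast hd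
  obtain ⟨k, hk, hdead⟩ := h.dead
  have hmem : (State.legs (ξ k ω) 1).card = 0 := Finset.card_eq_zero.2 hdead
  have h1 : extinctionTime ξ ω ≤ k := Nat.sInf_le hmem
  have h2 : (State.legs (ξ (extinctionTime ξ ω) ω) 1).card = 0 :=
    Nat.sInf_mem (s := {k : ℕ | (State.legs (ξ k ω) 1).card = 0}) ⟨k, hmem⟩
  have h3 : max (tExt - η) 0 * d.size ≤ extinctionTime ξ ω := by
    by_contra hlt
    exact h.alive _ (not_le.1 hlt) (Finset.card_eq_zero.1 h2)
  have h4 : (extinctionTime ξ ω : ℝ) ≤ (tExt + η) * d.size :=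
    le_trans (by exact_mod_cast h1) hk
  have h5 : tExt - η ≤ max (tExt - η) 0 := le_max_left _ _
  rw [abs_le]
  constructor
  · have : max (tExt - η) 0 ≤ (extinctionTime ξ ω : ℝ) / d.size := by rwa [le_div_iff₀ hn0]
    linarith
  · have : (extinctionTime ξ ω : ℝ) / d.size ≤ tExt + η := by rwa [div_le_iff₀ hn0]
    linarith

/-- Up to m = max(tExt - η, 0), closeness and the modulus of continuity of γ suffice. After m at
most 2ηn + 1 steps remain before freezing, each moving the triple by at most 18/n, while γ on [m,
tExt] is controlled by its modulus. -/
theorem FollowsFluid.norm_rescaledOf_sub_le (h : FollowsFluid s γ tExt η ε) (hd : 0 < d.size)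
    (ht : 0 ≤ tExt) (hη : 0 ≤ η)
    (hmod : ∀ a ∈ Set.Icc 0 tExt, ∀ b ∈ Set.Icc 0 tExt, |a - b| ≤ (d.size : ℝ)⁻¹ + η →
      ‖γ a - γ b‖ ≤ ε) {t : ℝ} (ht0 : 0 ≤ t) :
    ‖rescaledOf (s ⌊t * d.size⌋₊).2 - γ (min t tExt)‖ ≤
      2 * ε + 18 * (2 * η + (d.size : ℝ)⁻¹) := by
  set n : ℝ := (d.size : ℝ) with hn
  have hn0 : 0 < n := by rw [hn]; exact_mod_cast hd
  have hinv : 0 < n⁻¹ := by positivity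
  set m := max (tExt - η) 0 with hm
  have hm0 : 0 ≤ m := le_max_right _ _
  have hmt : m ≤ tExt := max_le (by linarith) ht
  have hmη : tExt - η ≤ m := le_max_left _ _
  have hfloor : ∀ {t : ℝ}, 0 ≤ t → (⌊t * n⌋₊ : ℝ) / n ≤ t ∧ t - n⁻¹ ≤ (⌊t * n⌋₊ : ℝ) / n ∧
      (⌊t * n⌋₊ : ℝ) ≤ t * n := by
    intro t ht
    have h1 := Nat.floor_le (mul_nonneg ht hn0.le)
    have h2 := Nat.lt_floor_add_one (t * n)
    refine ⟨by rwa [div_le_iff₀ hn0], ?_, h1⟩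
    rw [le_div_iff₀ hn0, sub_mul, inv_mul_cancel₀ hn0.ne']
    linarith
  have hbefore : ∀ r t : ℝ, 0 ≤ r → r ≤ m → r ≤ t → t ≤ tExt → t ≤ r + η →
      ‖rescaledOf (s ⌊r * n⌋₊).2 - γ t‖ ≤ 2 * ε := by
    intro r t hr hrm hrt htE htr
    obtain ⟨h1, h2, h3⟩ := hfloor hr
    have h4 := h.close ⌊r * n⌋₊ (h3.trans (by gcongr))
    have h5 := hmod (⌊r * n⌋₊ / n) ⟨by positivity, by linarith⟩ t ⟨by linarith, htE⟩ (by
      rw [abs_le]; constructor <;> linarith)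
    have h6 := norm_sub_le_norm_sub_add_norm_sub (rescaledOf (s ⌊r * n⌋₊).2) (γ (⌊r * n⌋₊ / n)) (γ t)
    linarith
  rcases le_or_gt t m with htm | htm
  · rw [min_eq_left (htm.trans hmt)]
    have := hbefore t t ht0 htm le_rfl (htm.trans hmt) (by linarith)
    linarith
  · have h1 := hbefore m (min t tExt) hm0 le_rfl (le_min htm.le hmt) (min_le_right _ _)
      ((min_le_right _ _).trans (by linarith))
    obtain ⟨k, hk, hdead⟩ := h.dead
    obtain ⟨-, h2, h3⟩ := hfloor hm0
    have hk0 : ⌊m * n⌋₊ ≤ k := by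
      by_contra hlt
      refine h.alive k (lt_of_lt_of_le ?_ h3) hdead
      exact_mod_cast not_le.1 hlt
    have hle : ⌊m * n⌋₊ ≤ ⌊t * n⌋₊ := Nat.floor_le_floor (by gcongr)
    have hfreeze : s ⌊t * n⌋₊ = s (min ⌊t * n⌋₊ k) := by
      rcases le_total ⌊t * n⌋₊ k with h4 | h4
      · rw [min_eq_left h4]
      · rw [min_eq_right h4]; exact h.isTrajectory.frozen hdead h4
    have h4 := h.isTrajectory.norm_rescaledOf_sub_le (le_min hle hk0)
    have h5 : ((min ⌊t * n⌋₊ k : ℕ) : ℝ) ≤ (tExt + η) * n :=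
      le_trans (by exact_mod_cast min_le_right _ _) hk
    have h6 : 18 * (((min ⌊t * n⌋₊ k : ℕ) : ℝ) - ⌊m * n⌋₊) / n ≤ 18 * (2 * η + n⁻¹) := by
      rw [mul_div_assoc]
      gcongr
      rw [sub_div]
      have : ((min ⌊t * n⌋₊ k : ℕ) : ℝ) / n ≤ tExt + η := by rwa [div_le_iff₀ hn0]
      linarith
    rw [hfreeze]
    have h7 := norm_sub_le_norm_sub_add_norm_sub (rescaledOf (s (min ⌊t * n⌋₊ k)).2)
      (rescaledOf (s ⌊m * n⌋₊).2) (γ (min t tExt))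
    linarith

end Consequences

end KarpSipser

theorem proposition3p1
    (d : ℕ → DegreeSequence)
    (heven : ∀ j, Even (d j).size)
    (hsize : Tendsto (fun j => (d j).size) atTop atTop)
    (p₁ p₂ p₃ : ℝ)
    (h₁ : Tendsto (fun j => ((d j).d₁ : ℝ) / (d j).size) atTop (𝓝 p₁))
    (h₂ : Tendsto (fun j => (2 * (d j).d₂ : ℝ) / (d j).size) atTop (𝓝 p₂))
    (h₃ : Tendsto (fun j => (3 * (d j).d₃ : ℝ) / (d j).size) atTop (𝓝 p₃))
    (hp : 0 < p₁ ∨ 0 < p₃)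
    (Ω : ℕ → Type*) [∀ j, MeasurableSpace (Ω j)]
    (P : ∀ j, Measure (Ω j)) [∀ j, IsProbabilityMeasure (P j)]
    (ξ : ∀ j, ℕ → Ω j → State (d j))
    (hξ : ∀ j, IsExploration (P j) (d j) (ξ j)) :
    ∃ (tExt : ℝ) (γ : ℝ → ℝ × ℝ × ℝ),
      IsFluidSolution (p₁, p₂, p₃) tExt γ ∧
      (∀ (T : ℝ) (η : ℝ → ℝ × ℝ × ℝ), IsFluidSolution (p₁, p₂, p₃) T η →
        T = tExt ∧ Set.EqOn η γ (Set.Icc 0 tExt)) ∧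
      (∀ ε : ℝ, 0 < ε →
        Tendsto (fun j => P j {ω | ∃ t : ℝ, 0 ≤ t ∧
            ε < dist (ξ j ⌊t * (d j).size⌋₊ ω).rescaled (γ (min t tExt))})
          atTop (𝓝 0)) ∧
      (∀ ε : ℝ, 0 < ε →
        Tendsto (fun j => P j {ω |
            ε < |(extinctionTime (ξ j) ω : ℝ) / (d j).size - tExt|})
          atTop (𝓝 0)) := by
  have hinit : Tendsto (fun j => rescaledOf (Finset.univ : Finset (HalfEdge (d j)))) atTop
      (𝓝 (p₁, p₂, p₃)) := by
    simp only [rescaledOf_univ]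
    exact h₁.prodMk_nhds (h₂.prodMk_nhds h₃)
  have hsizeR : Tendsto (fun j => ((d j).size : ℝ)) atTop atTop :=
    tendsto_natCast_atTop_atTop.comp hsize
  have hsum : p₁ + p₂ + p₃ = 1 := by
    have hlim := (continuous_mass.tendsto _).comp hinit
    refine tendsto_nhds_unique hlim (tendsto_const_nhds.congr' ?_)
    filter_upwards [hsize.eventually_gt_atTop 0] with j hj
    have hn : ((d j).size : ℝ) ≠ 0 := by positivity
    simp only [Function.comp_apply, mass_rescaledOf, card_univ_halfEdge, div_self hn]
  obtain ⟨tExt, γ, hγ⟩ := exists_fluid_trajectory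
    (ge_of_tendsto' h₁ fun j => by positivity) (ge_of_tendsto' h₂ fun j => by positivity)
    (ge_of_tendsto' h₃ fun j => by positivity) hsum hp
  have hmass : 0 < mass (p₁, p₂, p₃) := by
    simp only [mass, hsum]; exact one_pos
  refine ⟨tExt, γ, hγ.isFluidSolution, fun T η hη => hγ.eq_of_isFluidSolution hη,
    fun ε hε => ?_, fun ε hε => ?_⟩
  · obtain ⟨ρ, hρ, huc⟩ := Metric.uniformContinuousOn_iff.1
      ((isCompact_Icc (a := (0 : ℝ)) (b := tExt)).uniformContinuousOn_of_continuous
        hγ.continuous.continuousOn) (ε / 4) (by positivity)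
    -- With 1/n < ε/72 the error is at most 2 · ε/4 + 18 (2 · ε/144 + ε/72) = ε, and 1/n + η < ρ.
    set η := min (ρ / 2) (ε / 144) with hη
    have hη0 : 0 < η := lt_min (by positivity) (by positivity)
    refine tendsto_measure_zero_of_eventually_le (tendsto_measure_not_followsFluid hsize hξ hγ
      hmass hinit hη0 (show 0 < ε / 4 by positivity)) ?_
    filter_upwards [hsize.eventually_gt_atTop 0, hsizeR.eventually_gt_atTop (2 / ρ),
      hsizeR.eventually_gt_atTop (72 / ε)] with j hj0 hj1 hj2
    have hn0 : (0 : ℝ) < (d j).size := by exact_mod_cast hj0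
    have hinv1 : ((d j).size : ℝ)⁻¹ < ρ / 2 := by
      rw [inv_lt_comm₀ hn0 (by positivity), inv_div]; exact hj1
    have hinv2 : ((d j).size : ℝ)⁻¹ < ε / 72 := by
      rw [inv_lt_comm₀ hn0 (by positivity), inv_div]; exact hj2
    refine measure_mono ?_
    rintro ω ⟨t, ht0, hlt⟩ hfollow
    have h1 := hfollow.norm_rescaledOf_sub_le hj0 hγ.nonneg hη0.le (fun a ha b hb hab => by
      have := huc a ha b hb (by
        rw [Real.dist_eq]
        refine hab.trans_lt ?_
        have : η ≤ ρ / 2 := min_le_left _ _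
        linarith)
      rw [dist_eq_norm] at this
      exact this.le) ht0
    rw [dist_eq_norm, rescaled_eq_rescaledOf] at hlt
    have h2 : η ≤ ε / 144 := min_le_right _ _
    linarith
  -- Here η = ε; the closeness tolerance 1 is arbitrary, as only the times of `alive` and `dead`
  -- matter.
  · refine tendsto_measure_zero_of_eventually_le (tendsto_measure_not_followsFluid hsize hξ hγ
      hmass hinit hε one_pos) ?_
    filter_upwards [hsize.eventually_gt_atTop 0] with j hj0
    refine measure_mono ?_
    intro ω hlt hfollow
    exact absurd (hfollow.abs_extinctionTime_sub_le hj0) (not_le.2 hlt)
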